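/- Let $\phi:\mathbb R\to\mathbb R$, $A\in\mathbb R^{n\times n}$ (arbitrary, possibly unstable) and $B\in\mathbb R^{n\times p}$ with $p\ge n\ge 1$ and minimum singular value $\sigma_{\min}(B)>0$, and let $T_0\ge 1$ be an integer. Suppose that $\phi$ is $\beta$-increasing for some $\beta>0$: $\phi(0)=0$ and $\beta\le\phi'(x)\le 1$ for all $x$. (Kinks, as in the leaky ReLU, are allowed: then $\beta(y-x)\le\phi(y)-\phi(x)\le y-x$ for all $x\le y$, and $\phi'$ takes any value in $[\beta,1]$ at points where $\phi$ is not differentiable.) Consider $N$ independent trajectories, for $1\le i\le N$, \[ h^{(i)}_0=0,\qquad h^{(i)}_{t+1}=\phi\big(Ah^{(i)}_t+Bu^{(i)}_t\big)\quad(t\ge 0), \] where $\phi$ acts entrywise and all the inputs $u^{(i)}_t\in\mathbb R^p$ are i.i.d. $\mathcal N(0,I_p)$. Let $\|\cdot\|$ be the spectral norm and put \[ B_t=\|B\|\sqrt{\frac{1-\|A\|^{2t}}{1-\|A\|^2}},\qquad \bar\rho=\frac{B_{T_0}^2}{\beta^2\sigma_{\min}(B)^2},\qquad \rho=\begin{cases}\bar\rho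 & \text{if } n>1,\\[2pt] \bar\rho\,\dfrac{1-\beta^2|A|^2}{1-(\beta|A|)^{2T_0}} & \text{if } n=1,\end{cases} \] where a quotient $\frac{1-a^{2t}}{1-a^2}$ with $a=1$ is read as its limit $t$ (and its reciprocal as $1/t$). One sample is taken from each trajectory at time $T_0$: with the scaling $\mu=1/B_{T_0}$ set \[ y_i=h^{(i)}_{T_0+1},\qquad x_i=\begin{bmatrix}\mu h^{(i)}_{T_0}\\ u^{(i)}_{T_0}\end{bmatrix}\in\mathbb R^{n+p},\qquad C_\star=[\mu^{-1}A\;\;B]\in\mathbb R^{n\times(n+p)},\qquad \mathcal L_i(\Theta)=\tfrac12\|y_i-\phi(\Theta x_i)\|_{\ell_2}^2 , \] so that $y_i=\phi(C_\star x_i)$. From $\Theta_0\in\mathbb R^{n\times(n+p)}$ run SGD, $\Theta_{\tau}=\Theta_{\tau-1}-\eta\nabla\mathcal L_{\gamma_\tau}(\Theta_{\tau-1})$ for $\tau\ge 1$, where $\gamma_1,\gamma_2,\dots$ are i.i.d. uniform on $\{1,\dots,N\}$ and independent of the data, and where the $(j,k)$ entry of $\nabla\mathcal L_i(\Theta)$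 is $(\phi((\Theta x_i)_j)-y_{i,j})\,\phi'((\Theta x_i)_j)\,x_{i,k}$. There are absolute constants $C,c,c_0>0$ such that the following holds for all such $n,p,N,T_0,\beta,\phi,A,B$. If \[ N\ge C\rho^2(n+p)\qquad\text{and}\qquad \eta=c_0\frac{\beta^2}{\rho\,n(n+p)}, \] then, with probability at least $1-2Ne^{-100(n+p)}-4e^{-cN/\rho^2}$ over the data, for every $\Theta_0$ and every $\tau\ge 0$, \[ \mathbb E\big[\|\Theta_\tau-C_\star\|_F^2\big]\le\Big(1-c_0\frac{\beta^4}{2\rho^2n(n+p)}\Big)^{\tau}\|\Theta_0-C_\star\|_F^2, \] where the expectation is over the SGD indices $\gamma_1,\gamma_2,\dots$ only. -/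

import Mathlib

open MeasureTheory ProbabilityTheory Matrix
open scoped BigOperators

namespace RNN

noncomputable section

/-- The squared Euclidean norm `∑ j, v j ^ 2` of a vector. -/
def normSq {m : ℕ} (v : Fin m → ℝ) : ℝ := ∑ j, v j ^ 2

/-- The squared Frobenius norm of a matrix. -/
def frobSq {ι κ : Type} [Fintype ι] [Fintype κ] (M : Matrix ι κ ℝ) : ℝ := ∑ i, ∑ j, M i j ^ 2

/-- The spectral norm of a matrix: its operator norm between Euclidean spaces. -/
def specNorm {m k : ℕ} (M : Matrix (Fin m) (Fin k) ℝ) : ℝ :=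
  ‖LinearMap.toContinuousLinearMap (Matrix.toEuclideanLin M)‖

/-- The minimum singular value of an `m × k` matrix, that is, its `min m k`-th largest singular
value (Mathlib numbers the singular values from `0`, in decreasing order). -/
def sigmaMin {m k : ℕ} (M : Matrix (Fin m) (Fin k) ℝ) : ℝ :=
  (Matrix.toEuclideanLin M).singularValues (min m k - 1)

/-- `φ` is a `β`-increasing activation with derivative `φ'`: `φ 0 = 0` and `β ≤ φ' ≤ 1`.
For a differentiable `φ` this forces `φ' = deriv φ`, and the two slope bounds follow from the
bounds on `φ'` by the mean value theorem (see `IsIncreasingActivation.of_hasDerivAt`). The slope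
bounds are stated so that activations with kinks, such as the leaky ReLU `x ↦ max (β * x) x`, are
covered too; at a kink `φ'` may take any value in `[β, 1]`. -/
structure IsIncreasingActivation (β : ℝ) (φ φ' : ℝ → ℝ) : Prop where
  map_zero : φ 0 = 0
  le_deriv : ∀ x, β ≤ φ' x
  deriv_le : ∀ x, φ' x ≤ 1
  eq_deriv : ∀ x, DifferentiableAt ℝ φ x → φ' x = deriv φ x
  le_slope : ∀ x y, x ≤ y → β * (y - x) ≤ φ y - φ x
  slope_le : ∀ x y, x ≤ y → φ y - φ x ≤ y - x

theorem IsIncreasingActivation.of_hasDerivAt {β : ℝ} {φ φ' : ℝ → ℝ} (h0 : φ 0 = 0)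
    (hd : ∀ x, HasDerivAt φ (φ' x) x) (hl : ∀ x, β ≤ φ' x) (hu : ∀ x, φ' x ≤ 1) :
    IsIncreasingActivation β φ φ' where
  map_zero := h0
  le_deriv := hl
  deriv_le := hu
  eq_deriv := fun x _ => (hd x).deriv.symm
  le_slope := fun _ _ hxy =>
    mul_sub_le_image_sub_of_le_deriv (fun z => (hd z).differentiableAt)
      (fun z => (hd z).deriv.symm ▸ hl z) hxy
  slope_le := fun x y hxy => by
    have := image_sub_le_mul_sub_of_deriv_le (f := φ) (C := 1)
      (fun z => (hd z).differentiableAt) (fun z => (hd z).deriv.symm ▸ hu z) hxy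
    linarith

/-- The state vectors `h_t` of the system `h_{t+1} = φ(A h_t + B u_t)`, `h_0 = 0`, driven by the
input sequence `u`, with `φ` applied entrywise. -/
def state {n p : ℕ} (φ : ℝ → ℝ) (A : Matrix (Fin n) (Fin n) ℝ) (B : Matrix (Fin n) (Fin p) ℝ)
    (u : ℕ → Fin p → ℝ) : ℕ → Fin n → ℝ
  | 0 => 0
  | t + 1 => fun j => φ ((A *ᵥ state φ A B u t + B *ᵥ u t) j)

/-- The geometric sum `1 + a² + ⋯ + a^{2(t-1)}`, which is `(1 - a^{2t}) / (1 - a²)` if `a² ≠ 1`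
(see `geomSq_eq`) and the limit `t` of this quotient if `a² = 1`. -/
def geomSq (a : ℝ) (t : ℕ) : ℝ := ∑ i ∈ Finset.range t, (a ^ 2) ^ i

theorem geomSq_eq {a : ℝ} (ha : a ^ 2 ≠ 1) (t : ℕ) :
    geomSq a t = (1 - a ^ (2 * t)) / (1 - a ^ 2) := by
  rw [geomSq, geom_sum_eq ha, pow_mul, ← neg_div_neg_eq]
  simp only [neg_sub]

/-- `B_t = ‖B‖ √((1 - ‖A‖^{2t}) / (1 - ‖A‖²))`. -/
def stateBound {n p : ℕ} (A : Matrix (Fin n) (Fin n) ℝ) (B : Matrix (Fin n) (Fin p) ℝ)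
    (t : ℕ) : ℝ :=
  specNorm B * √(geomSq (specNorm A) t)

/-- The condition number bound: `ρ = ρ'` if `n > 1` and
`ρ = ρ' (1 - β²|A|²) / (1 - (β|A|)^{2T₀})` if `n = 1`, where `ρ' = B_{T₀}² / (β² σ_min(B)²)`. -/
def condNumber {n p : ℕ} (β : ℝ) (A : Matrix (Fin n) (Fin n) ℝ) (B : Matrix (Fin n) (Fin p) ℝ)
    (T₀ : ℕ) : ℝ :=
  if n = 1 then
    stateBound A B T₀ ^ 2 / (β ^ 2 * sigmaMin B ^ 2) / geomSq (β * specNorm A) T₀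
  else
    stateBound A B T₀ ^ 2 / (β ^ 2 * sigmaMin B ^ 2)

/-- The regression input `x = [μ h; u]`, where `h` and `u` are the state and the input at time
`T₀` of the trajectory driven by `u`. -/
def sampleInput {n p : ℕ} (φ : ℝ → ℝ) (A : Matrix (Fin n) (Fin n) ℝ)
    (B : Matrix (Fin n) (Fin p) ℝ) (μ : ℝ) (T₀ : ℕ) (u : ℕ → Fin p → ℝ) : Fin n ⊕ Fin p → ℝ :=
  Sum.elim (μ • state φ A B u T₀) (u T₀)

/-- The regression output: the state at time `T₀ + 1`. -/
def sampleOutput {n p : ℕ} (φ : ℝ → ℝ) (A : Matrix (Fin n) (Fin n) ℝ)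
    (B : Matrix (Fin n) (Fin p) ℝ) (T₀ : ℕ) (u : ℕ → Fin p → ℝ) : Fin n → ℝ :=
  state φ A B u (T₀ + 1)

/-- The ground truth `C = [μ⁻¹ A, B]`. -/
def groundTruth {n p : ℕ} (A : Matrix (Fin n) (Fin n) ℝ) (B : Matrix (Fin n) (Fin p) ℝ) (μ : ℝ) :
    Matrix (Fin n) (Fin n ⊕ Fin p) ℝ :=
  Matrix.fromCols (μ⁻¹ • A) B

/-- The loss `½ ‖y - φ(Θ x)‖²` of a single sample. -/
def sampleLoss {n p : ℕ} (φ : ℝ → ℝ) (x : Fin n ⊕ Fin p → ℝ) (y : Fin n → ℝ)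
    (Θ : Matrix (Fin n) (Fin n ⊕ Fin p) ℝ) : ℝ :=
  1 / 2 * normSq (fun j => y j - φ ((Θ *ᵥ x) j))

/-- The gradient of `sampleLoss` in `Θ`: the matrix with the entries
`(φ((Θ x)_j) - y_j) φ'((Θ x)_j) x_k` (see `hasDerivAt_sampleLoss`). -/
def lossGrad {n p : ℕ} (φ φ' : ℝ → ℝ) (x : Fin n ⊕ Fin p → ℝ) (y : Fin n → ℝ)
    (Θ : Matrix (Fin n) (Fin n ⊕ Fin p) ℝ) : Matrix (Fin n) (Fin n ⊕ Fin p) ℝ :=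
  Matrix.of fun j k => (φ ((Θ *ᵥ x) j) - y j) * φ' ((Θ *ᵥ x) j) * x k

/-- Where `φ'` is the derivative of `φ`, the matrix `lossGrad` is the gradient of the loss: the
derivative of the loss in the direction `D` is the entrywise inner product of `lossGrad` and `D`. -/
theorem hasDerivAt_sampleLoss {n p : ℕ} {φ φ' : ℝ → ℝ} {x : Fin n ⊕ Fin p → ℝ} {y : Fin n → ℝ}
    {Θ : Matrix (Fin n) (Fin n ⊕ Fin p) ℝ}
    (h : ∀ j, HasDerivAt φ (φ' ((Θ *ᵥ x) j)) ((Θ *ᵥ x) j))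
    (D : Matrix (Fin n) (Fin n ⊕ Fin p) ℝ) :
    HasDerivAt (fun s : ℝ => sampleLoss φ x y (Θ + s • D))
      (∑ j, ∑ k, lossGrad φ φ' x y Θ j k * D j k) 0 := by
  have hlin : ∀ (j : Fin n) (s : ℝ), ((Θ + s • D) *ᵥ x) j = (Θ *ᵥ x) j + s * (D *ᵥ x) j := by
    intro j s
    simp [Matrix.add_mulVec, Matrix.smul_mulVec]
  have hj : ∀ j : Fin n, HasDerivAt (fun s : ℝ => (y j - φ ((Θ *ᵥ x) j + s * (D *ᵥ x) j)) ^ 2)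
      (2 * (∑ k, lossGrad φ φ' x y Θ j k * D j k)) 0 := by
    intro j
    have h1 : HasDerivAt (fun s : ℝ => (Θ *ᵥ x) j + s * (D *ᵥ x) j) ((D *ᵥ x) j) 0 := by
      simpa using ((hasDerivAt_id (0 : ℝ)).mul_const ((D *ᵥ x) j)).const_add ((Θ *ᵥ x) j)
    have h2 : HasDerivAt φ (φ' ((Θ *ᵥ x) j)) ((Θ *ᵥ x) j + 0 * (D *ᵥ x) j) := by
      simpa using h j
    have h3 := ((h2.comp (0 : ℝ) h1).const_sub (y j)).pow 2
    refine h3.congr_deriv ?_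
    have : ∑ k, lossGrad φ φ' x y Θ j k * D j k
        = (φ ((Θ *ᵥ x) j) - y j) * φ' ((Θ *ᵥ x) j) * (D *ᵥ x) j := by
      simp only [lossGrad, Matrix.of_apply, Matrix.mulVec, dotProduct, Finset.mul_sum]
      exact Finset.sum_congr rfl fun k _ => by ring
    rw [this]
    simp
    ring
  have hsum := (HasDerivAt.fun_sum (u := Finset.univ) fun j _ => hj j).const_mul (1 / 2 : ℝ)
  simp only [sampleLoss, normSq, hlin]
  refine hsum.congr_deriv ?_
  rw [← Finset.mul_sum]
  ring

/-- The SGD iterates with learning rate `η`, started at `Θ₀`, on the samples `(x i, y i)`; step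
`τ` uses the sample with index `r τ`. -/
def sgd {n p N : ℕ} (φ φ' : ℝ → ℝ) (η : ℝ) (x : Fin N → Fin n ⊕ Fin p → ℝ)
    (y : Fin N → Fin n → ℝ) (Θ₀ : Matrix (Fin n) (Fin n ⊕ Fin p) ℝ) (r : ℕ → Fin N) :
    ℕ → Matrix (Fin n) (Fin n ⊕ Fin p) ℝ
  | 0 => Θ₀
  | τ + 1 => sgd φ φ' η x y Θ₀ r τ -
      η • lossGrad φ φ' (x (r τ)) (y (r τ)) (sgd φ φ' η x y Θ₀ r τ)

end

end RNN

namespace RNN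

/-! ### Integration of product functions on finite products. -/

open scoped ENNReal NNReal

/-! The noiseless loss is one-point convex around the ground truth. With d the difference of the two
preactivations in row j, that row of the gradient is g x, where β² d² ≤ g d and |g| ≤ |d|. Hence a
step on a sample with ‖x‖² ≤ X lowers the squared Frobenius distance by at least (2ηβ² - η²X) times
the sum of the d² (`frobSq_step_le`). Averaging over the uniform index turns this sum into the
empirical second moment form, so a lower bound l on that form gives geometric decay in expectation
(`integral_frobSq_sgd_le`). The probabilistic task is to reach X = 1000 (n + p) and l = 7 / (24 ρ)
simultaneously.

Stability plays no role because the horizon is finite. Since φ is 1-Lipschitz, the map from the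
inputs to μ h is 1-Lipschitz for Euclidean norms, all growth being absorbed by the scaling
`stateBound`; the same holds for the whole regression input. The bound on ‖x‖² comes from a
recursion on exponential moments along the trajectory (`lintegral_exp_state_le`).

The samples need not be centred, so they are grouped into disjoint pairs and only differences within
a pair are studied. These have mean zero, and their second moments are dominated by those of the
samples (`sum_sq_sub_le`). Three facts are needed. (a) Lower bound on the population moment:
shifting the Gaussian inputs along a suitable c moves w·x at a definite rate. By Cameron–Martin and
Cauchy–Schwarz the variance of w·x is then large (`EuclLipschitz.sq_le_of_increasing`). The rate
comes from φ' ≥ β and a right inverse of B, and yields variance at least ‖w‖²/ρ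
(`le_integral_sq_dotProduct_sampleInput`). In dimension one all past inputs can be shifted with
compatible signs, which explains the better ρ there. (b) Concentration in one direction: the
rotation argument of Maurey and Pisier bounds exponential moments of f(X) - f(Y) for Lipschitz f,
and then those of its square (`EuclLipschitz.lintegral_exp_sq_le`). A Bernstein bound follows
(`measureReal_abs_sum_sub_ge_le`). (c) Uniformity over directions: a net of at most 5^(n+p) points
and polarisation (`abs_le_of_half_net`). -/

theorem lintegral_pi_fin_prod {n : ℕ} {E : Type*} [MeasurableSpace E]
    (μ : Fin n → Measure E) [∀ i, SigmaFinite (μ i)]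
    (f : Fin n → E → ℝ≥0∞) (hf : ∀ i, Measurable (f i)) :
    ∫⁻ x, ∏ i, f i (x i) ∂(Measure.pi μ) = ∏ i, ∫⁻ x, f i x ∂(μ i) := by
  induction n with
  | zero => simp
  | succ n ih =>
    calc
      _ = ∫⁻ x : E × (Fin n → E), f 0 x.1 * ∏ i : Fin n, f i.succ (x.2 i)
            ∂((μ 0).prod (Measure.pi fun i => μ i.succ)) := by
        rw [← ((measurePreserving_piFinSuccAbove μ 0).symm).lintegral_comp_emb
          (MeasurableEquiv.measurableEmbedding _)]
        refine lintegral_congr fun x => ?_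
        simp [Fin.prod_univ_succ, MeasurableEquiv.piFinSuccAbove_symm_apply, Fin.insertNthEquiv]
      _ = (∫⁻ x, f 0 x ∂μ 0) * ∏ i : Fin n, ∫⁻ x, f i.succ x ∂(μ i.succ) := by
        rw [← ih _ _ fun i => hf _, ← lintegral_prod_mul (hf 0).aemeasurable]
        exact (Finset.measurable_prod _ fun i _ =>
          (hf i.succ).comp (measurable_pi_apply i)).aemeasurable
      _ = _ := by rw [Fin.prod_univ_succ]

/-- Tonelli's theorem for a product of functions of the single coordinates. -/
theorem lintegral_pi_prod {ι : Type*} [Fintype ι] {E : Type*} [MeasurableSpace E]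
    (μ : ι → Measure E) [∀ i, SigmaFinite (μ i)]
    (f : ι → E → ℝ≥0∞) (hf : ∀ i, Measurable (f i)) :
    ∫⁻ x, ∏ i, f i (x i) ∂(Measure.pi μ) = ∏ i, ∫⁻ x, f i x ∂(μ i) := by
  let e := (Fintype.equivFin ι).symm
  rw [← (measurePreserving_piCongrLeft μ e).lintegral_comp_emb
    (MeasurableEquiv.measurableEmbedding _), ← e.prod_comp,
    ← lintegral_pi_fin_prod (fun i => μ (e i)) _ fun i => hf _]
  refine lintegral_congr fun x => ?_
  rw [← e.prod_comp]
  simp_rw [MeasurableEquiv.coe_piCongrLeft, Equiv.piCongrLeft_apply_apply]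

/-- The standard Gaussian measure on `ι → ℝ`. -/
noncomputable abbrev stdG (ι : Type*) [Fintype ι] : Measure (ι → ℝ) :=
  Measure.pi fun _ => gaussianReal 0 1

/-! ### The standard Gaussian measure: density, shifts, exponential moments, rotations. -/

section

variable {ι : Type*} [Fintype ι]

theorem stdG_eq_withDensity :
    stdG ι = (volume : Measure (ι → ℝ)).withDensity (fun x => ∏ i, gaussianPDF 0 1 (x i)) := by
  refine Measure.pi_eq fun s hs => ?_
  rw [withDensity_apply _ (MeasurableSet.univ_pi hs), ← lintegral_indicator (MeasurableSet.univ_pi hs)]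
  have : ∀ x : ι → ℝ, (Set.univ.pi s).indicator (fun x => ∏ i, gaussianPDF 0 1 (x i)) x
      = ∏ i, (s i).indicator (gaussianPDF 0 1) (x i) := by
    intro x
    by_cases hx : x ∈ Set.univ.pi s
    · rw [Set.indicator_of_mem hx]
      exact Finset.prod_congr rfl fun i _ => (Set.indicator_of_mem (hx i trivial) _).symm
    · rw [Set.indicator_of_notMem hx]
      obtain ⟨i, hi⟩ : ∃ i, x i ∉ s i := by simpa [Set.mem_pi] using hx
      exact (Finset.prod_eq_zero (Finset.mem_univ i) (Set.indicator_of_notMem hi _)).symm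
  simp_rw [this]
  rw [volume_pi, lintegral_pi_prod _ _ fun i => (measurable_gaussianPDF 0 1).indicator (hs i)]
  refine Finset.prod_congr rfl fun i _ => ?_
  rw [lintegral_indicator (hs i), gaussianReal_apply _ one_ne_zero]

theorem stdG_absolutelyContinuous : stdG ι ≪ (volume : Measure (ι → ℝ)) := by
  rw [stdG_eq_withDensity]
  exact withDensity_absolutelyContinuous _ _

theorem measurable_prod_gaussianPDF :
    Measurable fun x : ι → ℝ => ∏ i, gaussianPDF 0 1 (x i) :=
  Finset.measurable_prod _ fun i _ => (measurable_gaussianPDF 0 1).comp (measurable_pi_apply i)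

/-- The Cameron–Martin formula for lower Lebesgue integrals. -/
theorem lintegral_stdG_add (c : ι → ℝ) (F : (ι → ℝ) → ℝ≥0∞) (hF : Measurable F) :
    ∫⁻ x, F (x + c) ∂(stdG ι)
      = ∫⁻ x, ENNReal.ofReal (Real.exp (c ⬝ᵥ x - c ⬝ᵥ c / 2)) * F x ∂(stdG ι) := by
  have hm : Measurable fun x : ι → ℝ => ENNReal.ofReal (Real.exp (c ⬝ᵥ x - c ⬝ᵥ c / 2)) := by
    unfold dotProduct
    fun_prop
  have hF' : Measurable fun x => F (x + c) := hF.comp (measurable_add_const c)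
  have hG : Measurable fun x =>
      ENNReal.ofReal (Real.exp (c ⬝ᵥ x - c ⬝ᵥ c / 2)) * F x := hm.mul hF
  rw [stdG_eq_withDensity, lintegral_withDensity_eq_lintegral_mul _ measurable_prod_gaussianPDF
    hF', lintegral_withDensity_eq_lintegral_mul _ measurable_prod_gaussianPDF hG]
  refine Eq.symm ?_
  -- Translating by c on the right matches the arguments of F. The exponential factor then
  -- compensates exactly for the change of density, coordinate by coordinate.
  rw [← lintegral_add_right_eq_self _ c]
  refine lintegral_congr fun x => ?_
  have h1 : ENNReal.ofReal (Real.exp (c ⬝ᵥ (x + c) - c ⬝ᵥ c / 2))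
      = ∏ i, ENNReal.ofReal (Real.exp (c i * x i + c i ^ 2 / 2)) := by
    rw [← ENNReal.ofReal_prod_of_nonneg fun i _ => (Real.exp_pos _).le, ← Real.exp_sum]
    congr 2
    simp only [dotProduct, Finset.sum_add_distrib, ← Finset.sum_div, Pi.add_apply, mul_add, pow_two]
    ring
  have h2 : ∀ y d : ℝ, gaussianPDF 0 1 (y + d) * ENNReal.ofReal (Real.exp (d * y + d ^ 2 / 2))
      = gaussianPDF 0 1 y := by
    intro y d
    rw [gaussianPDF, gaussianPDF, ← ENNReal.ofReal_mul (gaussianPDFReal_nonneg _ _ _)]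
    congr 1
    simp only [gaussianPDFReal]
    rw [mul_assoc, ← Real.exp_add]
    congr 2
    simp
    ring
  simp only [Pi.mul_apply, h1]
  rw [← mul_assoc, ← Finset.prod_mul_distrib]
  simp only [Pi.add_apply, h2]

/-- Completing the square: the integrand times the standard density is a constant times the Gaussian
density with mean a / (1 - 2κ) and variance 1 / (1 - 2κ). -/
theorem lintegral_exp_gaussianReal {κ : ℝ} (hκ : 2 * κ < 1) (a : ℝ) :
    ∫⁻ g, ENNReal.ofReal (Real.exp (a * g + κ * g ^ 2)) ∂(gaussianReal 0 1)
      = ENNReal.ofReal ((√(1 - 2 * κ))⁻¹ * Real.exp (a ^ 2 / (2 * (1 - 2 * κ)))) := by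
  have h1 : 0 < 1 - 2 * κ := by linarith
  let v : ℝ≥0 := ⟨(1 - 2 * κ)⁻¹, by positivity⟩
  have hv : v ≠ 0 := by
    intro h
    have : (v : ℝ) = 0 := by rw [h]; rfl
    have h2 : (v : ℝ) = (1 - 2 * κ)⁻¹ := rfl
    rw [h2] at this
    have := inv_pos.2 h1
    linarith
  have key : ∀ g : ℝ, gaussianPDF 0 1 g * ENNReal.ofReal (Real.exp (a * g + κ * g ^ 2))
      = ENNReal.ofReal ((√(1 - 2 * κ))⁻¹ * Real.exp (a ^ 2 / (2 * (1 - 2 * κ))))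
        * gaussianPDF (a / (1 - 2 * κ)) v g := by
    intro g
    rw [gaussianPDF, gaussianPDF, ← ENNReal.ofReal_mul (gaussianPDFReal_nonneg _ _ _),
      ← ENNReal.ofReal_mul (by positivity)]
    congr 1
    simp only [gaussianPDFReal]
    have h2 : (v : ℝ) = (1 - 2 * κ)⁻¹ := rfl
    have h3 : √(2 * Real.pi * (v : ℝ)) = √(2 * Real.pi) * (√(1 - 2 * κ))⁻¹ := by
      rw [h2, Real.sqrt_mul (by positivity), Real.sqrt_inv]
    have h4 : √(1 - 2 * κ) ≠ 0 := by positivity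
    have h5 : √(2 * Real.pi) ≠ 0 := by positivity
    rw [h3]
    have e1 : ∀ a b c d : ℝ, a * b * (c * d) = (a * c) * (b * d) := by intros; ring
    rw [mul_assoc, ← Real.exp_add, e1, ← Real.exp_add]
    congr 1
    · simp
      field_simp
    · congr 1
      rw [h2]
      simp
      field_simp
      ring
  rw [gaussianReal_of_var_ne_zero _ one_ne_zero, lintegral_withDensity_eq_lintegral_mul _
    (measurable_gaussianPDF 0 1) (by fun_prop)]
  simp only [Pi.mul_apply, key]
  rw [lintegral_const_mul _ (measurable_gaussianPDF _ _), lintegral_gaussianPDF_eq_one _ hv, mul_one]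

theorem lintegral_exp_stdG {κ : ℝ} (hκ : 2 * κ < 1) (a : ι → ℝ) :
    ∫⁻ g, ENNReal.ofReal (Real.exp (a ⬝ᵥ g + κ * (g ⬝ᵥ g))) ∂(stdG ι)
      = ENNReal.ofReal ((√(1 - 2 * κ))⁻¹ ^ Fintype.card ι
          * Real.exp (a ⬝ᵥ a / (2 * (1 - 2 * κ)))) := by
  have h : ∀ g : ι → ℝ, ENNReal.ofReal (Real.exp (a ⬝ᵥ g + κ * (g ⬝ᵥ g)))
      = ∏ i, ENNReal.ofReal (Real.exp (a i * g i + κ * g i ^ 2)) := by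
    intro g
    rw [← ENNReal.ofReal_prod_of_nonneg fun i _ => (Real.exp_pos _).le, ← Real.exp_sum]
    simp only [dotProduct, Finset.mul_sum, ← Finset.sum_add_distrib, pow_two]
  simp_rw [h]
  rw [lintegral_pi_prod _ (fun i x => ENNReal.ofReal (Real.exp (a i * x + κ * x ^ 2)))
    fun i => by fun_prop]
  simp_rw [lintegral_exp_gaussianReal hκ]
  rw [← ENNReal.ofReal_prod_of_nonneg fun i _ => by positivity, Finset.prod_mul_distrib,
    Finset.prod_const, ← Real.exp_sum, Finset.card_univ]
  simp only [dotProduct, Finset.sum_div, pow_two]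

theorem lintegral_exp_dotProduct_stdG (a : ι → ℝ) :
    ∫⁻ g, ENNReal.ofReal (Real.exp (a ⬝ᵥ g)) ∂(stdG ι)
      = ENNReal.ofReal (Real.exp (a ⬝ᵥ a / 2)) := by
  simpa using lintegral_exp_stdG (κ := 0) (by norm_num) a

theorem measurable_dotProduct_left (a : ι → ℝ) : Measurable fun g : ι → ℝ => a ⬝ᵥ g := by
  unfold dotProduct; fun_prop

theorem integrable_exp_dotProduct_stdG (a : ι → ℝ) :
    Integrable (fun g => Real.exp (a ⬝ᵥ g)) (stdG ι) := by
  refine ⟨(measurable_dotProduct_left a).exp.aestronglyMeasurable, ?_⟩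
  rw [hasFiniteIntegral_iff_ofReal (ae_of_all _ fun _ => (Real.exp_pos _).le),
    lintegral_exp_dotProduct_stdG]
  exact ENNReal.ofReal_lt_top

theorem integral_exp_dotProduct_stdG (a : ι → ℝ) :
    ∫ g, Real.exp (a ⬝ᵥ g) ∂(stdG ι) = Real.exp (a ⬝ᵥ a / 2) := by
  rw [integral_eq_lintegral_of_nonneg_ae (ae_of_all _ fun _ => (Real.exp_pos _).le)
    (measurable_dotProduct_left a).exp.aestronglyMeasurable, lintegral_exp_dotProduct_stdG,
    ENNReal.toReal_ofReal (Real.exp_pos _).le]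

instance : IsGaussian (stdG ι) := by
  have h1 : ∀ i, HasGaussianLaw (fun x : ι → ℝ => x i) (stdG ι) := fun i =>
    ⟨by rw [(measurePreserving_eval (fun _ : ι => gaussianReal 0 1) i).map_eq]; infer_instance⟩
  have h2 : iIndepFun (fun (i : ι) (x : ι → ℝ) => x i) (stdG ι) :=
    iIndepFun_pi (X := fun _ x => x) fun i => aemeasurable_id
  have h3 := (iIndepFun.hasGaussianLaw h1 h2).isGaussian_map
  simpa using h3

theorem integral_eval_stdG (i : ι) : ∫ x, x i ∂(stdG ι) = 0 := by
  have h := (measurePreserving_eval (fun _ : ι => gaussianReal 0 1) i).map_eq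
  rw [← integral_map (f := fun y : ℝ => y) (φ := fun x : ι → ℝ => x i)
    (measurable_pi_apply i).aemeasurable measurable_id.aestronglyMeasurable]
  change ∫ y, y ∂((stdG ι).map (Function.eval i)) = 0
  rw [h, integral_id_gaussianReal]

/-- The product of two standard Gaussian measures is invariant under rotations. -/
theorem stdG_prod_map_rotation (θ : ℝ) :
    ((stdG ι).prod (stdG ι)).map (ContinuousLinearMap.rotation θ) = (stdG ι).prod (stdG ι) := by
  refine IsGaussian.map_rotation_eq_self ?_ θ
  ext i
  rw [eval_integral]
  · simpa using integral_eval_stdG i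
  · exact fun i => (IsGaussian.integrable_dual (stdG ι) (ContinuousLinearMap.proj i))

end

open scoped Topology

/-! ### Concentration of Lipschitz functions of Gaussian vectors. -/

section

variable {ι : Type*} [Fintype ι]

theorem dotProduct_self_nonneg' (x : ι → ℝ) : 0 ≤ x ⬝ᵥ x :=
  Finset.sum_nonneg fun i _ => mul_self_nonneg (x i)

/-- Lipschitz functions for the Euclidean distance on `ι → ℝ`. -/
def EuclLipschitz (L : ℝ) (f : (ι → ℝ) → ℝ) : Prop :=
  ∀ x y, |f x - f y| ≤ L * √((x - y) ⬝ᵥ (x - y))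

/-- The metric on `ι → ℝ` is the sup metric. The dimensional factor is harmless, since this version
only serves measurability and Rademacher's theorem. -/
theorem EuclLipschitz.lipschitzWith {L : ℝ} (hL : 0 ≤ L) {f : (ι → ℝ) → ℝ}
    (hf : EuclLipschitz L f) :
    LipschitzWith (Real.toNNReal (L * √(Fintype.card ι))) f := by
  refine LipschitzWith.of_dist_le_mul fun x y => ?_
  rw [Real.coe_toNNReal _ (by positivity), Real.dist_eq, mul_assoc]
  refine (hf x y).trans (mul_le_mul_of_nonneg_left ?_ hL)
  rw [← Real.sqrt_sq (dist_nonneg (x := x) (y := y)), ← Real.sqrt_mul (by positivity)]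
  refine Real.sqrt_le_sqrt ?_
  calc (x - y) ⬝ᵥ (x - y) ≤ ∑ _i : ι, dist x y ^ 2 := by
        refine Finset.sum_le_sum fun i _ => ?_
        have : |(x - y) i| ≤ dist x y := by
          rw [Pi.sub_apply, ← Real.dist_eq]; exact dist_le_pi_dist x y i
        rw [← pow_two, ← sq_abs]
        exact pow_le_pow_left₀ (abs_nonneg _) this 2
    _ = _ := by simp

/-- The gradient of a function on `ι → ℝ`. -/
noncomputable def grad [DecidableEq ι] (f : (ι → ℝ) → ℝ) (x : ι → ℝ) : ι → ℝ :=
  fun i => fderiv ℝ f x (Pi.single i 1)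

theorem grad_dotProduct [DecidableEq ι] (f : (ι → ℝ) → ℝ) (x y : ι → ℝ) :
    grad f x ⬝ᵥ y = fderiv ℝ f x y := by
  conv_rhs => rw [pi_eq_sum_univ' y]
  simp [grad, dotProduct, mul_comm]

theorem measurable_grad [DecidableEq ι] (f : (ι → ℝ) → ℝ) : Measurable (grad f) :=
  measurable_pi_iff.2 fun _ => measurable_fderiv_apply_const ℝ f _

/-- The directional derivative along v is at most L ‖v‖; taking v to be the gradient itself gives
‖∇f‖² ≤ L ‖∇f‖. -/
theorem EuclLipschitz.grad_le [DecidableEq ι] {L : ℝ} (hL : 0 ≤ L) {f : (ι → ℝ) → ℝ}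
    (hf : EuclLipschitz L f) {x : ι → ℝ} (hx : DifferentiableAt ℝ f x) :
    grad f x ⬝ᵥ grad f x ≤ L ^ 2 := by
  have h1 : ∀ v : ι → ℝ, |fderiv ℝ f x v| ≤ L * √(v ⬝ᵥ v) := by
    intro v
    have hd : HasDerivAt (fun t : ℝ => f (x + t • v)) (fderiv ℝ f x v) 0 := by
      have h2 : HasDerivAt (fun t : ℝ => x + t • v) v 0 := by
        simpa using ((hasDerivAt_id (0 : ℝ)).smul_const v).const_add x
      have h3 : HasFDerivAt f (fderiv ℝ f x) (x + (0 : ℝ) • v) := by simpa using hx.hasFDerivAt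
      exact h3.comp_hasDerivAt (0 : ℝ) h2
    refine hd.le_of_lip' (by positivity) (Filter.Eventually.of_forall fun t => ?_)
    have h4 := hf (x + t • v) (x + (0 : ℝ) • v)
    have h5 : x + t • v - (x + (0 : ℝ) • v) = t • v := by simp
    rw [h5, smul_dotProduct, dotProduct_smul, smul_eq_mul, smul_eq_mul, ← mul_assoc, ← pow_two,
      Real.sqrt_mul (sq_nonneg t), Real.sqrt_sq_eq_abs] at h4
    rw [Real.norm_eq_abs, Real.norm_eq_abs, sub_zero]
    linarith
  have h2 := h1 (grad f x)
  rw [← grad_dotProduct, abs_of_nonneg (dotProduct_self_nonneg' _)] at h2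
  set s := grad f x ⬝ᵥ grad f x
  have hs : 0 ≤ s := dotProduct_self_nonneg' _
  have h3 := Real.sq_sqrt hs
  have h4 := Real.sqrt_nonneg s
  rcases h4.eq_or_lt with h5 | h5
  · rw [← h5] at h3
    rw [← h3]; simpa using sq_nonneg L
  · have : √s ≤ L := by
      by_contra h
      push Not at h
      nlinarith
    rw [← h3]
    exact pow_le_pow_left₀ h4 this 2

/-- A rotation path connects the two coordinates; the exponential of the difference of the values
at the endpoints is bounded by that of a rescaled short increment. -/
theorem lintegral_exp_sub_le_increment {f : (ι → ℝ) → ℝ} (hf : Measurable f) (m : ℕ) (hm : m ≠ 0) :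
    ∫⁻ z, ENNReal.ofReal (Real.exp (f z.1 - f z.2)) ∂((stdG ι).prod (stdG ι))
      ≤ ∫⁻ z, ENNReal.ofReal (Real.exp (m * (f z.1 - f (Real.cos (Real.pi / 2 / m) • z.1
          + Real.sin (Real.pi / 2 / m) • z.2)))) ∂((stdG ι).prod (stdG ι)) := by
  set δ : ℝ := Real.pi / 2 / m
  have hm' : (0 : ℝ) < m := by positivity
  let R : ℝ → (ι → ℝ) × (ι → ℝ) → (ι → ℝ) × (ι → ℝ) := fun θ => ContinuousLinearMap.rotation θ
  have hR : ∀ θ z, R θ z = (Real.cos θ • z.1 + Real.sin θ • z.2,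
      -Real.sin θ • z.1 + Real.cos θ • z.2) := fun θ z => ContinuousLinearMap.rotation_apply θ z
  have hRm : ∀ θ, Measurable (R θ) := fun θ => (ContinuousLinearMap.rotation θ).continuous.measurable
  let h : (ι → ℝ) × (ι → ℝ) → ℝ := fun z => m * (f z.1 - f (Real.cos δ • z.1 + Real.sin δ • z.2))
  have hhm : Measurable h := by
    refine measurable_const.mul ((hf.comp measurable_fst).sub (hf.comp ?_))
    fun_prop
  have hstep : ∀ (k : ℕ) z, h (R (k * δ) z) = m * (f (R (k * δ) z).1 - f (R ((k + 1 : ℕ) * δ) z).1) := by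
    intro k z
    simp only [h]
    congr 3
    simp only [hR]
    push_cast
    rw [add_mul, one_mul, Real.cos_add, Real.sin_add]
    ext i
    simp only [Pi.add_apply, Pi.smul_apply, smul_eq_mul]
    ring
  -- The first coordinate of the rotated pair runs from z.1 at angle 0 to z.2 at angle π/2. The
  -- difference telescopes into an average of m scaled increments, to which Jensen's inequality
  -- applies; by rotation invariance all of them have the same law.
  have htel : ∀ z : (ι → ℝ) × (ι → ℝ), f z.1 - f z.2
      = ∑ k ∈ Finset.range m, (m : ℝ)⁻¹ • h (R (k * δ) z) := by
    intro z
    simp only [hstep, smul_eq_mul, inv_mul_cancel_left₀ hm'.ne']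
    rw [Finset.sum_range_sub' (fun k : ℕ => f (R (k * δ) z).1)]
    have h1 : (m : ℝ) * δ = Real.pi / 2 := by simp only [δ]; field_simp
    rw [h1]
    simp [hR]
  have hpt : ∀ z : (ι → ℝ) × (ι → ℝ), ENNReal.ofReal (Real.exp (f z.1 - f z.2))
      ≤ ∑ k ∈ Finset.range m, ENNReal.ofReal (m : ℝ)⁻¹ * ENNReal.ofReal (Real.exp (h (R (k * δ) z))) := by
    intro z
    simp_rw [← ENNReal.ofReal_mul (inv_nonneg.2 hm'.le)]
    rw [← ENNReal.ofReal_sum_of_nonneg fun i _ => by positivity]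
    refine ENNReal.ofReal_le_ofReal ?_
    rw [htel z]
    refine (convexOn_exp.map_sum_le (fun i _ => by positivity) ?_ fun i _ => trivial).trans ?_
    · simp [hm'.ne']
    · simp
  refine (lintegral_mono hpt).trans ?_
  rw [lintegral_finsetSum _ fun k _ => by
    exact measurable_const.mul (hhm.comp (hRm _)).exp.ennreal_ofReal]
  have : ∀ k : ℕ, ∫⁻ z, ENNReal.ofReal (m : ℝ)⁻¹ * ENNReal.ofReal (Real.exp (h (R (k * δ) z)))
      ∂((stdG ι).prod (stdG ι)) = ENNReal.ofReal (m : ℝ)⁻¹ *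
        ∫⁻ z, ENNReal.ofReal (Real.exp (h z)) ∂((stdG ι).prod (stdG ι)) := by
    intro k
    have hmk : Measurable fun z => ENNReal.ofReal (Real.exp (h (R (k * δ) z))) :=
      (hhm.comp (hRm _)).exp.ennreal_ofReal
    rw [lintegral_const_mul _ hmk]
    congr 1
    conv_rhs => rw [← stdG_prod_map_rotation (k * δ)]
    rw [lintegral_map hhm.exp.ennreal_ofReal (hRm _)]
  simp_rw [this]
  rw [Finset.sum_const, Finset.card_range, nsmul_eq_mul, ← mul_assoc,
    show (m : ℝ≥0∞) = ENNReal.ofReal (m : ℝ) by simp, ← ENNReal.ofReal_mul hm'.le,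
    mul_inv_cancel₀ hm'.ne', ENNReal.ofReal_one, one_mul]

/-- Provides the integrable majorant for the limit of small rotation angles; it is finite because
1/4 < 1/2. -/
theorem lintegral_exp_quarter_stdG_prod_lt_top (a : ℝ) :
    ∫⁻ z : (ι → ℝ) × (ι → ℝ), ENNReal.ofReal (Real.exp (a + (z.1 ⬝ᵥ z.1 + z.2 ⬝ᵥ z.2) / 4))
      ∂((stdG ι).prod (stdG ι)) ≠ ∞ := by
  have h : ∀ z : (ι → ℝ) × (ι → ℝ),
      ENNReal.ofReal (Real.exp (a + (z.1 ⬝ᵥ z.1 + z.2 ⬝ᵥ z.2) / 4))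
      = ENNReal.ofReal (Real.exp a) * (ENNReal.ofReal (Real.exp (0 ⬝ᵥ z.1 + 1 / 4 * (z.1 ⬝ᵥ z.1)))
        * ENNReal.ofReal (Real.exp (0 ⬝ᵥ z.2 + 1 / 4 * (z.2 ⬝ᵥ z.2)))) := by
    intro z
    rw [← ENNReal.ofReal_mul (Real.exp_pos _).le, ← ENNReal.ofReal_mul (Real.exp_pos _).le,
      ← Real.exp_add, ← Real.exp_add]
    congr 2
    simp
    ring
  have hm : Measurable fun x : ι → ℝ =>
      ENNReal.ofReal (Real.exp (0 ⬝ᵥ x + 1 / 4 * (x ⬝ᵥ x))) := by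
    unfold dotProduct; fun_prop
  simp_rw [h]
  rw [lintegral_const_mul _ (by
    exact (hm.comp measurable_fst).mul (hm.comp measurable_snd)),
    lintegral_prod_mul hm.aemeasurable hm.aemeasurable, lintegral_exp_stdG (by norm_num)]
  finiteness

theorem EuclLipschitz.measurable {L : ℝ} (hL : 0 ≤ L) {f : (ι → ℝ) → ℝ}
    (hf : EuclLipschitz L f) : Measurable f := (hf.lipschitzWith hL).continuous.measurable

/-- Gaussian concentration: the exponential moment of the difference of the values of a Lipschitz
function at two independent standard Gaussian vectors. -/
theorem EuclLipschitz.lintegral_exp_sub_le {L : ℝ} (hL : 0 ≤ L) {f : (ι → ℝ) → ℝ}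
    (hf : EuclLipschitz L f) :
    ∫⁻ z, ENNReal.ofReal (Real.exp (f z.1 - f z.2)) ∂((stdG ι).prod (stdG ι))
      ≤ ENNReal.ofReal (Real.exp (5 / 4 * L ^ 2)) := by
  classical
  have hfm := hf.measurable hL
  let F : ℕ → (ι → ℝ) × (ι → ℝ) → ℝ≥0∞ := fun m z =>
    ENNReal.ofReal (Real.exp (m * (f z.1 - f (Real.cos (Real.pi / 2 / m) • z.1
          + Real.sin (Real.pi / 2 / m) • z.2))))
  let G : (ι → ℝ) × (ι → ℝ) → ℝ≥0∞ := fun z =>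
    ENNReal.ofReal (Real.exp ((-(Real.pi / 2)) • grad f z.1 ⬝ᵥ z.2))
  have hpi := Real.pi_pos
  have hpi2 : Real.pi < 3.15 := Real.pi_lt_d2
  have hFm : ∀ m, Measurable (F m) := fun m => by
    refine (measurable_const.mul ((hfm.comp measurable_fst).sub (hfm.comp ?_))).exp.ennreal_ofReal
    fun_prop
  -- An increment over the angle δ is at most 2 L δ √S with S = ‖z.1‖² + ‖z.2‖². As m δ = π/2, the
  -- exponent is at most π L √S ≤ 4 L √S ≤ 16 L² + S/4, uniformly in m.
  have hdom : ∀ m, F m ≤ᵐ[(stdG ι).prod (stdG ι)] fun z =>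
      ENNReal.ofReal (Real.exp (16 * L ^ 2 + (z.1 ⬝ᵥ z.1 + z.2 ⬝ᵥ z.2) / 4)) := by
    intro m
    refine ae_of_all _ fun z => ENNReal.ofReal_le_ofReal (Real.exp_le_exp.2 ?_)
    have hS1 := dotProduct_self_nonneg' z.1
    have hS2 := dotProduct_self_nonneg' z.2
    rcases Nat.eq_zero_or_pos m with rfl | hm
    · simp; positivity
    have hm1 : (1 : ℝ) ≤ m := by exact_mod_cast hm
    set δ := Real.pi / 2 / m
    have hδ0 : 0 ≤ δ := by positivity
    have hδm : m * δ = Real.pi / 2 := by simp only [δ]; field_simp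
    have hδ2 : δ ≤ 2 := by nlinarith
    have hc : (1 - Real.cos δ) ^ 2 ≤ δ ^ 2 := by
      have := Real.one_sub_sq_div_two_le_cos (x := δ)
      have := Real.cos_le_one δ
      refine pow_le_pow_left₀ (by linarith) ?_ 2
      nlinarith
    have hs : (Real.sin δ) ^ 2 ≤ δ ^ 2 := sq_le_sq.2 (Real.abs_sin_le_abs)
    have h1 := hf z.1 (Real.cos δ • z.1 + Real.sin δ • z.2)
    set w := z.1 - (Real.cos δ • z.1 + Real.sin δ • z.2)
    have h2 : w ⬝ᵥ w ≤ 2 * δ ^ 2 * (z.1 ⬝ᵥ z.1 + z.2 ⬝ᵥ z.2) := by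
      simp only [dotProduct, ← Finset.sum_add_distrib, Finset.mul_sum]
      refine Finset.sum_le_sum fun i _ => ?_
      have : w i = (1 - Real.cos δ) * z.1 i - Real.sin δ * z.2 i := by
        simp [w]; ring
      rw [this]
      nlinarith [sq_nonneg ((1 - Real.cos δ) * z.1 i + Real.sin δ * z.2 i),
        mul_le_mul_of_nonneg_right hc (sq_nonneg (z.1 i)),
        mul_le_mul_of_nonneg_right hs (sq_nonneg (z.2 i))]
    set S := z.1 ⬝ᵥ z.1 + z.2 ⬝ᵥ z.2
    have hS : 0 ≤ S := by positivity
    have h3 : √(w ⬝ᵥ w) ≤ (2 * δ) * √S := by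
      refine (Real.sqrt_le_sqrt h2).trans ?_
      rw [Real.sqrt_mul (by positivity)]
      refine mul_le_mul_of_nonneg_right ?_ (Real.sqrt_nonneg _)
      refine Real.sqrt_le_iff.2 ⟨by positivity, by nlinarith⟩
    have h4 : m * (f z.1 - f (Real.cos δ • z.1 + Real.sin δ • z.2)) ≤ m * (L * ((2 * δ) * √S)) := by
      refine mul_le_mul_of_nonneg_left ?_ (by positivity)
      exact (le_abs_self _).trans (h1.trans (mul_le_mul_of_nonneg_left h3 hL))
    have h5 : m * (L * ((2 * δ) * √S)) = Real.pi * (L * √S) := by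
      calc m * (L * ((2 * δ) * √S)) = 2 * (m * δ) * (L * √S) := by ring
        _ = _ := by rw [hδm]; ring
    have h6 := Real.sq_sqrt hS
    have h7 := Real.sqrt_nonneg S
    have h8 : 0 ≤ L * √S := by positivity
    nlinarith [sq_nonneg (4 * L - √S / 2), mul_le_mul_of_nonneg_right (by linarith : Real.pi ≤ 4) h8]
  -- At a point of differentiability, which is almost every point by Rademacher, the path leaves z.1
  -- with velocity z.2. The scaled increment therefore tends to -(π/2) ∇f(z.1)·z.2.
  have hlim : ∀ᵐ z ∂((stdG ι).prod (stdG ι)), Filter.Tendsto (fun m => F m z) Filter.atTop (𝓝 (G z)) := by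
    have hd : ∀ᵐ z ∂((stdG ι).prod (stdG ι)), DifferentiableAt ℝ f z.1 := by
      have := stdG_absolutelyContinuous.ae_le (hf.lipschitzWith hL).ae_differentiableAt
      exact Measure.quasiMeasurePreserving_fst.ae this
    filter_upwards [hd] with z hz
    refine (ENNReal.continuous_ofReal.tendsto _).comp ((Real.continuous_exp.tendsto _).comp ?_)
    have h2 : HasDerivAt (fun t : ℝ => Real.cos t • z.1 + Real.sin t • z.2) z.2 0 := by
      have := ((Real.hasDerivAt_cos 0).smul_const z.1).fun_add ((Real.hasDerivAt_sin 0).smul_const z.2)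
      simpa using this
    have h3 : HasFDerivAt f (fderiv ℝ f z.1) (Real.cos 0 • z.1 + Real.sin 0 • z.2) := by
      simpa using hz.hasFDerivAt
    have h4 := h3.comp_hasDerivAt (0 : ℝ) h2
    have h5 := h4.tendsto_slope
    have h6 : Filter.Tendsto (fun m : ℕ => Real.pi / 2 / (m : ℝ)) Filter.atTop (𝓝[≠] 0) := by
      refine tendsto_nhdsWithin_iff.2 ⟨tendsto_const_div_atTop_nhds_zero_nat _, ?_⟩
      filter_upwards [Filter.eventually_gt_atTop 0] with m hm
      have : (0 : ℝ) < m := by exact_mod_cast hm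
      exact (by positivity : Real.pi / 2 / (m : ℝ) ≠ 0)
    have h7 := (h5.comp h6).const_mul (-(Real.pi / 2))
    rw [smul_dotProduct, grad_dotProduct, smul_eq_mul]
    refine h7.congr' ?_
    filter_upwards [Filter.eventually_gt_atTop 0] with m hm
    have : (0 : ℝ) < m := by exact_mod_cast hm
    simp only [Function.comp_apply, slope_def_field, Real.cos_zero, Real.sin_zero, one_smul,
      zero_smul, add_zero, sub_zero]
    field_simp
    ring
  have hconv := tendsto_lintegral_of_dominated_convergence _ hFm hdom
    (lintegral_exp_quarter_stdG_prod_lt_top _) hlim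
  have hle : ∫⁻ z, ENNReal.ofReal (Real.exp (f z.1 - f z.2)) ∂((stdG ι).prod (stdG ι))
      ≤ ∫⁻ z, G z ∂((stdG ι).prod (stdG ι)) := by
    refine ge_of_tendsto hconv ?_
    filter_upwards [Filter.eventually_ne_atTop 0] with m hm
    exact lintegral_exp_sub_le_increment hfm m hm
  refine hle.trans ?_
  have hGm : Measurable G := by
    have := measurable_grad f
    have h1 : ∀ i, Measurable fun x => grad f x i := fun i => (measurable_pi_iff.1 this) i
    refine (Real.measurable_exp.comp ?_).ennreal_ofReal
    unfold dotProduct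
    refine Finset.measurable_sum _ fun i _ => ?_
    exact (((h1 i).comp measurable_fst).const_mul _).mul (by fun_prop)
  rw [lintegral_prod _ hGm.aemeasurable]
  have hae : ∀ᵐ x ∂(stdG ι), ∫⁻ y, G (x, y) ∂(stdG ι) ≤ ENNReal.ofReal (Real.exp (5 / 4 * L ^ 2)) := by
    filter_upwards [stdG_absolutelyContinuous.ae_le (hf.lipschitzWith hL).ae_differentiableAt]
      with x hx
    simp only [G]
    rw [lintegral_exp_dotProduct_stdG]
    refine ENNReal.ofReal_le_ofReal (Real.exp_le_exp.2 ?_)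
    rw [smul_dotProduct, dotProduct_smul, smul_eq_mul, smul_eq_mul]
    have h1 := hf.grad_le hL hx
    have h2 := dotProduct_self_nonneg' (grad f x)
    -- Integrating out z.2 leaves the exponent π² ‖∇f‖² / 8, whence the constant 5/4.
    have h3 : Real.pi ^ 2 ≤ 10 := by nlinarith
    have h4 := mul_le_mul_of_nonneg_right h3 h2
    nlinarith
  refine (lintegral_mono_ae hae).trans ?_
  simp

end

/-! ### Exponential moments of squares, and lower bounds on variances. -/

section

variable {ι : Type*} [Fintype ι]

theorem EuclLipschitz.const_mul {L : ℝ} {f : (ι → ℝ) → ℝ} (hf : EuclLipschitz L f) (a : ℝ) :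
    EuclLipschitz (|a| * L) fun x => a * f x := fun x y => by
  rw [← mul_sub, abs_mul, mul_assoc]
  exact mul_le_mul_of_nonneg_left (hf x y) (abs_nonneg a)

/-- The squared difference of a `1`-Lipschitz function at two independent standard Gaussian vectors
has a bounded exponential moment. -/
theorem EuclLipschitz.lintegral_exp_sq_le {f : (ι → ℝ) → ℝ} (hf : EuclLipschitz 1 f) :
    ∫⁻ z, ENNReal.ofReal (Real.exp ((f z.1 - f z.2) ^ 2 / 10)) ∂((stdG ι).prod (stdG ι)) ≤ 2 := by
  have hfm := hf.measurable zero_le_one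
  have h15 : 0 ≤ √(1 / 5 : ℝ) := Real.sqrt_nonneg _
  have h15' : √(1 / 5 : ℝ) ^ 2 = 1 / 5 := Real.sq_sqrt (by norm_num)
  -- The square is linearised by an auxiliary Gaussian g with factor √(1/5). After swapping, the
  -- inner integral is at most exp(g²/4), and E exp(g²/4) = √2 ≤ 2.
  have h1 : ∀ y : ℝ, ENNReal.ofReal (Real.exp (y ^ 2 / 10))
      = ∫⁻ g, ENNReal.ofReal (Real.exp (√(1 / 5) * y * g)) ∂(gaussianReal 0 1) := by
    intro y
    have := lintegral_exp_gaussianReal (κ := 0) (by norm_num) (√(1 / 5) * y)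
    simp only [zero_mul, add_zero, mul_zero, sub_zero, Real.sqrt_one, inv_one, one_mul, mul_one] at this
    rw [this, mul_pow, h15']
    congr 2
    ring
  simp_rw [h1]
  have hm : Measurable (Function.uncurry fun (z : (ι → ℝ) × (ι → ℝ)) (g : ℝ) =>
      ENNReal.ofReal (Real.exp (√(1 / 5) * (f z.1 - f z.2) * g))) := by
    refine (Real.measurable_exp.comp ?_).ennreal_ofReal
    refine (Measurable.const_mul ?_ _).mul measurable_snd
    exact (hfm.comp (measurable_fst.comp measurable_fst)).sub
      (hfm.comp (measurable_snd.comp measurable_fst))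
  rw [lintegral_lintegral_swap hm.aemeasurable]
  have h2 : ∀ g : ℝ, ∫⁻ z, ENNReal.ofReal (Real.exp (√(1 / 5) * (f z.1 - f z.2) * g))
      ∂((stdG ι).prod (stdG ι)) ≤ ENNReal.ofReal (Real.exp (0 * g + 1 / 4 * g ^ 2)) := by
    intro g
    have h3 := (hf.const_mul (√(1 / 5) * g)).lintegral_exp_sub_le (by positivity)
    refine le_trans (le_of_eq ?_) (h3.trans (le_of_eq ?_))
    · refine lintegral_congr fun z => ?_
      congr 2
      ring
    · rw [mul_one, sq_abs, mul_pow, h15']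
      congr 2
      ring
  refine (lintegral_mono h2).trans ?_
  rw [lintegral_exp_gaussianReal (by norm_num)]
  have h4 : (√(1 - 2 * (1 / 4)) : ℝ)⁻¹ ≤ 2 := by
    refine inv_le_of_inv_le₀ (by norm_num) ?_
    exact Real.le_sqrt_of_sq_le (by norm_num)
  rw [show (2 : ℝ≥0∞) = ENNReal.ofReal 2 by simp]
  refine ENNReal.ofReal_le_ofReal ?_
  simpa using h4

theorem stdG_map_add (c : ι → ℝ) :
    (stdG ι).map (fun x => x + c)
      = (stdG ι).withDensity fun x => ENNReal.ofReal (Real.exp (c ⬝ᵥ x - c ⬝ᵥ c / 2)) := by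
  have hm : Measurable fun x : ι → ℝ => ENNReal.ofReal (Real.exp (c ⬝ᵥ x - c ⬝ᵥ c / 2)) := by
    unfold dotProduct
    fun_prop
  refine Measure.ext_of_lintegral _ fun F hF => ?_
  rw [lintegral_map hF (measurable_add_const c), lintegral_stdG_add c F hF,
    lintegral_withDensity_eq_lintegral_mul _ hm hF]
  rfl

/-- The Cameron–Martin formula. -/
theorem integral_stdG_add (c : ι → ℝ) (f : (ι → ℝ) → ℝ) (hf : Measurable f) :
    ∫ x, f (x + c) ∂(stdG ι) = ∫ x, Real.exp (c ⬝ᵥ x - c ⬝ᵥ c / 2) * f x ∂(stdG ι) := by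
  have hm : Measurable fun x : ι → ℝ => ENNReal.ofReal (Real.exp (c ⬝ᵥ x - c ⬝ᵥ c / 2)) := by
    unfold dotProduct
    fun_prop
  rw [← integral_map (f := f) (φ := fun x => x + c) (measurable_add_const c).aemeasurable
    hf.aestronglyMeasurable, stdG_map_add,
    integral_withDensity_eq_integral_toReal_smul hm (ae_of_all _ fun _ => ENNReal.ofReal_lt_top)]
  refine integral_congr_ae (ae_of_all _ fun x => ?_)
  simp only [smul_eq_mul]
  rw [ENNReal.toReal_ofReal (Real.exp_pos _).le]

theorem memLp_two_eval_stdG (i : ι) : MemLp (fun x : ι → ℝ => x i) 2 (stdG ι) :=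
  IsGaussian.memLp_dual (stdG ι) (ContinuousLinearMap.proj (R := ℝ) (φ := fun _ : ι => ℝ) i) 2 (by simp)

theorem integrable_dotProduct_self_stdG : Integrable (fun x : ι → ℝ => x ⬝ᵥ x) (stdG ι) := by
  unfold dotProduct
  refine integrable_finsetSum _ fun i _ => ?_
  simpa [pow_two] using (memLp_two_eval_stdG i).integrable_sq

theorem EuclLipschitz.memLp_two {L : ℝ} (hL : 0 ≤ L) {f : (ι → ℝ) → ℝ} (hf : EuclLipschitz L f) :
    MemLp f 2 (stdG ι) := by
  have hfm := hf.measurable hL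
  rw [memLp_two_iff_integrable_sq hfm.aestronglyMeasurable]
  refine Integrable.mono' ((integrable_const (2 * f 0 ^ 2)).add
    (integrable_dotProduct_self_stdG.const_mul (2 * L ^ 2))) (hfm.pow_const 2).aestronglyMeasurable
    (ae_of_all _ fun x => ?_)
  rw [Real.norm_eq_abs, abs_of_nonneg (sq_nonneg _)]
  have h1 := hf x 0
  rw [sub_zero] at h1
  have h2 := pow_le_pow_left₀ (abs_nonneg _) h1 2
  rw [sq_abs, mul_pow, Real.sq_sqrt (dotProduct_self_nonneg' x)] at h2
  simp only [Pi.add_apply]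
  nlinarith [sq_nonneg (f x - 2 * f 0)]

theorem sq_integral_mul_le {Ω : Type*} [MeasurableSpace Ω] {P : Measure Ω} {X Y : Ω → ℝ}
    (hX : MemLp X 2 P) (hY : MemLp Y 2 P) :
    (∫ ω, X ω * Y ω ∂P) ^ 2 ≤ (∫ ω, X ω ^ 2 ∂P) * ∫ ω, Y ω ^ 2 ∂P := by
  have hXY : Integrable (fun ω => X ω * Y ω) P := hX.integrable_mul hY
  have hX2 := hX.integrable_sq
  have hY2 := hY.integrable_sq
  have h : ∀ t : ℝ, 0 ≤ (∫ ω, X ω ^ 2 ∂P) * (t * t) + (2 * ∫ ω, X ω * Y ω ∂P) * t + ∫ ω, Y ω ^ 2 ∂P := by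
    intro t
    have h1 : 0 ≤ ∫ ω, (t * X ω + Y ω) ^ 2 ∂P := integral_nonneg fun ω => sq_nonneg _
    have h2 : ∫ ω, (t * X ω + Y ω) ^ 2 ∂P
        = ∫ ω, (t * t * X ω ^ 2 + 2 * t * (X ω * Y ω) + Y ω ^ 2) ∂P :=
      integral_congr_ae (ae_of_all _ fun ω => by ring)
    have h3 : Integrable (fun ω => t * t * X ω ^ 2 + 2 * t * (X ω * Y ω)) P :=
      (hX2.const_mul _).add (hXY.const_mul _)
    rw [h2, integral_add h3 hY2,
      integral_add (hX2.const_mul _) (hXY.const_mul _), integral_const_mul, integral_const_mul] at h1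
    linarith
  have := discrim_le_zero h
  rw [discrim] at this
  nlinarith

/-- The covariance of two square integrable functions, expressed with two independent copies. -/
theorem integral_prod_sub_mul_sub {Ω : Type*} [MeasurableSpace Ω] {P : Measure Ω}
    [IsProbabilityMeasure P] {X Y : Ω → ℝ} (hX : MemLp X 2 P) (hY : MemLp Y 2 P) :
    ∫ z, (X z.1 - X z.2) * (Y z.1 - Y z.2) ∂(P.prod P)
      = 2 * (∫ ω, X ω * Y ω ∂P - (∫ ω, X ω ∂P) * ∫ ω, Y ω ∂P) := by
  have hXi := hX.integrable one_le_two
  have hYi := hY.integrable one_le_two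
  have hXY : Integrable (fun ω => X ω * Y ω) P := hX.integrable_mul hY
  have e : ∀ z : Ω × Ω, (X z.1 - X z.2) * (Y z.1 - Y z.2)
      = (X z.1 * Y z.1 + X z.2 * Y z.2) - (X z.1 * Y z.2 + Y z.1 * X z.2) := fun z => by ring
  simp_rw [e]
  have i1 : Integrable (fun z : Ω × Ω => X z.1 * Y z.1) (P.prod P) := hXY.comp_fst P
  have i2 : Integrable (fun z : Ω × Ω => X z.2 * Y z.2) (P.prod P) := hXY.comp_snd P
  have i3 : Integrable (fun z : Ω × Ω => X z.1 * Y z.2) (P.prod P) := hXi.mul_prod hYi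
  have i4 : Integrable (fun z : Ω × Ω => Y z.1 * X z.2) (P.prod P) := hYi.mul_prod hXi
  have i12 : Integrable (fun z : Ω × Ω => X z.1 * Y z.1 + X z.2 * Y z.2) (P.prod P) := i1.add i2
  have i34 : Integrable (fun z : Ω × Ω => X z.1 * Y z.2 + Y z.1 * X z.2) (P.prod P) := i3.add i4
  rw [integral_sub i12 i34, integral_add i1 i2, integral_add i3 i4,
    integral_prod_mul (fun x => X x) (fun y => Y y), integral_prod_mul (fun x => Y x) (fun y => X y),
    integral_fun_fst (fun x => X x * Y x), integral_fun_snd (fun x => X x * Y x)]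
  simp
  ring

theorem MemLp.prod_sub {Ω : Type*} [MeasurableSpace Ω] {P : Measure Ω}
    [IsProbabilityMeasure P] {X : Ω → ℝ} (hX : MemLp X 2 P) :
    MemLp (fun z : Ω × Ω => X z.1 - X z.2) 2 (P.prod P) :=
  (hX.comp_measurePreserving measurePreserving_fst).sub
    (hX.comp_measurePreserving measurePreserving_snd)

/-- A lower bound on the variance of a Lipschitz function of a standard Gaussian vector that
increases at a given rate in the direction `c`. -/
theorem EuclLipschitz.sq_le_of_increasing {L : ℝ} (hL : 0 ≤ L) {f : (ι → ℝ) → ℝ}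
    (hf : EuclLipschitz L f) (c : ι → ℝ) {D : ℝ} (hD : 0 ≤ D)
    (hc : ∀ x, ∀ ε : ℝ, 0 < ε → ε * D ≤ f (x + ε • c) - f x) :
    2 * D ^ 2 ≤ (c ⬝ᵥ c) * ∫ z, (f z.1 - f z.2) ^ 2 ∂((stdG ι).prod (stdG ι)) := by
  have hfm := hf.measurable hL
  have hf2 := hf.memLp_two hL
  have hfi := hf2.integrable one_le_two
  set q := ∫ z, (f z.1 - f z.2) ^ 2 ∂((stdG ι).prod (stdG ι))
  set κ := c ⬝ᵥ c
  have hκ : 0 ≤ κ := dotProduct_self_nonneg' c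
  have hq : 0 ≤ q := integral_nonneg fun z => sq_nonneg _
  -- R is the density of the shift by ε c. The shift raises the mean of f by at least ε D, and this
  -- increase is the covariance of R and f; Cauchy–Schwarz bounds it through Var R = exp(ε² κ) - 1.
  -- Dividing by ε² and letting ε tend to 0 gives the claim.
  have key : ∀ ε : ℝ, 0 < ε → 2 * (ε * D) ^ 2 ≤ (Real.exp (ε ^ 2 * κ) - 1) * q := by
    intro ε hε
    let R : (ι → ℝ) → ℝ := fun x => Real.exp ((ε • c) ⬝ᵥ x - (ε • c) ⬝ᵥ (ε • c) / 2)
    have hκε : (ε • c) ⬝ᵥ (ε • c) = ε ^ 2 * κ := by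
      rw [smul_dotProduct, dotProduct_smul, smul_eq_mul, smul_eq_mul]; ring
    have hR : ∀ x, R x = Real.exp (-(ε ^ 2 * κ / 2)) * Real.exp ((ε • c) ⬝ᵥ x) := by
      intro x
      simp only [R]
      rw [← Real.exp_add, hκε]
      congr 1
      ring
    have hR2 : ∀ x, R x ^ 2 = Real.exp (-(ε ^ 2 * κ)) * Real.exp (((2 : ℝ) • ε • c) ⬝ᵥ x) := by
      intro x
      rw [hR, mul_pow, ← Real.exp_nat_mul, ← Real.exp_nat_mul]
      congr 2
      · push_cast; ring
      · rw [smul_dotProduct (2 : ℝ)]; simp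
    have hRm : Measurable R := by
      simp only [R]; unfold dotProduct; fun_prop
    have hRLp : MemLp R 2 (stdG ι) := by
      rw [memLp_two_iff_integrable_sq hRm.aestronglyMeasurable]
      simp_rw [hR2]
      exact (integrable_exp_dotProduct_stdG _).const_mul _
    have hR1 : ∫ x, R x ∂(stdG ι) = 1 := by
      simp_rw [hR]
      rw [integral_const_mul, integral_exp_dotProduct_stdG, ← Real.exp_add, hκε]
      simp
    have hR2i : ∫ x, R x * R x ∂(stdG ι) = Real.exp (ε ^ 2 * κ) := by
      simp_rw [← pow_two, hR2]
      rw [integral_const_mul, integral_exp_dotProduct_stdG, ← Real.exp_add]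
      congr 1
      rw [smul_dotProduct, dotProduct_smul, hκε]
      simp
      ring
    have hΔ : ε * D ≤ ∫ x, R x * f x ∂(stdG ι) - ∫ x, f x ∂(stdG ι) := by
      have h1 : ∫ x, f (x + ε • c) ∂(stdG ι) = ∫ x, R x * f x ∂(stdG ι) :=
        integral_stdG_add (ε • c) f hfm
      have h2 : Integrable (fun x => f (x + ε • c)) (stdG ι) := by
        have h3 : EuclLipschitz L fun x => f (x + ε • c) := fun x y => by
          simpa using hf (x + ε • c) (y + ε • c)
        exact (h3.memLp_two hL).integrable one_le_two
      rw [← h1, ← integral_sub h2 hfi]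
      calc ε * D = ∫ _x : ι → ℝ, ε * D ∂(stdG ι) := by simp
        _ ≤ _ := integral_mono (integrable_const _) (h2.sub hfi) fun x => hc x ε hε
    have hCS := sq_integral_mul_le (MemLp.prod_sub hRLp) (MemLp.prod_sub hf2)
    have hq' : ∫ z, (R z.1 - R z.2) ^ 2 ∂((stdG ι).prod (stdG ι))
        = 2 * (Real.exp (ε ^ 2 * κ) - 1) := by
      have := integral_prod_sub_mul_sub hRLp hRLp
      rw [hR1, hR2i] at this
      simp_rw [pow_two]
      rw [this]
      simp [pow_two]
    rw [integral_prod_sub_mul_sub hRLp hf2, hq', hR1, one_mul] at hCS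
    have h0 : 0 ≤ ε * D := by positivity
    have := pow_le_pow_left₀ h0 hΔ 2
    change _ ≤ _ * q at hCS
    nlinarith
  have hlim : Filter.Tendsto (fun ε : ℝ => (κ + ε ^ 2 * κ ^ 2) * q) (𝓝[>] 0) (𝓝 (κ * q)) := by
    have : Filter.Tendsto (fun ε : ℝ => (κ + ε ^ 2 * κ ^ 2) * q) (𝓝 0) (𝓝 ((κ + 0 ^ 2 * κ ^ 2) * q)) :=
      Continuous.tendsto (by fun_prop) 0
    simpa using this.mono_left nhdsWithin_le_nhds
  refine ge_of_tendsto hlim ?_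
  have hsmall : ∀ᶠ ε : ℝ in 𝓝[>] 0, ε ^ 2 * κ < 1 := by
    have : Filter.Tendsto (fun ε : ℝ => ε ^ 2 * κ) (𝓝 0) (𝓝 (0 ^ 2 * κ)) :=
      Continuous.tendsto (by fun_prop) 0
    refine (this.mono_left nhdsWithin_le_nhds).eventually_lt_const (by simp)
  filter_upwards [hsmall, self_mem_nhdsWithin] with ε hε hε0
  have hε0' : (0 : ℝ) < ε := hε0
  have h1 := key ε hε0'
  have hx : 0 ≤ ε ^ 2 * κ := by positivity
  have h2 := Real.abs_exp_sub_one_sub_id_le (x := ε ^ 2 * κ) (by rw [abs_of_nonneg hx]; exact hε.le)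
  have h3 := (abs_le.1 h2).2
  have h4 : Real.exp (ε ^ 2 * κ) - 1 ≤ ε ^ 2 * (κ + ε ^ 2 * κ ^ 2) := by nlinarith
  have h5 := mul_le_mul_of_nonneg_right h4 hq
  have h6 : ε ^ 2 * (2 * D ^ 2) ≤ ε ^ 2 * ((κ + ε ^ 2 * κ ^ 2) * q) := by nlinarith
  exact le_of_mul_le_mul_left h6 (by positivity)

end

/-! ### Spectral norm and minimum singular value. -/

theorem norm_toLp_sq {ι : Type*} [Fintype ι] (v : ι → ℝ) : ‖WithLp.toLp 2 v‖ ^ 2 = v ⬝ᵥ v := by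
  rw [EuclideanSpace.real_norm_sq_eq]
  simp [dotProduct, pow_two]

theorem dotProduct_sq_le {ι : Type*} [Fintype ι] (v w : ι → ℝ) :
    (v ⬝ᵥ w) ^ 2 ≤ (v ⬝ᵥ v) * (w ⬝ᵥ w) := by
  simpa [dotProduct, pow_two] using Finset.sum_mul_sq_le_sq_mul_sq Finset.univ v w

theorem specNorm_nonneg {m k : ℕ} (M : Matrix (Fin m) (Fin k) ℝ) : 0 ≤ specNorm M := norm_nonneg _

theorem mulVec_dotProduct_self_le {m k : ℕ} (M : Matrix (Fin m) (Fin k) ℝ) (v : Fin k → ℝ) :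
    (M *ᵥ v) ⬝ᵥ (M *ᵥ v) ≤ specNorm M ^ 2 * (v ⬝ᵥ v) := by
  have h := (LinearMap.toContinuousLinearMap (Matrix.toEuclideanLin M)).le_opNorm (WithLp.toLp 2 v)
  have h2 := pow_le_pow_left₀ (norm_nonneg _) h 2
  rw [mul_pow, norm_toLp_sq v] at h2
  rw [← norm_toLp_sq (M *ᵥ v)]
  exact h2

theorem vecMul_dotProduct_self_le {m k : ℕ} (M : Matrix (Fin m) (Fin k) ℝ) (g : Fin m → ℝ) :
    (g ᵥ* M) ⬝ᵥ (g ᵥ* M) ≤ specNorm M ^ 2 * (g ⬝ᵥ g) := by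
  set s := (g ᵥ* M) ⬝ᵥ (g ᵥ* M) with hs
  have h1 : s = g ⬝ᵥ (M *ᵥ (g ᵥ* M)) := by rw [dotProduct_mulVec]
  have h2 := dotProduct_sq_le g (M *ᵥ (g ᵥ* M))
  rw [← h1] at h2
  have h3 := mulVec_dotProduct_self_le M (g ᵥ* M)
  rw [← hs] at h3
  have hs0 : 0 ≤ s := dotProduct_self_nonneg' _
  have hg0 : 0 ≤ g ⬝ᵥ g := dotProduct_self_nonneg' _
  rcases hs0.eq_or_lt with h | h
  · rw [← h]; positivity
  · have : s * s ≤ s * (specNorm M ^ 2 * (g ⬝ᵥ g)) := by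
      nlinarith [mul_le_mul_of_nonneg_left h3 hg0]
    exact le_of_mul_le_mul_left this h

theorem specNorm_fin_one (A : Matrix (Fin 1) (Fin 1) ℝ) : specNorm A ^ 2 = A 0 0 ^ 2 := by
  have h : ∀ x : EuclideanSpace ℝ (Fin 1), Matrix.toEuclideanLin A x = A 0 0 • x := by
    intro x
    ext i
    fin_cases i
    simp [Matrix.toEuclideanLin, Matrix.mulVec, dotProduct]
  have h2 : LinearMap.toContinuousLinearMap (Matrix.toEuclideanLin A)
      = A 0 0 • ContinuousLinearMap.id ℝ (EuclideanSpace ℝ (Fin 1)) := by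
    ext1 x
    simpa using h x
  rw [specNorm, h2, norm_smul, ContinuousLinearMap.norm_id, mul_one, Real.norm_eq_abs, sq_abs]

/-- A matrix with positive minimum singular value and at least as many columns as rows has a right
inverse whose norm is at most the inverse of this singular value. -/
theorem exists_mulVec_eq {n p : ℕ} (hn : 1 ≤ n) (hnp : n ≤ p) (B : Matrix (Fin n) (Fin p) ℝ)
    (hB : 0 < sigmaMin B) (v : Fin n → ℝ) :
    ∃ c : Fin p → ℝ, B *ᵥ c = v ∧ sigmaMin B ^ 2 * (c ⬝ᵥ c) ≤ v ⬝ᵥ v := by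
  let T := Matrix.toEuclideanLin B
  have hfr : Module.finrank ℝ (EuclideanSpace ℝ (Fin p)) = p := by simp
  let e := T.isSymmetric_adjoint_comp_self.eigenvectorBasis hfr
  have hσ : ∀ i : Fin p, T.singularValues i ^ 2 = T.isSymmetric_adjoint_comp_self.eigenvalues hfr i :=
    fun i => T.sq_singularValues_fin hfr i
  have hσn : ∀ i : Fin n, sigmaMin B ≤ T.singularValues i := by
    intro i
    have h1 : sigmaMin B = T.singularValues (n - 1) := by
      rw [sigmaMin, Nat.min_eq_left hnp]
    rw [h1]
    exact T.singularValues_antitone (by have := i.2; omega)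
  -- The n leading right singular vectors. Their normalised images are n orthonormal vectors in
  -- dimension n, hence a basis, and the preimage is found by dividing the coordinates of v in it by
  -- the singular values.
  let E : Fin n → EuclideanSpace ℝ (Fin p) := fun i => e (Fin.castLE hnp i)
  have hinner : ∀ i j, inner ℝ (T (E i)) (T (E j)) = if i = j then T.singularValues i ^ 2 else 0 := by
    intro i j
    rw [← LinearMap.adjoint_inner_right, ← LinearMap.comp_apply]
    have h2 := T.isSymmetric_adjoint_comp_self.apply_eigenvectorBasis hfr (Fin.castLE hnp j)
    change inner ℝ (E i) ((LinearMap.adjoint T ∘ₗ T) (e (Fin.castLE hnp j))) = _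
    rw [h2, ← hσ]
    rw [inner_smul_right]
    change _ * inner ℝ (e (Fin.castLE hnp i)) (e (Fin.castLE hnp j)) = _
    rw [OrthonormalBasis.inner_eq_ite]
    by_cases hij : i = j
    · subst hij; simp
    · simp [hij]
  let F : Fin n → EuclideanSpace ℝ (Fin n) := fun i => (T.singularValues i)⁻¹ • T (E i)
  have hpos : ∀ i : Fin n, 0 < T.singularValues i := fun i => hB.trans_le (hσn i)
  have hF : Orthonormal ℝ F := by
    rw [orthonormal_iff_ite]
    intro i j
    simp only [F, inner_smul_left, inner_smul_right, hinner]
    by_cases hij : i = j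
    · subst hij
      have := (hpos i).ne'
      simp
      field_simp
    · simp [hij]
  let b : OrthonormalBasis (Fin n) ℝ (EuclideanSpace ℝ (Fin n)) :=
    OrthonormalBasis.mk hF (by
      rw [hF.linearIndependent.span_eq_top_of_card_eq_finrank' (by simp)])
  let a : Fin n → ℝ := fun i => (T.singularValues i)⁻¹ * b.repr (WithLp.toLp 2 v) i
  let c : EuclideanSpace ℝ (Fin p) := ∑ i, a i • E i
  have hTc : T c = WithLp.toLp 2 v := by
    rw [← b.sum_repr (WithLp.toLp 2 v)]
    simp only [c, map_sum, map_smul, a]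
    refine Finset.sum_congr rfl fun i _ => ?_
    simp only [b, OrthonormalBasis.coe_mk, F]
    rw [smul_smul, mul_comm]
  refine ⟨c.ofLp, ?_, ?_⟩
  · have := congrArg WithLp.ofLp hTc
    simpa [T, Matrix.toEuclideanLin] using this
  · have hE : Orthonormal ℝ E := e.orthonormal.comp _ (Fin.castLE_injective hnp)
    have hc : ‖c‖ ^ 2 = ∑ i, a i ^ 2 := by
      rw [← real_inner_self_eq_norm_sq, hE.inner_sum]
      simp [pow_two]
    have hv : ‖WithLp.toLp 2 v‖ ^ 2 = ∑ i : Fin n, (T.singularValues i * a i) ^ 2 := by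
      rw [← b.repr.norm_map, EuclideanSpace.real_norm_sq_eq]
      refine Finset.sum_congr rfl fun i _ => ?_
      have := (hpos i).ne'
      simp only [a]
      field_simp
    rw [← norm_toLp_sq v, ← norm_toLp_sq c.ofLp, hv]
    change _ * ‖c‖ ^ 2 ≤ _
    rw [hc, Finset.mul_sum]
    refine Finset.sum_le_sum fun i _ => ?_
    refine (mul_le_mul_of_nonneg_right (pow_le_pow_left₀ hB.le (hσn i) 2) (sq_nonneg _)).trans ?_
    exact (mul_pow _ _ _).ge

theorem sigmaMin_le_specNorm {n p : ℕ} (hn : 1 ≤ n) (hnp : n ≤ p) (B : Matrix (Fin n) (Fin p) ℝ)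
    (hB : 0 < sigmaMin B) : sigmaMin B ≤ specNorm B := by
  obtain ⟨c, h1, h2⟩ := exists_mulVec_eq hn hnp B hB (fun _ => 1)
  have h3 := mulVec_dotProduct_self_le B c
  rw [h1] at h3
  have h4 : (0 : ℝ) < (fun _ : Fin n => (1 : ℝ)) ⬝ᵥ (fun _ => 1) := by
    simp [dotProduct]
    omega
  have h5 := dotProduct_self_nonneg' c
  have h6 : 0 < c ⬝ᵥ c := by
    rcases h5.eq_or_lt with h | h
    · rw [← h] at h3; linarith
    · exact h
  have h7 : sigmaMin B ^ 2 * (c ⬝ᵥ c) ≤ specNorm B ^ 2 * (c ⬝ᵥ c) := h2.trans h3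
  exact le_of_sq_le_sq (le_of_mul_le_mul_right h7 h6) (specNorm_nonneg B)

/-! ### The activation -/

namespace IsIncreasingActivation

variable {β : ℝ} {φ φ' : ℝ → ℝ}

theorem beta_le_one (h : IsIncreasingActivation β φ φ') : β ≤ 1 := (h.le_deriv 0).trans (h.deriv_le 0)

theorem mul_sub_le (h : IsIncreasingActivation β φ φ') (x y : ℝ) :
    β * (y - x) ^ 2 ≤ (y - x) * (φ y - φ x) := by
  rcases le_total x y with hxy | hxy
  · nlinarith [h.le_slope x y hxy]
  · nlinarith [h.le_slope y x hxy]

/-- The weight a must not oppose the sign of the increment. The lower bounds on state increments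
have to arrange this before applying φ. -/
theorem mul_le_mul_sub (h : IsIncreasingActivation β φ φ') (a x y : ℝ) (hxy : 0 ≤ a * (y - x)) :
    β * (a * (y - x)) ≤ a * (φ y - φ x) := by
  rcases eq_or_ne y x with rfl | hne
  · simp
  · have h1 : 0 < (y - x) ^ 2 := by
      have := sub_ne_zero.2 hne
      positivity
    have h2 := mul_le_mul_of_nonneg_left (h.mul_sub_le x y) hxy
    have h3 : (y - x) ^ 2 * (β * (a * (y - x))) ≤ (y - x) ^ 2 * (a * (φ y - φ x)) := by
      nlinarith
    exact le_of_mul_le_mul_left h3 h1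

theorem sq_sub_le (h : IsIncreasingActivation β φ φ') (hβ : 0 < β) (x y : ℝ) :
    (φ y - φ x) ^ 2 ≤ (y - x) ^ 2 := by
  rcases le_total x y with hxy | hxy
  · have := h.slope_le x y hxy
    have h2 := h.le_slope x y hxy
    have h3 : 0 ≤ β * (y - x) := mul_nonneg hβ.le (by linarith)
    exact pow_le_pow_left₀ (by linarith) this 2
  · have := h.slope_le y x hxy
    have h2 := h.le_slope y x hxy
    have h3 : 0 ≤ β * (x - y) := mul_nonneg hβ.le (by linarith)
    have := pow_le_pow_left₀ (by linarith) this 2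
    nlinarith

theorem continuous (h : IsIncreasingActivation β φ φ') (hβ : 0 < β) : Continuous φ := by
  have : LipschitzWith 1 φ := by
    refine LipschitzWith.of_dist_le_mul fun x y => ?_
    rw [NNReal.coe_one, one_mul, Real.dist_eq, Real.dist_eq]
    exact sq_le_sq.1 (h.sq_sub_le hβ y x)
  exact this.continuous

end IsIncreasingActivation

theorem geomSq_succ (a : ℝ) (t : ℕ) : geomSq a (t + 1) = a ^ 2 * geomSq a t + 1 := by
  rw [geomSq, Finset.sum_range_succ', geomSq, Finset.mul_sum]
  simp [pow_succ']

theorem geomSq_nonneg (a : ℝ) (t : ℕ) : 0 ≤ geomSq a t :=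
  Finset.sum_nonneg fun _ _ => by positivity

theorem one_le_geomSq (a : ℝ) {t : ℕ} (ht : 1 ≤ t) : 1 ≤ geomSq a t := by
  obtain ⟨s, rfl⟩ := Nat.exists_eq_add_of_le' ht
  rw [geomSq_succ]
  have := geomSq_nonneg a s
  nlinarith [mul_nonneg (sq_nonneg a) this]

theorem stateBound_sq {n p : ℕ} (A : Matrix (Fin n) (Fin n) ℝ) (B : Matrix (Fin n) (Fin p) ℝ)
    (t : ℕ) : stateBound A B t ^ 2 = specNorm B ^ 2 * geomSq (specNorm A) t := by
  rw [stateBound, mul_pow, Real.sq_sqrt (geomSq_nonneg _ _)]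

/-! ### Dependence of states and regression inputs on the driving inputs. -/

section

variable {n p : ℕ} {β : ℝ} {φ φ' : ℝ → ℝ} {A : Matrix (Fin n) (Fin n) ℝ}
  {B : Matrix (Fin n) (Fin p) ℝ}

theorem state_succ (u : ℕ → Fin p → ℝ) (t : ℕ) (j : Fin n) :
    state φ A B u (t + 1) j = φ ((A *ᵥ state φ A B u t + B *ᵥ u t) j) := rfl

theorem state_congr {u u' : ℕ → Fin p → ℝ} {t : ℕ} (h : ∀ s < t, u s = u' s) :
    state φ A B u t = state φ A B u' t := by
  induction t with
  | zero => rfl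
  | succ t ih =>
    ext j
    rw [state_succ, state_succ, ih fun s hs => h s (hs.trans t.lt_succ_self), h t t.lt_succ_self]

/-- The activation does not increase distances, so the increment obeys the linear recursion with
gains ‖A‖ and ‖B‖. Cauchy–Schwarz in the form (a√(GS) + √E)² ≤ (a²G + 1)(S + E) reproduces the
recursion of `geomSq`, so no factor is lost. -/
theorem state_sub_dotProduct_self_le (hφ : IsIncreasingActivation β φ φ') (hβ : 0 < β)
    (u u' : ℕ → Fin p → ℝ) (t : ℕ) :
    (state φ A B u t - state φ A B u' t) ⬝ᵥ (state φ A B u t - state φ A B u' t)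
      ≤ specNorm B ^ 2 * geomSq (specNorm A) t
        * ∑ s ∈ Finset.range t, (u s - u' s) ⬝ᵥ (u s - u' s) := by
  induction t with
  | zero => simp [state, geomSq]
  | succ t ih =>
    set a := specNorm A
    set b := specNorm B
    set δ := state φ A B u t - state φ A B u' t with hδ
    set S := ∑ s ∈ Finset.range t, (u s - u' s) ⬝ᵥ (u s - u' s)
    set e := u t - u' t with he
    set G := geomSq a t
    have hG : 0 ≤ G := geomSq_nonneg _ _
    have hS : 0 ≤ S := Finset.sum_nonneg fun s _ => dotProduct_self_nonneg' _
    have hE : 0 ≤ e ⬝ᵥ e := dotProduct_self_nonneg' _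
    have h1 : (state φ A B u (t + 1) - state φ A B u' (t + 1)) ⬝ᵥ
        (state φ A B u (t + 1) - state φ A B u' (t + 1))
        ≤ (A *ᵥ δ + B *ᵥ e) ⬝ᵥ (A *ᵥ δ + B *ᵥ e) := by
      refine Finset.sum_le_sum fun j _ => ?_
      rw [← pow_two, ← pow_two, Pi.sub_apply, state_succ, state_succ]
      refine (hφ.sq_sub_le hβ _ _).trans (le_of_eq ?_)
      congr 1
      rw [hδ, he, Matrix.mulVec_sub, Matrix.mulVec_sub]
      simp
      ring
    set x := A *ᵥ δ
    set y := B *ᵥ e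
    have hx : x ⬝ᵥ x ≤ a ^ 2 * (b ^ 2 * G * S) :=
      (mulVec_dotProduct_self_le A δ).trans (mul_le_mul_of_nonneg_left ih (sq_nonneg _))
    have hy : y ⬝ᵥ y ≤ b ^ 2 * (e ⬝ᵥ e) := mulVec_dotProduct_self_le B e
    have hxy : (x + y) ⬝ᵥ (x + y) = x ⬝ᵥ x + y ⬝ᵥ y + 2 * (x ⬝ᵥ y) := by
      rw [add_dotProduct, dotProduct_add, dotProduct_add, dotProduct_comm y x]
      ring
    -- Cauchy–Schwarz, then the arithmetic–geometric mean inequality for a²G‖e‖² and S.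
    have hc : 2 * (x ⬝ᵥ y) ≤ b ^ 2 * (a ^ 2 * G * (e ⬝ᵥ e) + S) := by
      have h2 := dotProduct_sq_le x y
      have h3 : (x ⬝ᵥ x) * (y ⬝ᵥ y) ≤ a ^ 2 * (b ^ 2 * G * S) * (b ^ 2 * (e ⬝ᵥ e)) :=
        mul_le_mul hx hy (dotProduct_self_nonneg' _) (by positivity)
      refine le_of_sq_le_sq ?_ (by positivity)
      have h4 : 0 ≤ (b ^ 2) ^ 2 * (a ^ 2 * G * (e ⬝ᵥ e) - S) ^ 2 := by positivity
      nlinarith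
    refine h1.trans ?_
    rw [Finset.sum_range_succ, geomSq_succ, hxy]
    change _ ≤ b ^ 2 * (a ^ 2 * G + 1) * (S + e ⬝ᵥ e)
    nlinarith

/-- The squared Euclidean distance of two regression inputs is at most that of the driving input
sequences. -/
theorem sampleInput_sub_dotProduct_self_le (hφ : IsIncreasingActivation β φ φ') (hβ : 0 < β)
    {T : ℕ} (hB : 0 < stateBound A B T) (u u' : ℕ → Fin p → ℝ) :
    (sampleInput φ A B (1 / stateBound A B T) T u - sampleInput φ A B (1 / stateBound A B T) T u')
      ⬝ᵥ (sampleInput φ A B (1 / stateBound A B T) T u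
        - sampleInput φ A B (1 / stateBound A B T) T u')
      ≤ ∑ s ∈ Finset.range (T + 1), (u s - u' s) ⬝ᵥ (u s - u' s) := by
  have h1 := state_sub_dotProduct_self_le (A := A) (B := B) hφ hβ u u' T
  rw [← stateBound_sq] at h1
  rw [Finset.sum_range_succ]
  set S := ∑ s ∈ Finset.range T, (u s - u' s) ⬝ᵥ (u s - u' s)
  simp only [dotProduct, Fintype.sum_sum_type]
  refine add_le_add ?_ (le_of_eq ?_)
  · have h2 : ∀ i : Fin n, (sampleInput φ A B (1 / stateBound A B T) T u
        - sampleInput φ A B (1 / stateBound A B T) T u') (Sum.inl i)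
        = 1 / stateBound A B T * (state φ A B u T - state φ A B u' T) i := by
      intro i
      simp [sampleInput]
      ring
    simp only [h2]
    have h3 : ∀ i : Fin n, 1 / stateBound A B T * (state φ A B u T - state φ A B u' T) i *
        (1 / stateBound A B T * (state φ A B u T - state φ A B u' T) i)
        = (1 / stateBound A B T ^ 2) * ((state φ A B u T - state φ A B u' T) i
          * (state φ A B u T - state φ A B u' T) i) := by
      intro i
      field_simp
    simp only [h3]
    rw [← Finset.mul_sum, one_div_mul_eq_div, div_le_iff₀ (by positivity)]
    linarith [show _ = _ from mul_comm S (stateBound A B T ^ 2), h1,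
      show (state φ A B u T - state φ A B u' T) ⬝ᵥ (state φ A B u T - state φ A B u' T)
        = ∑ i, (state φ A B u T - state φ A B u' T) i * (state φ A B u T - state φ A B u' T) i
        from rfl]
  · simp [sampleInput]

/-- The sequence of input vectors with the given coordinates at the times `0, …, T`. -/
def inputSeq {p : ℕ} (T : ℕ) (g : Fin (T + 1) × Fin p → ℝ) : ℕ → Fin p → ℝ := fun t k =>
  if h : t < T + 1 then g (⟨t, h⟩, k) else 0

theorem inputSeq_sub (T : ℕ) (g g' : Fin (T + 1) × Fin p → ℝ) (t : ℕ) :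
    inputSeq T (g - g') t = inputSeq T g t - inputSeq T g' t := by
  ext k
  by_cases h : t < T + 1 <;> simp [inputSeq, h]

theorem inputSeq_add_smul (T : ℕ) (g c : Fin (T + 1) × Fin p → ℝ) (ε : ℝ) (t : ℕ) :
    inputSeq T (g + ε • c) t = inputSeq T g t + ε • inputSeq T c t := by
  ext k
  by_cases h : t < T + 1 <;> simp [inputSeq, h]

theorem sum_inputSeq_dotProduct_self (T : ℕ) (g : Fin (T + 1) × Fin p → ℝ) :
    ∑ s ∈ Finset.range (T + 1), inputSeq T g s ⬝ᵥ inputSeq T g s = g ⬝ᵥ g := by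
  rw [Finset.sum_range]
  simp only [dotProduct, Fintype.sum_prod_type]
  refine Finset.sum_congr rfl fun t _ => Finset.sum_congr rfl fun k _ => ?_
  simp [inputSeq, t.2]

/-- Only the inputs at times 0, …, T matter, so each linear functional of the sample is a function
of one finite Gaussian vector. The scaling makes its Lipschitz constant ‖w‖. -/
theorem euclLipschitz_dotProduct_sampleInput (hφ : IsIncreasingActivation β φ φ') (hβ : 0 < β)
    {T : ℕ} (hB : 0 < stateBound A B T) (w : Fin n ⊕ Fin p → ℝ) :
    EuclLipschitz (√(w ⬝ᵥ w)) fun g : Fin (T + 1) × Fin p → ℝ =>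
      w ⬝ᵥ sampleInput φ A B (1 / stateBound A B T) T (inputSeq T g) := by
  intro g g'
  rw [← dotProduct_sub, ← Real.sqrt_mul (dotProduct_self_nonneg' _)]
  refine Real.abs_le_sqrt ((dotProduct_sq_le _ _).trans
    (mul_le_mul_of_nonneg_left ?_ (dotProduct_self_nonneg' _)))
  refine (sampleInput_sub_dotProduct_self_le hφ hβ hB _ _).trans (le_of_eq ?_)
  simp_rw [← inputSeq_sub]
  exact sum_inputSeq_dotProduct_self T (g - g')

/-- If the state moves at rate `D₁` in direction `v` when the inputs are shifted along `c`, then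
the second moment of the difference of two independent copies of the regression input is large. -/
theorem le_integral_sq_of_state_increasing (hφ : IsIncreasingActivation β φ φ') (hβ : 0 < β)
    {T : ℕ} (hB : 0 < stateBound A B T) (v : Fin n → ℝ) (w : Fin p → ℝ)
    (c : ℕ → Fin p → ℝ) {D₁ : ℝ} (hD₁ : 0 ≤ D₁)
    (hc : ∑ s ∈ Finset.range T, c s ⬝ᵥ c s ≤ 1 / stateBound A B T * D₁)
    (hinc : ∀ (u u' : ℕ → Fin p → ℝ) (ε : ℝ), 0 < ε → (∀ s < T, u' s = u s + ε • c s) →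
      ε * D₁ ≤ v ⬝ᵥ (state φ A B u' T - state φ A B u T)) :
    2 * (1 / stateBound A B T * D₁ + w ⬝ᵥ w)
      ≤ ∫ z, (Sum.elim v w ⬝ᵥ sampleInput φ A B (1 / stateBound A B T) T (inputSeq T z.1)
          - Sum.elim v w ⬝ᵥ sampleInput φ A B (1 / stateBound A B T) T (inputSeq T z.2)) ^ 2
        ∂((stdG (Fin (T + 1) × Fin p)).prod (stdG (Fin (T + 1) × Fin p))) := by
  set μ := 1 / stateBound A B T with hμ
  have hμ0 : 0 < μ := by positivity
  set q := ∫ z, (Sum.elim v w ⬝ᵥ sampleInput φ A B μ T (inputSeq T z.1)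
          - Sum.elim v w ⬝ᵥ sampleInput φ A B μ T (inputSeq T z.2)) ^ 2
        ∂((stdG (Fin (T + 1) × Fin p)).prod (stdG (Fin (T + 1) × Fin p)))
  have hq : 0 ≤ q := integral_nonneg fun z => sq_nonneg _
  have hw := dotProduct_self_nonneg' w
  set D := μ * D₁ + w ⬝ᵥ w
  have hD : 0 ≤ D := by positivity
  -- The input at time T does not affect the state at time T, so it is shifted by w independently.
  -- The size condition on c gives ‖c'‖² ≤ D, so one factor D cancels from 2D² ≤ ‖c'‖² q.
  let c' : Fin (T + 1) × Fin p → ℝ := fun tk => if (tk.1 : ℕ) < T then c tk.1 tk.2 else w tk.2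
  have hc'1 : ∀ s < T, inputSeq T c' s = c s := by
    intro s hs
    ext k
    simp [inputSeq, c', hs, hs.trans T.lt_succ_self]
  have hc'2 : inputSeq T c' T = w := by
    ext k
    simp [inputSeq, c']
  have hcc : c' ⬝ᵥ c' ≤ D := by
    rw [← sum_inputSeq_dotProduct_self, Finset.sum_range_succ, hc'2]
    refine add_le_add (le_trans (le_of_eq ?_) hc) le_rfl
    exact Finset.sum_congr rfl fun s hs => by rw [hc'1 s (Finset.mem_range.1 hs)]
  have key := (euclLipschitz_dotProduct_sampleInput (A := A) (B := B) hφ hβ hB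
    (Sum.elim v w)).sq_le_of_increasing (Real.sqrt_nonneg _) c' hD (by
      intro g ε hε
      rw [← dotProduct_sub]
      have h1 := hinc (inputSeq T g) (inputSeq T (g + ε • c')) ε hε (fun s hs => by
        rw [inputSeq_add_smul, hc'1 s hs])
      have h2 : Sum.elim v w ⬝ᵥ (sampleInput φ A B μ T (inputSeq T (g + ε • c'))
          - sampleInput φ A B μ T (inputSeq T g))
          = μ * (v ⬝ᵥ (state φ A B (inputSeq T (g + ε • c')) T - state φ A B (inputSeq T g) T))
            + ε * (w ⬝ᵥ w) := by
        simp only [dotProduct, Fintype.sum_sum_type, Finset.mul_sum]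
        congr 1
        · refine Finset.sum_congr rfl fun i _ => ?_
          simp [sampleInput]
          ring
        · refine Finset.sum_congr rfl fun i _ => ?_
          simp [sampleInput, inputSeq_add_smul, hc'2]
          ring
      change ε * D ≤ Sum.elim v w ⬝ᵥ (sampleInput φ A B μ T (inputSeq T (g + ε • c'))
          - sampleInput φ A B μ T (inputSeq T g))
      rw [h2]
      have := mul_le_mul_of_nonneg_left h1 hμ0.le
      simp only [D]
      nlinarith)
  change 2 * D ^ 2 ≤ _ * q at key
  rcases hD.eq_or_lt with h | h
  · change 2 * D ≤ q
    rw [← h]; simpa using hq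
  · have h3 := mul_le_mul_of_nonneg_right hcc hq
    have h4 : D * (2 * D) ≤ D * q := by nlinarith
    exact le_of_mul_le_mul_left h4 h

end

/-! ### Lower bound on the covariance of the regression input. -/

section

variable {n p : ℕ} {β : ℝ} {φ φ' : ℝ → ℝ}

/-- Only the last input is shifted, which moves the preactivation along v, so every entry of the
state moves with the sign of v_j. An earlier shift would pass through A, which need not preserve
these signs. -/
theorem state_last_increasing {A : Matrix (Fin n) (Fin n) ℝ} {B : Matrix (Fin n) (Fin p) ℝ}
    (hφ : IsIncreasingActivation β φ φ') {T : ℕ} (v : Fin n → ℝ)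
    {k : ℝ} (hk : 0 ≤ k) (c : Fin p → ℝ) (hc : B *ᵥ c = k • v) (u u' : ℕ → Fin p → ℝ) {ε : ℝ}
    (hε : 0 < ε) (hu : ∀ s < T, u' s = u s) (huT : u' T = u T + ε • c) :
    ε * (β * k * (v ⬝ᵥ v)) ≤ v ⬝ᵥ (state φ A B u' (T + 1) - state φ A B u (T + 1)) := by
  have h1 : state φ A B u' T = state φ A B u T := state_congr hu
  simp only [dotProduct, Finset.mul_sum]
  refine Finset.sum_le_sum fun j _ => ?_
  rw [Pi.sub_apply, state_succ, state_succ, h1, huT, Matrix.mulVec_add, Matrix.mulVec_smul, hc]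
  set y := (A *ᵥ state φ A B u T + B *ᵥ u T) j with hy
  have h2 : (A *ᵥ state φ A B u T + (B *ᵥ u T + ε • k • v)) j = y + ε * k * v j := by
    simp [hy]; ring
  rw [h2]
  have h3 := hφ.mul_le_mul_sub (v j) y (y + ε * k * v j) (by
    have : v j * (y + ε * k * v j - y) = ε * k * (v j * v j) := by ring
    rw [this]
    exact mul_nonneg (by positivity) (mul_self_nonneg _))
  refine le_trans (le_of_eq ?_) h3
  ring

/-- For scalar states the shift at time s can carry the sign that A will give it by time T. With the
weight (β A)^(T-1-s) the contributions of all times reinforce each other and add up to the geometric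
sum. -/
theorem state_scalar_increasing {A : Matrix (Fin 1) (Fin 1) ℝ} {B : Matrix (Fin 1) (Fin p) ℝ}
    (hφ : IsIncreasingActivation β φ φ') (hβ : 0 < β) {T : ℕ} (v : ℝ) {m : ℝ} (hm : 0 ≤ m)
    (c : ℕ → Fin p → ℝ)
    (hc : ∀ s < T, B *ᵥ c s = fun _ => m * v * (β * A 0 0) ^ (T - 1 - s))
    (u u' : ℕ → Fin p → ℝ) {ε : ℝ} (hε : 0 < ε) (hu : ∀ s < T, u' s = u s + ε • c s) (t : ℕ)
    (ht : t ≤ T) :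
    ε * (β * m * v ^ 2 * ∑ s ∈ Finset.range t, ((β * A 0 0) ^ (T - 1 - s)) ^ 2)
      ≤ v * (β * A 0 0) ^ (T - t) * (state φ A B u' t 0 - state φ A B u t 0) := by
  induction t with
  | zero => simp [state]
  | succ t ih =>
    have ih := ih (by omega)
    set α := A 0 0
    set r := (β * α) ^ (T - 1 - t) with hr
    have hr1 : (β * α) ^ (T - t) = β * α * r := by
      rw [hr, ← pow_succ']; congr 1; omega
    have hr2 : T - (t + 1) = T - 1 - t := by omega
    rw [hr1] at ih
    rw [hr2, ← hr, Finset.sum_range_succ, ← hr]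
    set S := ∑ s ∈ Finset.range t, ((β * α) ^ (T - 1 - s)) ^ 2
    have hS : 0 ≤ S := Finset.sum_nonneg fun s _ => sq_nonneg _
    set Δ := state φ A B u' t 0 - state φ A B u t 0 with hΔ
    rw [state_succ, state_succ, hu t (by omega), Matrix.mulVec_add, Matrix.mulVec_smul, hc t (by omega)]
    set y := (A *ᵥ state φ A B u t + B *ᵥ u t) 0 with hy
    have h2 : (A *ᵥ state φ A B u' t + (B *ᵥ u t + ε • (fun _ => m * v * r : Fin 1 → ℝ))) 0
        = y + (α * Δ + ε * m * v * r) := by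
      have h3 : ∀ x : Fin 1 → ℝ, (A *ᵥ x) 0 = α * x 0 := by
        intro x; simp [Matrix.mulVec, dotProduct, α]
      simp only [hy, Pi.add_apply, h3, hΔ, Pi.smul_apply, smul_eq_mul]
      ring
    rw [h2]
    -- The induction hypothesis makes the propagated increment v β α r Δ nonnegative, and the new
    -- shift adds a square; this is the sign condition under which the slope bound applies.
    have hz : 0 ≤ β * (v * r * (α * Δ + ε * m * v * r)) := by
      have : β * (v * r * (α * Δ + ε * m * v * r))
          = v * (β * α * r) * Δ + ε * (β * m) * (v * r) ^ 2 := by ring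
      rw [this]
      have h4 : 0 ≤ ε * (β * m * v ^ 2 * S) := by positivity
      have h5 : 0 ≤ ε * (β * m) * (v * r) ^ 2 := by positivity
      linarith
    have h6 := hφ.mul_le_mul_sub (v * r) y (y + (α * Δ + ε * m * v * r)) (by
      rw [add_sub_cancel_left]
      exact nonneg_of_mul_nonneg_right hz hβ)
    rw [add_sub_cancel_left] at h6
    refine le_trans ?_ h6
    nlinarith

theorem stateBound_pos {A : Matrix (Fin n) (Fin n) ℝ} {B : Matrix (Fin n) (Fin p) ℝ}
    (hn : 1 ≤ n) (hnp : n ≤ p) (hB : 0 < sigmaMin B) {T : ℕ} (hT : 1 ≤ T) :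
    0 < stateBound A B T := by
  have h1 := sigmaMin_le_specNorm hn hnp B hB
  have h2 := one_le_geomSq (specNorm A) hT
  exact mul_pos (by linarith) (Real.sqrt_pos.2 (by linarith))

theorem geomSq_mono {a b : ℝ} (h : a ^ 2 ≤ b ^ 2) (t : ℕ) : geomSq a t ≤ geomSq b t :=
  Finset.sum_le_sum fun i _ => pow_le_pow_left₀ (sq_nonneg a) h i

theorem one_le_condNumber {A : Matrix (Fin n) (Fin n) ℝ} {B : Matrix (Fin n) (Fin p) ℝ}
    (hφ : IsIncreasingActivation β φ φ') (hβ : 0 < β)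
    (hn : 1 ≤ n) (hnp : n ≤ p) (hB : 0 < sigmaMin B) {T : ℕ} (hT : 1 ≤ T) :
    1 ≤ condNumber β A B T := by
  have h1 := sigmaMin_le_specNorm hn hnp B hB
  have hG := one_le_geomSq (specNorm A) hT
  have hβ1 := hφ.beta_le_one
  have hβ2 : β ^ 2 ≤ 1 := by nlinarith
  have h2 : β ^ 2 * sigmaMin B ^ 2 ≤ specNorm B ^ 2 := by
    have h3 := pow_le_pow_left₀ hB.le h1 2
    have h4 := mul_le_mul_of_nonneg_right hβ2 (sq_nonneg (sigmaMin B))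
    linarith
  have hpos : 0 < β ^ 2 * sigmaMin B ^ 2 := by positivity
  have hb := sq_nonneg (specNorm B)
  rw [condNumber, stateBound_sq]
  split_ifs with hn1
  · have h5 : geomSq (β * specNorm A) T ≤ geomSq (specNorm A) T := by
      refine geomSq_mono ?_ T
      rw [mul_pow]
      have := mul_le_mul_of_nonneg_right hβ2 (sq_nonneg (specNorm A))
      linarith
    have h6 := one_le_geomSq (β * specNorm A) hT
    rw [div_div, one_le_div (by positivity)]
    exact mul_le_mul h2 h5 (by linarith) hb
  · rw [one_le_div hpos]
    nlinarith

/-- The covariance of the regression input is at least the identity divided by the condition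
number. -/
theorem le_integral_sq_dotProduct_sampleInput {A : Matrix (Fin n) (Fin n) ℝ}
    {B : Matrix (Fin n) (Fin p) ℝ} (hφ : IsIncreasingActivation β φ φ') (hβ : 0 < β)
    (hn : 1 ≤ n) (hnp : n ≤ p) (hB : 0 < sigmaMin B) {T : ℕ} (hT : 1 ≤ T)
    (w : Fin n ⊕ Fin p → ℝ) :
    2 * (w ⬝ᵥ w / condNumber β A B T)
      ≤ ∫ z, (w ⬝ᵥ sampleInput φ A B (1 / stateBound A B T) T (inputSeq T z.1)
          - w ⬝ᵥ sampleInput φ A B (1 / stateBound A B T) T (inputSeq T z.2)) ^ 2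
        ∂((stdG (Fin (T + 1) × Fin p)).prod (stdG (Fin (T + 1) × Fin p))) := by
  have hsb := stateBound_pos (A := A) hn hnp hB hT
  have hρ := one_le_condNumber (A := A) hφ hβ hn hnp hB hT
  obtain ⟨v, x, rfl⟩ : ∃ v x, w = Sum.elim v x := ⟨w ∘ Sum.inl, w ∘ Sum.inr, by simp⟩
  have hw : Sum.elim v x ⬝ᵥ Sum.elim v x = v ⬝ᵥ v + x ⬝ᵥ x := by
    simp [dotProduct, Fintype.sum_sum_type]
  have hx0 := dotProduct_self_nonneg' x
  have hv0 := dotProduct_self_nonneg' v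
  have hx : x ⬝ᵥ x / condNumber β A B T ≤ x ⬝ᵥ x := div_le_self hx0 hρ
  set σ := sigmaMin B
  set μ := 1 / stateBound A B T with hμ
  have hμ0 : 0 < μ := by positivity
  -- This amplitude balances cost and gain: the shift has squared norm at most μ D₁, as
  -- `le_integral_sq_of_state_increasing` requires, and μ D₁ equals ‖v‖²/ρ.
  have hk0 : 0 ≤ μ * β * σ ^ 2 := by positivity
  rw [hw, add_div]
  by_cases hn1 : n = 1
  · subst hn1
    set α := A 0 0 with hα
    have hv : v = fun _ => v 0 := by ext i; fin_cases i; rfl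
    have hvv : v ⬝ᵥ v = v 0 ^ 2 := by simp [dotProduct, pow_two]
    have hρe : condNumber β A B T
        = stateBound A B T ^ 2 / (β ^ 2 * σ ^ 2) / geomSq (β * specNorm A) T := by
      simp [condNumber, σ]
    have hG : geomSq (β * specNorm A) T
        = ∑ s ∈ Finset.range T, ((β * α) ^ (T - 1 - s)) ^ 2 := by
      rw [geomSq, ← Finset.sum_range_reflect]
      refine Finset.sum_congr rfl fun s _ => ?_
      rw [mul_pow, specNorm_fin_one, ← mul_pow, ← pow_mul, ← pow_mul, mul_comm 2]
    have hGpos := one_le_geomSq (β * specNorm A) hT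
    set G := geomSq (β * specNorm A) T
    choose c hc1 hc2 using fun s : ℕ => exists_mulVec_eq hn hnp B hB
      (fun _ => (μ * β * σ ^ 2) * v 0 * (β * α) ^ (T - 1 - s))
    have key := le_integral_sq_of_state_increasing (A := A) (B := B) (T := T) hφ hβ hsb v x c
      (D₁ := β * (μ * β * σ ^ 2) * v 0 ^ 2 * G) (by positivity) (by
        have h1 : σ ^ 2 * ∑ s ∈ Finset.range T, c s ⬝ᵥ c s ≤ (μ * β * σ ^ 2) ^ 2 * v 0 ^ 2 * G := by
          rw [hG, Finset.mul_sum, Finset.mul_sum]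
          refine Finset.sum_le_sum fun s _ => (hc2 s).trans (le_of_eq ?_)
          simp [dotProduct]
          ring
        have h2 : (0 : ℝ) < σ ^ 2 := by positivity
        refine le_of_mul_le_mul_left (h1.trans (le_of_eq ?_)) h2
        ring) (fun u u' ε hε hu => by
        have h3 := state_scalar_increasing (A := A) (B := B) hφ hβ (v 0) hk0 c
          (fun s _ => hc1 s) u u' hε hu T le_rfl
        rw [← hα, ← hG] at h3
        refine h3.trans (le_of_eq ?_)
        simp [dotProduct])
    refine le_trans ?_ key
    refine mul_le_mul_of_nonneg_left (add_le_add (le_of_eq ?_) hx) zero_le_two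
    rw [hρe, hvv, ← hμ]
    have : stateBound A B T = 1 / μ := by simp [hμ]
    rw [this]
    field_simp
  · obtain ⟨T, rfl⟩ := Nat.exists_eq_add_of_le' hT
    have hρe : condNumber β A B (T + 1) = stateBound A B (T + 1) ^ 2 / (β ^ 2 * σ ^ 2) := by
      simp [condNumber, σ, hn1]
    obtain ⟨c, hc1, hc2⟩ := exists_mulVec_eq hn hnp B hB ((μ * β * σ ^ 2) • v)
    rw [smul_dotProduct, dotProduct_smul, smul_eq_mul, smul_eq_mul] at hc2
    -- T + 1 is the sampling time here, so index T is the last input that acts on the state.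
    have key := le_integral_sq_of_state_increasing (A := A) (B := B) (T := T + 1) hφ hβ hsb v x
      (fun s => if s = T then c else 0) (D₁ := β * (μ * β * σ ^ 2) * (v ⬝ᵥ v)) (by positivity) (by
        rw [Finset.sum_eq_single_of_mem T (by simp) (fun s _ hs => by simp [hs])]
        simp only [if_true]
        have h2 : (0 : ℝ) < σ ^ 2 := by positivity
        refine le_of_mul_le_mul_left (hc2.trans (le_of_eq ?_)) h2
        ring) (fun u u' ε hε hu =>
        state_last_increasing hφ v hk0 c hc1 u u' hε
          (fun s hs => by simpa [hs.ne] using hu s (by omega))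
          (by simpa using hu T (by omega)))
    refine le_trans ?_ key
    refine mul_le_mul_of_nonneg_left (add_le_add (le_of_eq ?_) hx) zero_le_two
    rw [hρe, ← hμ]
    have : stateBound A B (T + 1) = 1 / μ := by simp [hμ]
    rw [this]
    field_simp

end

/-! ### Contraction of stochastic gradient descent. -/

section

theorem frobSq_eq_sum_dotProduct {ι κ : Type} [Fintype ι] [Fintype κ] (M : Matrix ι κ ℝ) :
    frobSq M = ∑ i, M i ⬝ᵥ M i := by
  simp [frobSq, dotProduct, pow_two]

theorem frobSq_nonneg {ι κ : Type} [Fintype ι] [Fintype κ] (M : Matrix ι κ ℝ) : 0 ≤ frobSq M :=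
  Finset.sum_nonneg fun _ _ => Finset.sum_nonneg fun _ _ => sq_nonneg _

variable {n p : ℕ} {β : ℝ} {φ φ' : ℝ → ℝ}

theorem sampleOutput_eq (A : Matrix (Fin n) (Fin n) ℝ) (B : Matrix (Fin n) (Fin p) ℝ) {μ : ℝ}
    (hμ : μ ≠ 0) (T : ℕ) (u : ℕ → Fin p → ℝ) (j : Fin n) :
    sampleOutput φ A B T u j
      = φ ((groundTruth A B μ *ᵥ sampleInput φ A B μ T u) j) := by
  rw [sampleOutput, state_succ, groundTruth, sampleInput, Matrix.fromCols_mulVec_sumElim,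
    Matrix.smul_mulVec, Matrix.mulVec_smul, smul_smul, inv_mul_cancel₀ hμ, one_smul]

/-- One gradient step decreases the squared distance to the ground truth. -/
theorem frobSq_step_le (hφ : IsIncreasingActivation β φ φ') (hβ : 0 < β) (η : ℝ)
    (C Θ : Matrix (Fin n) (Fin n ⊕ Fin p) ℝ) (x : Fin n ⊕ Fin p → ℝ) (y : Fin n → ℝ)
    (hy : ∀ j, y j = φ ((C *ᵥ x) j)) {X : ℝ} (hX : x ⬝ᵥ x ≤ X) (hη : 0 ≤ η) :
    frobSq (Θ - η • lossGrad φ φ' x y Θ - C)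
      ≤ frobSq (Θ - C) - (2 * η * β ^ 2 - η ^ 2 * X) * ∑ j, ((Θ - C) j ⬝ᵥ x) ^ 2 := by
  rw [frobSq_eq_sum_dotProduct, frobSq_eq_sum_dotProduct, Finset.mul_sum, ← Finset.sum_sub_distrib]
  refine Finset.sum_le_sum fun j _ => ?_
  set a := (Θ *ᵥ x) j with ha
  set b := (C *ᵥ x) j with hb
  set g := (φ a - φ b) * φ' a with hg
  have hrow : (Θ - η • lossGrad φ φ' x y Θ - C) j = (Θ - C) j - (η * g) • x := by
    ext k
    simp [lossGrad, hy, hg, ha, hb]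
    ring
  have hd : (Θ - C) j ⬝ᵥ x = a - b := by
    change (Θ j - C j) ⬝ᵥ x = a - b
    rw [sub_dotProduct]
    rfl
  rw [hrow, sub_dotProduct, dotProduct_sub, dotProduct_sub, smul_dotProduct, dotProduct_smul,
    smul_dotProduct, dotProduct_smul, dotProduct_comm x, hd]
  simp only [smul_eq_mul]
  have hβ1 := hφ.le_deriv a
  have hβ2 := hφ.deriv_le a
  -- One factor β comes from the slope of φ, the other from φ'.
  have h1 : β ^ 2 * (a - b) ^ 2 ≤ g * (a - b) := by
    have h2 := hφ.mul_sub_le b a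
    have h3 : 0 ≤ (a - b) * (φ a - φ b) := le_trans (by positivity) h2
    have h4 := mul_le_mul_of_nonneg_right hβ1 h3
    have h5 := mul_le_mul_of_nonneg_left h2 hβ.le
    rw [hg]
    nlinarith
  have h2 : g ^ 2 ≤ (a - b) ^ 2 := by
    have h3 := hφ.sq_sub_le hβ b a
    have h4 : φ' a ^ 2 ≤ 1 := by nlinarith
    rw [hg, mul_pow]
    have := mul_le_mul_of_nonneg_left h4 (sq_nonneg (φ a - φ b))
    linarith
  have hx0 := dotProduct_self_nonneg' x
  have h3 : g ^ 2 * (x ⬝ᵥ x) ≤ (a - b) ^ 2 * X := mul_le_mul h2 hX hx0 (sq_nonneg _)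
  have h4 := mul_le_mul_of_nonneg_left h3 (sq_nonneg η)
  have h5 := mul_le_mul_of_nonneg_left h1 hη
  nlinarith

theorem integral_uniformOn_univ {N : ℕ} (f : Fin N → ℝ) :
    ∫ i, f i ∂(uniformOn (Set.univ : Set (Fin N))) = (N : ℝ)⁻¹ * ∑ i, f i := by
  rcases Nat.eq_zero_or_pos N with rfl | hN
  · simp [integral_of_isEmpty]
  have : Nonempty (Fin N) := ⟨⟨0, hN⟩⟩
  have : IsProbabilityMeasure (uniformOn (Set.univ : Set (Fin N))) :=
    isProbabilityMeasure_uniformOn Set.finite_univ Set.univ_nonempty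
  rw [integral_fintype (.of_finite), Finset.mul_sum]
  refine Finset.sum_congr rfl fun i _ => ?_
  rw [measureReal_def, uniformOn_univ]
  simp

theorem sgd_congr {N : ℕ} {η : ℝ} {x : Fin N → Fin n ⊕ Fin p → ℝ}
    {y : Fin N → Fin n → ℝ} {Θ₀ : Matrix (Fin n) (Fin n ⊕ Fin p) ℝ} {r r' : ℕ → Fin N} {τ : ℕ}
    (h : ∀ s < τ, r s = r' s) : sgd φ φ' η x y Θ₀ r τ = sgd φ φ' η x y Θ₀ r' τ := by
  induction τ with
  | zero => rfl
  | succ τ ih =>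
    rw [sgd, sgd, ih fun s hs => h s (hs.trans τ.lt_succ_self), h τ τ.lt_succ_self]

/-- Averaging a function of the first `τ` independent uniform indices and of the next one. -/
theorem integral_uniform_succ {N : ℕ} (hN : 0 < N) {Ω' : Type*} [MeasurableSpace Ω']
    {Q : Measure Ω'} [IsProbabilityMeasure Q] {r : ℕ → Ω' → Fin N}
    (hr : ∀ τ, HasLaw (r τ) (uniformOn Set.univ) Q) (hind : iIndepFun r Q) (τ : ℕ)
    (H : (ℕ → Fin N) → Fin N → ℝ) (hH : ∀ s s' i, (∀ t < τ, s t = s' t) → H s i = H s' i) :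
    Integrable (fun ω' => H (fun s => r s ω') (r τ ω')) Q ∧
      Integrable (fun ω' => (N : ℝ)⁻¹ * ∑ i, H (fun s => r s ω') i) Q ∧
      ∫ ω', H (fun s => r s ω') (r τ ω') ∂Q
        = ∫ ω', (N : ℝ)⁻¹ * ∑ i, H (fun s => r s ω') i ∂Q := by
  have hm : ∀ s, AEMeasurable (r s) Q := fun s => (hr s).aemeasurable
  let X : Ω' → (Finset.range τ → Fin N) := fun ω' s => r s ω'
  -- Extends the first τ indices by an arbitrary later value, which is harmless since H ignores it.
  -- Both arguments of H then range over finite types, and independence allows Fubini.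
  let e : (Finset.range τ → Fin N) → ℕ → Fin N := fun f s =>
    if h : s ∈ Finset.range τ then f ⟨s, h⟩ else ⟨0, hN⟩
  have hX : AEMeasurable X Q := aemeasurable_pi_lambda _ fun s => hm s
  have hHX : ∀ ω' i, H (fun s => r s ω') i = H (e (X ω')) i := by
    intro ω' i
    refine hH _ _ _ fun t ht => ?_
    simp [e, X, ht]
  have hXY : IndepFun X (r τ) Q := by
    have h1 := hind.indepFun_finset₀ (Finset.range τ) {τ} (by simp) hm
    have h2 : Measurable fun f : (({τ} : Finset ℕ) → Fin N) => f ⟨τ, Finset.mem_singleton_self τ⟩ :=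
      measurable_pi_apply _
    exact h1.comp measurable_id h2
  have hmap := (indepFun_iff_map_prod_eq_prod_map_map hX (hm τ)).1 hXY
  have : IsProbabilityMeasure (Q.map X) := Measure.isProbabilityMeasure_map hX
  have : IsProbabilityMeasure (Q.map (r τ)) := Measure.isProbabilityMeasure_map (hm τ)
  have hXr : AEMeasurable (fun ω' => (X ω', r τ ω')) Q := hX.prodMk (hm τ)
  let F : (Finset.range τ → Fin N) × Fin N → ℝ := fun z => H (e z.1) z.2
  have hF : Integrable F ((Q.map X).prod (Q.map (r τ))) := .of_finite
  have hF' : Integrable F (Q.map fun ω' => (X ω', r τ ω')) := by rwa [hmap]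
  let K : (Finset.range τ → Fin N) → ℝ := fun f => (N : ℝ)⁻¹ * ∑ i, H (e f) i
  have hK : Integrable K (Q.map X) := .of_finite
  simp_rw [hHX]
  refine ⟨hF'.comp_aemeasurable hXr, hK.comp_aemeasurable hX, ?_⟩
  rw [← integral_map (f := F) hXr hF'.aestronglyMeasurable, hmap, integral_prod _ hF,
    ← integral_map (f := K) hX hK.aestronglyMeasurable]
  refine integral_congr_ae (ae_of_all _ fun f => ?_)
  simp only [F, K]
  rw [(hr τ).map_eq, integral_uniformOn_univ]

/-- Linear convergence in expectation of SGD on samples whose empirical second moment matrix is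
bounded below. -/
theorem integral_frobSq_sgd_le (hφ : IsIncreasingActivation β φ φ') (hβ : 0 < β)
    {N : ℕ} (hN : 0 < N) {Ω' : Type*} [MeasurableSpace Ω']
    {Q : Measure Ω'} [IsProbabilityMeasure Q] {r : ℕ → Ω' → Fin N}
    (hr : ∀ τ, HasLaw (r τ) (uniformOn Set.univ) Q) (hind : iIndepFun r Q)
    {η X l q : ℝ} (hη : 0 ≤ η) (hηX : 0 ≤ 2 * η * β ^ 2 - η ^ 2 * X) (hq : 0 ≤ q)
    (hlq : 1 - (2 * η * β ^ 2 - η ^ 2 * X) * l ≤ q)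
    (C Θ₀ : Matrix (Fin n) (Fin n ⊕ Fin p) ℝ) (x : Fin N → Fin n ⊕ Fin p → ℝ)
    (y : Fin N → Fin n → ℝ) (hy : ∀ i j, y i j = φ ((C *ᵥ x i) j)) (hX : ∀ i, x i ⬝ᵥ x i ≤ X)
    (hl : ∀ w : Fin n ⊕ Fin p → ℝ, l * (w ⬝ᵥ w) ≤ (N : ℝ)⁻¹ * ∑ i, (w ⬝ᵥ x i) ^ 2) (τ : ℕ) :
    Integrable (fun ω' => frobSq (sgd φ φ' η x y Θ₀ (fun s => r s ω') τ - C)) Q ∧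
      ∫ ω', frobSq (sgd φ φ' η x y Θ₀ (fun s => r s ω') τ - C) ∂Q
        ≤ q ^ τ * frobSq (Θ₀ - C) := by
  have hstep : ∀ Θ : Matrix (Fin n) (Fin n ⊕ Fin p) ℝ,
      (N : ℝ)⁻¹ * ∑ i, frobSq (Θ - η • lossGrad φ φ' (x i) (y i) Θ - C) ≤ q * frobSq (Θ - C) := by
    intro Θ
    have hN' : (0 : ℝ) < N := by exact_mod_cast hN
    set f := frobSq (Θ - C) with hf
    have hf0 : 0 ≤ f := frobSq_nonneg _
    have h1 : ∑ i, frobSq (Θ - η • lossGrad φ φ' (x i) (y i) Θ - C)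
        ≤ ∑ i, (f - (2 * η * β ^ 2 - η ^ 2 * X) * ∑ j, ((Θ - C) j ⬝ᵥ x i) ^ 2) :=
      Finset.sum_le_sum fun i _ => frobSq_step_le hφ hβ η C Θ (x i) (y i) (hy i) (hX i) hη
    have h2 : l * f ≤ (N : ℝ)⁻¹ * ∑ i, ∑ j, ((Θ - C) j ⬝ᵥ x i) ^ 2 := by
      rw [hf, frobSq_eq_sum_dotProduct, Finset.mul_sum, Finset.sum_comm, Finset.mul_sum]
      exact Finset.sum_le_sum fun j _ => hl _
    have h3 : (N : ℝ)⁻¹ * ∑ i, (f - (2 * η * β ^ 2 - η ^ 2 * X) * ∑ j, ((Θ - C) j ⬝ᵥ x i) ^ 2)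
        = f - (2 * η * β ^ 2 - η ^ 2 * X) * ((N : ℝ)⁻¹ * ∑ i, ∑ j, ((Θ - C) j ⬝ᵥ x i) ^ 2) := by
      rw [Finset.sum_sub_distrib, ← Finset.mul_sum]
      simp
      field_simp
    have h4 := mul_le_mul_of_nonneg_left h1 (inv_nonneg.2 hN'.le)
    have h5 := mul_le_mul_of_nonneg_left h2 hηX
    have h6 := mul_le_mul_of_nonneg_right hlq hf0
    nlinarith
  induction τ with
  | zero => simp [sgd]
  | succ τ ih =>
    obtain ⟨ih1, ih2⟩ := ih
    obtain ⟨k1, k2, k3⟩ := integral_uniform_succ hN hr hind τ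
      (fun s i => frobSq (sgd φ φ' η x y Θ₀ s τ
        - η • lossGrad φ φ' (x i) (y i) (sgd φ φ' η x y Θ₀ s τ) - C))
      (fun s s' i h => by simp only [sgd_congr h])
    refine ⟨k1, ?_⟩
    calc _ = _ := k3
      _ ≤ ∫ ω', q * frobSq (sgd φ φ' η x y Θ₀ (fun s => r s ω') τ - C) ∂Q :=
        integral_mono k2 (ih1.const_mul q) fun ω' => hstep _
      _ = q * ∫ ω', frobSq (sgd φ φ' η x y Θ₀ (fun s => r s ω') τ - C) ∂Q := integral_const_mul _ _
      _ ≤ q * (q ^ τ * frobSq (Θ₀ - C)) := mul_le_mul_of_nonneg_left ih2 hq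
      _ = _ := by ring

end

/-! ### Exponential moments of the states and the norm bound on the samples. -/

section

variable {n p : ℕ} {β : ℝ} {φ φ' : ℝ → ℝ} {A : Matrix (Fin n) (Fin n) ℝ}
  {B : Matrix (Fin n) (Fin p) ℝ}

theorem measurable_mulVec' {m k : ℕ} (M : Matrix (Fin m) (Fin k) ℝ) :
    Measurable fun v : Fin k → ℝ => M *ᵥ v := by
  unfold Matrix.mulVec dotProduct
  fun_prop

theorem measurable_dotProduct_self {ι : Type*} [Fintype ι] :
    Measurable fun v : ι → ℝ => v ⬝ᵥ v := by
  unfold dotProduct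
  fun_prop

/-- The square is linearised by an auxiliary Gaussian g in dimension n. Integrating u first produces
s ‖Bᵀg‖² ≤ s ‖B‖² ‖g‖² in the exponent, and a Gaussian integral over g remains; so the power is n
rather than p. -/
theorem lintegral_exp_affine_le {s : ℝ} (hs : 0 ≤ s) (hsB : 2 * (s * specNorm B ^ 2) < 1)
    (m : Fin n → ℝ) :
    ∫⁻ u, ENNReal.ofReal (Real.exp (s * ((m + B *ᵥ u) ⬝ᵥ (m + B *ᵥ u)))) ∂(stdG (Fin p))
      ≤ ENNReal.ofReal ((√(1 - 2 * (s * specNorm B ^ 2)))⁻¹ ^ n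
        * Real.exp (s / (1 - 2 * (s * specNorm B ^ 2)) * (m ⬝ᵥ m))) := by
  have hsq : √(2 * s) * √(2 * s) = 2 * s := Real.mul_self_sqrt (by positivity)
  have h1 : ∀ y : Fin n → ℝ, ENNReal.ofReal (Real.exp (s * (y ⬝ᵥ y)))
      = ∫⁻ g, ENNReal.ofReal (Real.exp ((√(2 * s) • y) ⬝ᵥ g)) ∂(stdG (Fin n)) := by
    intro y
    rw [lintegral_exp_dotProduct_stdG, smul_dotProduct, dotProduct_smul, smul_eq_mul, smul_eq_mul,
      ← mul_assoc, hsq]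
    congr 2
    ring
  simp_rw [h1]
  have hm : Measurable (Function.uncurry fun (u : Fin p → ℝ) (g : Fin n → ℝ) =>
      ENNReal.ofReal (Real.exp ((√(2 * s) • (m + B *ᵥ u)) ⬝ᵥ g))) := by
    refine (Real.measurable_exp.comp ?_).ennreal_ofReal
    have := measurable_mulVec' B
    unfold dotProduct
    refine Finset.measurable_sum _ fun i _ => ?_
    have h2 : Measurable fun z : (Fin p → ℝ) × (Fin n → ℝ) => (√(2 * s) • (m + B *ᵥ z.1)) i :=
      ((measurable_pi_apply i).comp ((this.comp measurable_fst).const_add m)).const_mul _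
    exact h2.mul (by fun_prop)
  rw [lintegral_lintegral_swap hm.aemeasurable]
  have h3 : ∀ g : Fin n → ℝ,
      ∫⁻ u, ENNReal.ofReal (Real.exp ((√(2 * s) • (m + B *ᵥ u)) ⬝ᵥ g)) ∂(stdG (Fin p))
        ≤ ENNReal.ofReal (Real.exp ((√(2 * s) • m) ⬝ᵥ g + (s * specNorm B ^ 2) * (g ⬝ᵥ g))) := by
    intro g
    have e : ∀ u : Fin p → ℝ, ENNReal.ofReal (Real.exp ((√(2 * s) • (m + B *ᵥ u)) ⬝ᵥ g))
        = ENNReal.ofReal (Real.exp ((√(2 * s) • m) ⬝ᵥ g))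
          * ENNReal.ofReal (Real.exp ((√(2 * s) • (g ᵥ* B)) ⬝ᵥ u)) := by
      intro u
      rw [← ENNReal.ofReal_mul (Real.exp_pos _).le, ← Real.exp_add]
      congr 2
      rw [smul_add, add_dotProduct, smul_dotProduct _ (B *ᵥ u), smul_dotProduct _ (g ᵥ* B),
        ← dotProduct_mulVec, dotProduct_comm (B *ᵥ u)]
    simp_rw [e]
    rw [lintegral_const_mul _ ((measurable_dotProduct_left _).exp.ennreal_ofReal),
      lintegral_exp_dotProduct_stdG, ← ENNReal.ofReal_mul (Real.exp_pos _).le, ← Real.exp_add]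
    refine ENNReal.ofReal_le_ofReal (Real.exp_le_exp.2 (add_le_add le_rfl ?_))
    rw [smul_dotProduct, dotProduct_smul, smul_eq_mul, smul_eq_mul, ← mul_assoc, hsq]
    have := mul_le_mul_of_nonneg_left (vecMul_dotProduct_self_le B g) hs
    linarith
  refine (lintegral_mono h3).trans (le_of_eq ?_)
  have h4 : √(2 * s) * (√(2 * s) * (m ⬝ᵥ m)) = 2 * s * (m ⬝ᵥ m) := by rw [← mul_assoc, hsq]
  rw [lintegral_exp_stdG hsB, Fintype.card_fin, smul_dotProduct, dotProduct_smul, smul_eq_mul,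
    smul_eq_mul, h4]
  have : 1 - 2 * (s * specNorm B ^ 2) ≠ 0 := by linarith
  congr 3
  field_simp

theorem measurable_state (hφ : Continuous φ) (A : Matrix (Fin n) (Fin n) ℝ)
    (B : Matrix (Fin n) (Fin p) ℝ) (t : ℕ) :
    Measurable fun u : ℕ → Fin p → ℝ => state φ A B u t := by
  induction t with
  | zero => exact measurable_const
  | succ t ih =>
    refine measurable_pi_lambda _ fun j => hφ.measurable.comp ?_
    have h1 := (measurable_mulVec' A).comp ih
    have h2 := (measurable_mulVec' B).comp (measurable_pi_apply (X := fun _ : ℕ => Fin p → ℝ) t)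
    exact (measurable_pi_apply j).comp (h1.add h2)

variable {Ω : Type*} [MeasurableSpace Ω] {P : Measure Ω}

/-- The current state is independent of the current input. -/
theorem indepFun_state (hφ : Continuous φ) (A : Matrix (Fin n) (Fin n) ℝ)
    (B : Matrix (Fin n) (Fin p) ℝ) {u : ℕ → Ω → Fin p → ℝ}
    (hu : ∀ t, AEMeasurable (u t) P) (hind : iIndepFun u P) (t : ℕ) :
    IndepFun (fun ω => state φ A B (fun s => u s ω) t) (u t) P := by
  let e : (Finset.range t → Fin p → ℝ) → ℕ → Fin p → ℝ := fun f s =>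
    if h : s ∈ Finset.range t then f ⟨s, h⟩ else 0
  have he : Measurable e := measurable_pi_lambda _ fun s => by
    by_cases h : s ∈ Finset.range t
    · simp only [e, h, dif_pos]
      exact measurable_pi_apply (⟨s, h⟩ : Finset.range t)
    · simp only [e, h, dif_neg, not_false_eq_true]
      exact measurable_const
  have h1 := hind.indepFun_finset₀ (Finset.range t) {t} (by simp) hu
  have h2 : Measurable fun f : (({t} : Finset ℕ) → Fin p → ℝ) =>
      f ⟨t, Finset.mem_singleton_self t⟩ := measurable_pi_apply _
  have h3 := h1.comp ((measurable_state hφ A B t).comp he) h2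
  have h4 : (fun ω => state φ A B (fun s => u s ω) t)
      = ((fun v => state φ A B v t) ∘ e) ∘ fun ω (s : Finset.range t) => u s ω := by
    funext ω
    refine state_congr fun s hs => ?_
    simp [e, hs]
  rw [h4]
  exact h3

/-- The bound is the exponential moment of a Gaussian vector with covariance `stateBound`² times the
identity. As |φ(y)| ≤ |y|, integrating out the last input, which is independent of the state,
replaces s by s ‖A‖² / κ at the cost of κ^(-n/2). -/
theorem lintegral_exp_state_le [IsProbabilityMeasure P]
    (hφ : IsIncreasingActivation β φ φ') (hβ : 0 < β) {u : ℕ → Ω → Fin p → ℝ} (hu : ∀ t, HasLaw (u t) (stdG (Fin p)) P) (hind : iIndepFun u P)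
    (t : ℕ) {s : ℝ} (hs : 0 ≤ s) (hsG : 2 * (s * specNorm B ^ 2) * geomSq (specNorm A) t < 1) :
    ∫⁻ ω, ENNReal.ofReal (Real.exp (s * (state φ A B (fun k => u k ω) t
        ⬝ᵥ state φ A B (fun k => u k ω) t))) ∂P
      ≤ ENNReal.ofReal ((√(1 - 2 * (s * specNorm B ^ 2) * geomSq (specNorm A) t))⁻¹ ^ n) := by
  induction t generalizing s with
  | zero => simp [state, geomSq]
  | succ t ih =>
    have hum : ∀ t, AEMeasurable (u t) P := fun t => (hu t).aemeasurable
    have huu : AEMeasurable (fun ω k => u k ω) P := aemeasurable_pi_lambda _ hum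
    have hh : AEMeasurable (fun ω => state φ A B (fun k => u k ω) t) P :=
      (measurable_state (hφ.continuous hβ) A B t).comp_aemeasurable huu
    set a := specNorm A
    set b := specNorm B
    set G := geomSq a t with hG
    have hG0 : 0 ≤ G := geomSq_nonneg _ _
    rw [geomSq_succ] at hsG
    have hab : 0 ≤ 2 * (s * b ^ 2) * (a ^ 2 * G) := by positivity
    have hsB : 2 * (s * b ^ 2) < 1 := by nlinarith
    set κ := 1 - 2 * (s * b ^ 2) with hκ
    have hκ0 : 0 < κ := by linarith
    let F : (Fin n → ℝ) × (Fin p → ℝ) → ℝ≥0∞ := fun z =>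
      ENNReal.ofReal (Real.exp (s * ((A *ᵥ z.1 + B *ᵥ z.2) ⬝ᵥ (A *ᵥ z.1 + B *ᵥ z.2))))
    have hF : Measurable F := by
      have h1 : Measurable fun z : (Fin n → ℝ) × (Fin p → ℝ) => A *ᵥ z.1 + B *ᵥ z.2 :=
        ((measurable_mulVec' A).comp measurable_fst).add ((measurable_mulVec' B).comp measurable_snd)
      exact ((measurable_dotProduct_self.comp h1).const_mul s).exp.ennreal_ofReal
    have hle : ∀ ω, ENNReal.ofReal (Real.exp (s * (state φ A B (fun k => u k ω) (t + 1)
        ⬝ᵥ state φ A B (fun k => u k ω) (t + 1)))) ≤ F (state φ A B (fun k => u k ω) t, u t ω) := by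
      intro ω
      refine ENNReal.ofReal_le_ofReal (Real.exp_le_exp.2 (mul_le_mul_of_nonneg_left ?_ hs))
      refine Finset.sum_le_sum fun j _ => ?_
      rw [← pow_two, ← pow_two, state_succ]
      simpa [hφ.map_zero] using hφ.sq_sub_le hβ 0 _
    refine (lintegral_mono hle).trans ?_
    have hmap := (indepFun_iff_map_prod_eq_prod_map_map hh (hum t)).1
      (indepFun_state (hφ.continuous hβ) A B hum hind t)
    rw [← lintegral_map' (f := F) (g := fun ω => (state φ A B (fun k => u k ω) t, u t ω))
      hF.aemeasurable (hh.prodMk (hum t)), hmap, lintegral_prod _ hF.aemeasurable, (hu t).map_eq]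
    have hstep : ∀ x : Fin n → ℝ, ∫⁻ y, F (x, y) ∂(stdG (Fin p))
        ≤ ENNReal.ofReal ((√κ)⁻¹ ^ n) * ENNReal.ofReal (Real.exp (s / κ * a ^ 2 * (x ⬝ᵥ x))) := by
      intro x
      refine (lintegral_exp_affine_le hs hsB (A *ᵥ x)).trans ?_
      rw [← ENNReal.ofReal_mul (by positivity)]
      refine ENNReal.ofReal_le_ofReal (mul_le_mul_of_nonneg_left (Real.exp_le_exp.2 ?_)
        (by positivity))
      rw [mul_assoc]
      exact mul_le_mul_of_nonneg_left (mulVec_dotProduct_self_le A x) (by positivity)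
    refine (lintegral_mono hstep).trans ?_
    have hm : Measurable fun x : Fin n → ℝ =>
        ENNReal.ofReal (Real.exp (s / κ * a ^ 2 * (x ⬝ᵥ x))) :=
      (measurable_dotProduct_self.const_mul _).exp.ennreal_ofReal
    rw [lintegral_const_mul _ hm, lintegral_map' hm.aemeasurable hh]
    -- The admissibility quantity at time t + 1 is κ times the one at time t for the new parameter,
    -- so the prefactors combine exactly.
    have hrat : 1 - 2 * (s / κ * a ^ 2 * b ^ 2) * G
        = (1 - 2 * (s * b ^ 2) * (a ^ 2 * G + 1)) / κ := by
      field_simp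
      rw [hκ]
      ring
    have hpos : 0 < (1 - 2 * (s * b ^ 2) * (a ^ 2 * G + 1)) / κ := div_pos (by linarith) hκ0
    have := ih (s := s / κ * a ^ 2) (by positivity) (by linarith)
    refine (mul_le_mul_right this _).trans (le_of_eq ?_)
    rw [← ENNReal.ofReal_mul (by positivity), ← mul_pow, ← mul_inv, geomSq_succ, hrat,
      ← Real.sqrt_mul hκ0.le, mul_div_cancel₀ _ hκ0.ne']

/-- Chernoff's bound: the moment 2^k ≤ e^d uses up one of the 101 units of d. -/
theorem measureReal_dotProduct_self_ge_le {m : ℕ} {X : Ω → Fin m → ℝ} (hX : AEMeasurable X P)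
    {k : ℕ} {d : ℝ} (hk : (k : ℝ) ≤ d) {s : ℝ}
    (h : ∫⁻ ω, ENNReal.ofReal (Real.exp (s * (X ω ⬝ᵥ X ω))) ∂P ≤ ENNReal.ofReal (2 ^ k)) :
    P.real {ω | 101 * d ≤ s * (X ω ⬝ᵥ X ω)} ≤ Real.exp (-100 * d) := by
  have hm : AEMeasurable (fun ω => ENNReal.ofReal (Real.exp (s * (X ω ⬝ᵥ X ω)))) P :=
    ((measurable_dotProduct_self.comp_aemeasurable hX).const_mul s).exp.ennreal_ofReal
  have h1 := mul_meas_ge_le_lintegral₀ hm (ENNReal.ofReal (Real.exp (101 * d)))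
  have h2 : {ω | 101 * d ≤ s * (X ω ⬝ᵥ X ω)} ⊆ {ω | ENNReal.ofReal (Real.exp (101 * d))
      ≤ ENNReal.ofReal (Real.exp (s * (X ω ⬝ᵥ X ω)))} := fun ω hω =>
    ENNReal.ofReal_le_ofReal (Real.exp_le_exp.2 hω)
  have h3 : ENNReal.ofReal (Real.exp (101 * d)) * P {ω | 101 * d ≤ s * (X ω ⬝ᵥ X ω)}
      ≤ ENNReal.ofReal (2 ^ k) := (mul_le_mul_right (measure_mono h2) _).trans (h1.trans h)
  have h4 := ENNReal.toReal_mono ENNReal.ofReal_ne_top h3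
  rw [ENNReal.toReal_mul, ENNReal.toReal_ofReal (Real.exp_pos _).le,
    ENNReal.toReal_ofReal (by positivity)] at h4
  have h5 : (2 : ℝ) ^ k ≤ Real.exp d := by
    calc (2 : ℝ) ^ k ≤ Real.exp 1 ^ k := by
          refine pow_le_pow_left₀ (by norm_num) ?_ k
          have := Real.add_one_le_exp (1 : ℝ)
          linarith
      _ = Real.exp k := by rw [← Real.exp_nat_mul, mul_one]
      _ ≤ Real.exp d := Real.exp_le_exp.2 hk
  have h6 : Real.exp (101 * d) * P.real {ω | 101 * d ≤ s * (X ω ⬝ᵥ X ω)}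
      ≤ Real.exp (101 * d) * Real.exp (-100 * d) := by
    rw [← Real.exp_add]
    refine (h4.trans h5).trans (le_of_eq ?_)
    congr 1
    ring
  exact le_of_mul_le_mul_left h6 (Real.exp_pos _)

theorem inv_sqrt_half_pow_le (k : ℕ) : (√(1 / 2 : ℝ))⁻¹ ^ k ≤ 2 ^ k := by
  refine pow_le_pow_left₀ (by positivity) ?_ k
  refine inv_le_of_inv_le₀ (by norm_num) ?_
  exact Real.le_sqrt_of_sq_le (by norm_num)

/-- The regression input has squared norm at most `1000 (n + p)` with high probability. -/
theorem measureReal_sampleInput_gt_le [IsProbabilityMeasure P]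
    (hφ : IsIncreasingActivation β φ φ') (hβ : 0 < β) {T : ℕ} (hB : 0 < stateBound A B T)
    {u : ℕ → Ω → Fin p → ℝ} (hu : ∀ t, HasLaw (u t) (stdG (Fin p)) P) (hind : iIndepFun u P) :
    P.real {ω | 1000 * ((n : ℝ) + p) < sampleInput φ A B (1 / stateBound A B T) T (fun k => u k ω)
        ⬝ᵥ sampleInput φ A B (1 / stateBound A B T) T (fun k => u k ω)}
      ≤ 2 * Real.exp (-100 * ((n : ℝ) + p)) := by
  have hum : ∀ t, AEMeasurable (u t) P := fun t => (hu t).aemeasurable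
  have huu : AEMeasurable (fun ω k => u k ω) P := aemeasurable_pi_lambda _ hum
  have hh : AEMeasurable (fun ω => state φ A B (fun k => u k ω) T) P :=
    (measurable_state (hφ.continuous hβ) A B T).comp_aemeasurable huu
  set b := stateBound A B T with hb
  have hn0 : (0 : ℝ) ≤ n := by positivity
  have hp0 : (0 : ℝ) ≤ p := by positivity
  have hsb : (1 / (4 * b ^ 2)) * specNorm B ^ 2 * geomSq (specNorm A) T = 1 / 4 := by
    rw [mul_assoc, ← stateBound_sq, ← hb]
    field_simp
  -- With this parameter 2 s b² = 1/2. The scaled state and the input each have squared norm below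
  -- 404 (n + p) off an exceptional event, 808 (n + p) together.
  have e1 := lintegral_exp_state_le (A := A) (B := B) hφ hβ hu hind T (s := 1 / (4 * b ^ 2))
    (by positivity) (by linarith)
  have e2 : 1 - 2 * ((1 / (4 * b ^ 2)) * specNorm B ^ 2) * geomSq (specNorm A) T = 1 / 2 := by
    linarith
  rw [e2] at e1
  have e3 := measureReal_dotProduct_self_ge_le hh (d := (n : ℝ) + p) (k := n) (by linarith)
    (e1.trans (ENNReal.ofReal_le_ofReal (inv_sqrt_half_pow_le n)))
  have e4 : ∫⁻ ω, ENNReal.ofReal (Real.exp (1 / 4 * (u T ω ⬝ᵥ u T ω))) ∂P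
      ≤ ENNReal.ofReal (2 ^ p) := by
    have hm : Measurable fun x : Fin p → ℝ => ENNReal.ofReal (Real.exp (1 / 4 * (x ⬝ᵥ x))) :=
      (measurable_dotProduct_self.const_mul _).exp.ennreal_ofReal
    rw [← lintegral_map' (f := fun x : Fin p → ℝ => ENNReal.ofReal (Real.exp (1 / 4 * (x ⬝ᵥ x))))
      hm.aemeasurable (hum T), (hu T).map_eq]
    have := lintegral_exp_stdG (ι := Fin p) (κ := 1 / 4) (by norm_num) 0
    simp only [zero_dotProduct, zero_add, zero_div, Real.exp_zero, mul_one, Fintype.card_fin] at this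
    rw [this]
    refine ENNReal.ofReal_le_ofReal ?_
    have e5 : (1 - 2 * (1 / 4) : ℝ) = 1 / 2 := by norm_num
    rw [e5]
    exact inv_sqrt_half_pow_le p
  have e5 := measureReal_dotProduct_self_ge_le (hum T) (d := (n : ℝ) + p) (k := p) (by linarith) e4
  refine (measureReal_mono (s₂ := {ω | 101 * ((n : ℝ) + p) ≤ 1 / (4 * b ^ 2) *
      (state φ A B (fun k => u k ω) T ⬝ᵥ state φ A B (fun k => u k ω) T)} ∪
      {ω | 101 * ((n : ℝ) + p) ≤ 1 / 4 * (u T ω ⬝ᵥ u T ω)}) ?_).trans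
    ((measureReal_union_le _ _).trans (by linarith))
  intro ω hω
  by_contra hcon
  simp only [Set.mem_union, Set.mem_ofPred_eq, not_or, not_le] at hcon hω
  set h := state φ A B (fun k => u k ω) T
  have hx : sampleInput φ A B (1 / b) T (fun k => u k ω) ⬝ᵥ sampleInput φ A B (1 / b) T (fun k => u k ω)
      = 4 * (1 / (4 * b ^ 2) * (h ⬝ᵥ h)) + u T ω ⬝ᵥ u T ω := by
    simp only [dotProduct, Fintype.sum_sum_type, sampleInput, Sum.elim_inl, Sum.elim_inr,
      Finset.mul_sum, Pi.smul_apply, smul_eq_mul]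
    congr 1
    refine Finset.sum_congr rfl fun i _ => ?_
    simp only [h]
    field_simp
  rw [hx] at hω
  linarith [hcon.1, hcon.2]

end

/-! ### Nets of the sphere and quadratic forms. -/

section

variable {ι : Type} [Fintype ι]

/-- A maximal `1`-separated subset of the sphere of radius `2`, of cardinality at most `5 ^ d`. -/
theorem exists_separated_maximal (E : Type*) [NormedAddCommGroup E] [NormedSpace ℝ E]
    [FiniteDimensional ℝ E] :
    ∃ s : Finset E, s.card ≤ 5 ^ Module.finrank ℝ E ∧ (∀ v ∈ s, ‖v‖ = 2) ∧
      ∀ v, ‖v‖ = 2 → ∃ w ∈ s, ‖v - w‖ ≤ 1 := by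
  classical
  let good : Finset E → Prop := fun s => (∀ v ∈ s, ‖v‖ = 2) ∧ ∀ c ∈ s, ∀ d ∈ s, c ≠ d → 1 ≤ ‖c - d‖
  have hcard : ∀ s, good s → s.card ≤ 5 ^ Module.finrank ℝ E := fun s hs =>
    Besicovitch.card_le_of_separated s (fun c hc => (hs.1 c hc).le) hs.2
  let S : Set ℕ := {k | ∃ s, good s ∧ s.card = k}
  have hS : BddAbove S := ⟨5 ^ Module.finrank ℝ E, by
    rintro _ ⟨s, hs, rfl⟩
    exact hcard s hs⟩
  have hne : S.Nonempty := ⟨0, ∅, by simp [good], rfl⟩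
  obtain ⟨s, hs, hmax⟩ := Nat.sSup_mem hne hS
  refine ⟨s, hcard s hs, hs.1, fun v hv => ?_⟩
  by_contra! hcon
  have hvs : v ∉ s := fun h => by
    have := hcon v h
    simp at this
    linarith
  have hgood : good (insert v s) := by
    refine ⟨fun w hw => ?_, fun c hc d hd hcd => ?_⟩
    · rcases Finset.mem_insert.1 hw with rfl | hw
      · exact hv
      · exact hs.1 w hw
    · rcases Finset.mem_insert.1 hc with hc' | hc' <;> rcases Finset.mem_insert.1 hd with hd' | hd'
      · exact absurd (hc'.trans hd'.symm) hcd
      · exact hc' ▸ (hcon d hd').le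
      · rw [norm_sub_rev]
        exact hd' ▸ (hcon c hc').le
      · exact hs.2 c hc' d hd' hcd
  have h1 : (insert v s).card ≤ sSup S := le_csSup hS ⟨_, hgood, rfl⟩
  rw [Finset.card_insert_of_notMem hvs, hmax] at h1
  omega

/-- A `1/2`-net of the Euclidean unit sphere of cardinality at most `5 ^ d`. -/
theorem exists_half_net (ι : Type) [Fintype ι] :
    ∃ s : Finset (ι → ℝ), s.card ≤ 5 ^ Fintype.card ι ∧ (∀ v ∈ s, v ⬝ᵥ v = 1) ∧
      ∀ v, v ⬝ᵥ v = 1 → ∃ w ∈ s, (v - w) ⬝ᵥ (v - w) ≤ 1 / 4 := by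
  classical
  obtain ⟨s, hcard, hs, hnet⟩ := exists_separated_maximal (EuclideanSpace ℝ ι)
  have key : ∀ w : EuclideanSpace ℝ ι, (WithLp.ofLp w) ⬝ᵥ (WithLp.ofLp w) = ‖w‖ ^ 2 := by
    intro w
    rw [EuclideanSpace.norm_sq_eq]
    simp [dotProduct, pow_two]
  -- Halving the radius 2 halves the separation 1, so squared distances to the net are at most 1/4.
  refine ⟨s.image fun w => (1 / 2 : ℝ) • WithLp.ofLp w, ?_, ?_, ?_⟩
  · refine Finset.card_image_le.trans (hcard.trans (le_of_eq ?_))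
    rw [finrank_euclideanSpace]
  · intro v hv
    obtain ⟨w, hw, rfl⟩ := Finset.mem_image.1 hv
    rw [smul_dotProduct, dotProduct_smul, key, hs w hw]
    norm_num
  · intro v hv
    have hv2 : ‖(WithLp.toLp 2 ((2 : ℝ) • v) : EuclideanSpace ℝ ι)‖ = 2 := by
      have h1 := key (WithLp.toLp 2 ((2 : ℝ) • v))
      rw [smul_dotProduct, dotProduct_smul, hv] at h1
      have h2 : (0 : ℝ) ≤ ‖(WithLp.toLp 2 ((2 : ℝ) • v) : EuclideanSpace ℝ ι)‖ := norm_nonneg _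
      simp only [smul_eq_mul] at h1
      nlinarith
    obtain ⟨w, hw, hvw⟩ := hnet _ hv2
    refine ⟨_, Finset.mem_image_of_mem _ hw, ?_⟩
    have h1 := key (WithLp.toLp 2 ((2 : ℝ) • v) - w)
    have h2 : v - (1 / 2 : ℝ) • WithLp.ofLp w
        = (1 / 2 : ℝ) • WithLp.ofLp (WithLp.toLp 2 ((2 : ℝ) • v) - w) := by
      ext i
      simp
      ring
    rw [h2, smul_dotProduct, dotProduct_smul, h1]
    have h3 := norm_nonneg (WithLp.toLp 2 ((2 : ℝ) • v) - w)
    simp only [smul_eq_mul]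
    nlinarith

/-- A quadratic form that is bounded by `m` on a `1/2`-net of the unit sphere is bounded by `32 m`
on the sphere. The form is given by its homogeneity and by the identity
`q v - q w = q (a + b) - q (a - b)`, where `a = (v + w) / 4` and `b = v - w`. -/
theorem abs_le_of_half_net {q : (ι → ℝ) → ℝ} (hsmul : ∀ (c : ℝ) v, q (c • v) = c ^ 2 * q v)
    (hsub : ∀ v w, q v - q w
      = q ((1 / 4 : ℝ) • (v + w) + (v - w)) - q ((1 / 4 : ℝ) • (v + w) - (v - w)))
    {K : ℝ} (hK : ∀ v, v ⬝ᵥ v = 1 → |q v| ≤ K) {s : Finset (ι → ℝ)} (hs : ∀ v ∈ s, v ⬝ᵥ v = 1)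
    (hnet : ∀ v, v ⬝ᵥ v = 1 → ∃ w ∈ s, (v - w) ⬝ᵥ (v - w) ≤ 1 / 4)
    {m : ℝ} (hm : ∀ w ∈ s, |q w| ≤ m) {v : ι → ℝ} (hv : v ⬝ᵥ v = 1) : |q v| ≤ 32 * m := by
  let S : Set ℝ := (fun v => |q v|) '' {v | v ⬝ᵥ v = 1}
  have hS : BddAbove S := ⟨K, by
    rintro _ ⟨v, hv, rfl⟩
    exact hK v hv⟩
  set Q := sSup S with hQ
  have hle : ∀ v, v ⬝ᵥ v = 1 → |q v| ≤ Q := fun v hv => le_csSup hS ⟨v, hv, rfl⟩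
  have hall : ∀ v, |q v| ≤ Q * (v ⬝ᵥ v) := by
    intro v
    rcases (dotProduct_self_nonneg' v).eq_or_lt with h0 | h0
    · have : v = 0 := dotProduct_self_eq_zero.1 h0.symm
      have h1 := hsmul 0 v
      rw [zero_smul, zero_pow two_ne_zero, zero_mul] at h1
      rw [this, h1]
      simp
    · set r := √(v ⬝ᵥ v) with hr
      have hr0 : 0 < r := Real.sqrt_pos.2 h0
      have hr2 : r ^ 2 = v ⬝ᵥ v := Real.sq_sqrt h0.le
      have h1 : (r⁻¹ • v) ⬝ᵥ (r⁻¹ • v) = 1 := by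
        rw [smul_dotProduct, dotProduct_smul, ← hr2, smul_eq_mul, smul_eq_mul]
        field_simp
      have h2 := hle _ h1
      rw [hsmul, abs_mul, abs_of_nonneg (sq_nonneg _), inv_pow, hr2, inv_mul_le_iff₀ h0] at h2
      linarith
  -- With ‖b‖² ≤ 1/4, 2‖a‖² + 2‖b‖² = 1/2 + (15/8)‖b‖² ≤ 31/32. The bound K is used only to make the
  -- supremum Q finite.
  have hstep : Q ≤ m + 31 / 32 * Q := by
    refine csSup_le ⟨_, v, hv, rfl⟩ ?_
    rintro _ ⟨v, hv, rfl⟩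
    change |q v| ≤ _
    obtain ⟨w, hw, hvw⟩ := hnet v hv
    set a := (1 / 4 : ℝ) • (v + w) with ha
    set b := v - w with hb
    have hw1 := hs w hw
    have hQ0 : 0 ≤ Q := (abs_nonneg _).trans (hle v hv)
    have hab : (a + b) ⬝ᵥ (a + b) + (a - b) ⬝ᵥ (a - b) = 2 * (a ⬝ᵥ a) + 2 * (b ⬝ᵥ b) := by
      simp only [add_dotProduct, sub_dotProduct, dotProduct_add, dotProduct_sub]
      ring
    have haa : a ⬝ᵥ a = (4 - b ⬝ᵥ b) / 16 := by
      have : b ⬝ᵥ b = 2 - 2 * (v ⬝ᵥ w) := by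
        rw [hb, sub_dotProduct, dotProduct_sub, dotProduct_sub, hv, hw1, dotProduct_comm w v]
        ring
      rw [this, ha, smul_dotProduct, dotProduct_smul, add_dotProduct, dotProduct_add,
        dotProduct_add, hv, hw1, dotProduct_comm w v]
      simp only [smul_eq_mul]
      ring
    have h1 : |q v| ≤ |q w| + (|q (a + b)| + |q (a - b)|) := by
      have h2 : q v = q w + (q (a + b) - q (a - b)) := by
        rw [ha, hb, ← hsub]
        ring
      rw [h2]
      exact (abs_add_le _ _).trans (add_le_add le_rfl (abs_sub _ _))
    have h3 : |q (a + b)| + |q (a - b)| ≤ Q * (2 * (a ⬝ᵥ a) + 2 * (b ⬝ᵥ b)) := by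
      rw [← hab, mul_add]
      exact add_le_add (hall _) (hall _)
    have h4 : Q * (2 * (a ⬝ᵥ a) + 2 * (b ⬝ᵥ b)) ≤ Q * (31 / 32) :=
      mul_le_mul_of_nonneg_left (by rw [haa]; linarith) hQ0
    linarith [hm w hw]
  linarith [hle v hv]

end

/-! ### A Bernstein inequality for nonnegative variables with exponential moments. -/

section

variable {Ω : Type*} [MeasurableSpace Ω] {P : Measure Ω}

theorem abs_exp_sub_one_sub_le (x : ℝ) : |Real.exp x - 1 - x| ≤ x ^ 2 * Real.exp |x| := by
  have h := Complex.norm_exp_sub_sum_le_norm_mul_exp (x : ℂ) 2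
  have e : Complex.exp (x : ℂ) - ∑ m ∈ Finset.range 2, (x : ℂ) ^ m / m.factorial
      = ((Real.exp x - 1 - x : ℝ) : ℂ) := by
    simp [Finset.sum_range_succ]
    ring
  rw [e, Complex.norm_real, Complex.norm_real, Real.norm_eq_abs, Real.norm_eq_abs, sq_abs] at h
  exact h

theorem integrable_exp_div_ten {Z : Ω → ℝ} (hZ : AEMeasurable Z P)
    (hE : ∫⁻ ω, ENNReal.ofReal (Real.exp (Z ω / 10)) ∂P ≤ 2) :
    Integrable (fun ω => Real.exp (Z ω / 10)) P ∧ ∫ ω, Real.exp (Z ω / 10) ∂P ≤ 2 := by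
  have hm : AEStronglyMeasurable (fun ω => Real.exp (Z ω / 10)) P :=
    (hZ.div_const 10).exp.aestronglyMeasurable
  have h0 : 0 ≤ᵐ[P] fun ω => Real.exp (Z ω / 10) := .of_forall fun ω => (Real.exp_pos _).le
  refine ⟨⟨hm, ?_⟩, ?_⟩
  · rw [hasFiniteIntegral_iff_ofReal h0]
    exact hE.trans_lt (by simp)
  · rw [integral_eq_lintegral_of_nonneg_ae h0 hm]
    exact ENNReal.toReal_le_of_le_ofReal (by norm_num) (hE.trans (by simp))

/-- A nonnegative random variable with `E exp(Z / 10) ≤ 2` has mean at most `10`. -/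
theorem integrable_of_exp_div_ten [IsProbabilityMeasure P] {Z : Ω → ℝ} (hZ : AEMeasurable Z P)
    (h0 : ∀ ω, 0 ≤ Z ω)
    (hE : ∫⁻ ω, ENNReal.ofReal (Real.exp (Z ω / 10)) ∂P ≤ 2) :
    Integrable Z P ∧ 0 ≤ ∫ ω, Z ω ∂P ∧ ∫ ω, Z ω ∂P ≤ 10 := by
  obtain ⟨h1, h2⟩ := integrable_exp_div_ten hZ hE
  have hle : ∀ ω, Z ω ≤ 10 * Real.exp (Z ω / 10) - 10 := fun ω => by
    have := Real.add_one_le_exp (Z ω / 10)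
    linarith
  have hi : Integrable (fun ω => 10 * Real.exp (Z ω / 10) - 10) P :=
    (h1.const_mul 10).sub (integrable_const _)
  have hZi : Integrable Z P := hi.mono' hZ.aestronglyMeasurable (.of_forall fun ω => by
    rw [Real.norm_eq_abs, abs_of_nonneg (h0 ω)]
    exact hle ω)
  refine ⟨hZi, integral_nonneg h0, (integral_mono hZi hi hle).trans ?_⟩
  rw [integral_sub (h1.const_mul 10) (integrable_const _), integral_const_mul]
  simp
  linarith

/-- The centred moment generating function of a nonnegative random variable with
`E exp(Z / 10) ≤ 2`. -/
theorem mgf_sub_integral_le [IsProbabilityMeasure P] {Z : Ω → ℝ} (hZ : AEMeasurable Z P)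
    (h0 : ∀ ω, 0 ≤ Z ω) (hE : ∫⁻ ω, ENNReal.ofReal (Real.exp (Z ω / 10)) ∂P ≤ 2)
    {θ : ℝ} (hθ : |θ| ≤ 1 / 20) :
    mgf (fun ω => Z ω - ∫ ω', Z ω' ∂P) P θ ≤ Real.exp (3200 * θ ^ 2) ∧
      Integrable (fun ω => Real.exp (θ * (Z ω - ∫ ω', Z ω' ∂P))) P := by
  obtain ⟨h1, h2⟩ := integrable_exp_div_ten hZ hE
  obtain ⟨hZi, hm0, hm10⟩ := integrable_of_exp_div_ten hZ h0 hE
  set m := ∫ ω', Z ω' ∂P with hm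
  -- Second-order Taylor bound with remainder x² exp|x|. Since |θ| ≤ 1/20 and m ≤ 10, the factor
  -- exp|x| is at most 2 exp(Z/20) and (Z - m)² at most 800 exp(Z/20); their product involves only
  -- the controlled moment exp(Z/10).
  have hpt : ∀ ω, Real.exp (θ * (Z ω - m))
      ≤ 1 + θ * (Z ω - m) + 1600 * θ ^ 2 * Real.exp (Z ω / 10) := by
    intro ω
    have e1 := (le_abs_self _).trans (abs_exp_sub_one_sub_le (θ * (Z ω - m)))
    have e2 : |θ * (Z ω - m)| ≤ Z ω / 20 + 1 / 2 := by
      rw [abs_mul]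
      have : |Z ω - m| ≤ Z ω + m := abs_le.2 ⟨by linarith [h0 ω], by linarith [h0 ω]⟩
      calc |θ| * |Z ω - m| ≤ 1 / 20 * (Z ω + m) :=
            mul_le_mul hθ this (abs_nonneg _) (by norm_num)
        _ ≤ Z ω / 20 + 1 / 2 := by linarith
    have e3 : Real.exp |θ * (Z ω - m)| ≤ Real.exp (Z ω / 20) * 2 := by
      refine (Real.exp_le_exp.2 e2).trans ?_
      rw [Real.exp_add]
      refine mul_le_mul_of_nonneg_left ?_ (Real.exp_pos _).le
      have h4 : Real.exp (1 / 2) ^ 2 = Real.exp 1 := by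
        rw [← Real.exp_nat_mul]
        norm_num
      have := Real.exp_one_lt_d9
      nlinarith [Real.exp_pos (1 / 2)]
    have e4 : (Z ω - m) ^ 2 ≤ 800 * Real.exp (Z ω / 20) := by
      have h5 := Real.quadratic_le_exp_of_nonneg (x := Z ω / 20) (by linarith [h0 ω])
      have h6 : 0 ≤ Z ω := h0 ω
      nlinarith
    have e5 : Real.exp (Z ω / 10) = Real.exp (Z ω / 20) * Real.exp (Z ω / 20) := by
      rw [← Real.exp_add]
      congr 1
      ring
    have e6 : (θ * (Z ω - m)) ^ 2 * Real.exp |θ * (Z ω - m)|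
        ≤ 1600 * θ ^ 2 * Real.exp (Z ω / 10) := by
      rw [e5, mul_pow]
      calc θ ^ 2 * (Z ω - m) ^ 2 * Real.exp |θ * (Z ω - m)|
          ≤ θ ^ 2 * (800 * Real.exp (Z ω / 20)) * (Real.exp (Z ω / 20) * 2) := by gcongr
        _ = _ := by ring
    linarith
  have hi1 : Integrable (fun ω => θ * (Z ω - m)) P :=
    (hZi.sub (integrable_const m)).const_mul θ
  have hi2 : Integrable (fun ω => 1 + θ * (Z ω - m)) P := (integrable_const _).add hi1
  have hi : Integrable (fun ω => 1 + θ * (Z ω - m) + 1600 * θ ^ 2 * Real.exp (Z ω / 10)) P :=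
    hi2.add (h1.const_mul _)
  have hexp : Integrable (fun ω => Real.exp (θ * (Z ω - m))) P :=
    hi.mono' ((hZ.sub_const m).const_mul θ).exp.aestronglyMeasurable (.of_forall fun ω => by
      rw [Real.norm_eq_abs, abs_of_pos (Real.exp_pos _)]
      exact hpt ω)
  refine ⟨(integral_mono hexp hi hpt).trans ?_, hexp⟩
  rw [integral_add hi2 (h1.const_mul _),
    integral_add (integrable_const _) hi1, integral_const_mul, integral_const_mul,
    integral_sub hZi (integrable_const m), ← hm]
  simp only [integral_const, probReal_univ, smul_eq_mul, one_mul, sub_self, mul_zero, add_zero]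
  have := Real.add_one_le_exp (3200 * θ ^ 2)
  nlinarith [sq_nonneg θ]

/-- A Bernstein type bound for a sum of independent nonnegative random variables with
`E exp(Z / 10) ≤ 2` and the same mean. -/
theorem measureReal_abs_sum_sub_ge_le [IsProbabilityMeasure P] {κ : Type*} [Fintype κ]
    {Z : κ → Ω → ℝ} (hind : iIndepFun Z P) (hZ : ∀ k, AEMeasurable (Z k) P)
    (h0 : ∀ k ω, 0 ≤ Z k ω)
    (hE : ∀ k, ∫⁻ ω, ENNReal.ofReal (Real.exp (Z k ω / 10)) ∂P ≤ 2)
    {m : ℝ} (hm : ∀ k, ∫ ω, Z k ω ∂P = m) {δ : ℝ} (hδ : 0 ≤ δ) (hδ1 : δ ≤ 1) :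
    P.real {ω | Fintype.card κ * δ ≤ |∑ k, Z k ω - Fintype.card κ * m|}
      ≤ 2 * Real.exp (-(Fintype.card κ * δ ^ 2 / 12800)) := by
  set M : ℝ := (Fintype.card κ : ℝ) with hM
  have hind' : iIndepFun (fun k ω => Z k ω - m) P :=
    hind.comp (fun _ x => x - m) fun _ => measurable_id.sub_const m
  have hZ' : ∀ k, AEMeasurable (fun ω => Z k ω - m) P := fun k => (hZ k).sub_const m
  have hsum : ∀ ω, (∑ k, fun ω => Z k ω - m) ω = ∑ k, Z k ω - M * m := by
    intro ω
    simp [M]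
  have hbound : ∀ θ : ℝ, |θ| ≤ 1 / 20 →
      mgf (∑ k, fun ω => Z k ω - m) P θ ≤ Real.exp (3200 * θ ^ 2) ^ Fintype.card κ ∧
      Integrable (fun ω => Real.exp (θ * (∑ k, fun ω => Z k ω - m) ω)) P := by
    intro θ hθ
    have hk : ∀ k, mgf (fun ω => Z k ω - m) P θ ≤ Real.exp (3200 * θ ^ 2) ∧
        Integrable (fun ω => Real.exp (θ * (Z k ω - m))) P := fun k => by
      have := mgf_sub_integral_le (hZ k) (h0 k) (hE k) hθ
      rwa [hm k] at this
    refine ⟨?_, ?_⟩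
    · rw [hind'.mgf_sum₀ hZ']
      exact (Finset.prod_le_prod (fun k _ => mgf_nonneg) fun k _ => (hk k).1).trans (by simp)
    -- A nonintegrable exponential would have integral 0 by convention, contradicting the product of
    -- positive moment generating functions.
    · by_contra hcon
      have h1 := hind'.mgf_sum₀ hZ' (t := θ) Finset.univ
      rw [mgf, integral_undef hcon] at h1
      exact (Finset.prod_pos fun k _ => mgf_pos (hk k).2).ne h1
  -- The value |θ| = δ/6400 minimises 3200 θ² - |θ| δ.
  have hfin : ∀ θ : ℝ, θ ^ 2 = (δ / 6400) ^ 2 →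
      Real.exp (-(δ / 6400) * (M * δ)) * Real.exp (3200 * θ ^ 2) ^ Fintype.card κ
        = Real.exp (-(M * δ ^ 2 / 12800)) := by
    intro θ hθ
    rw [← Real.exp_nat_mul, ← Real.exp_add, hθ]
    congr 1
    ring
  have hθ1 : |δ / 6400| ≤ 1 / 20 := by
    rw [abs_of_nonneg (by positivity)]
    linarith
  have hup := measure_ge_le_exp_mul_mgf (M * δ) (by positivity : 0 ≤ δ / 6400) (hbound _ hθ1).2
  have hlo := measure_le_le_exp_mul_mgf (-(M * δ)) (by linarith : -(δ / 6400) ≤ 0)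
    (hbound (-(δ / 6400)) (by rwa [abs_neg])).2
  have hup' := hup.trans (mul_le_mul_of_nonneg_left (hbound _ hθ1).1 (Real.exp_pos _).le)
  have hlo' := hlo.trans (mul_le_mul_of_nonneg_left
    (hbound (-(δ / 6400)) (by rwa [abs_neg])).1 (Real.exp_pos _).le)
  rw [hfin _ rfl] at hup'
  rw [show -(-(δ / 6400)) * -(M * δ) = -(δ / 6400) * (M * δ) by ring, hfin _ (by ring)] at hlo'
  refine (measureReal_mono (s₂ := {ω | M * δ ≤ (∑ k, fun ω => Z k ω - m) ω} ∪
    {ω | (∑ k, fun ω => Z k ω - m) ω ≤ -(M * δ)}) ?_).trans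
    ((measureReal_union_le _ _).trans (by linarith))
  intro ω hω
  simp only [Set.mem_union, Set.mem_ofPred_eq, hsum] at hω ⊢
  rcases le_abs'.1 hω with h | h
  · exact Or.inr h
  · exact Or.inl h

end

/-! ### Joint laws and independence under regrouping of indices. -/

section

variable {α γ : Type} [Fintype α] [Fintype γ] {E : Type*} [MeasurableSpace E]
  {Ω : Type*} [MeasurableSpace Ω] {P : Measure Ω}

theorem pi_map_curry (μ : α → γ → Measure E) [∀ a b, IsProbabilityMeasure (μ a b)] :
    (Measure.pi fun z : α × γ => μ z.1 z.2).map (MeasurableEquiv.curry α γ E)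
      = Measure.pi fun a => Measure.pi fun b => μ a b := by
  have h := Measure.infinitePi_map_curry μ
  simpa only [Measure.infinitePi_eq_pi] using h

theorem hasLaw_uncurry_stdG {X : α → Ω → γ → ℝ} (hX : ∀ a, HasLaw (X a) (stdG γ) P)
    (hind : iIndepFun X P) :
    HasLaw (fun ω (z : α × γ) => X z.1 ω z.2) (stdG (α × γ)) P := by
  have hm : ∀ a, AEMeasurable (X a) P := fun a => (hX a).aemeasurable
  have hc := pi_map_curry (α := α) (γ := γ) fun _ _ => gaussianReal 0 1
  rw [MeasurableEquiv.map_apply_eq_iff_map_symm_apply_eq] at hc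
  have h1 := hind.map_fun_eq_pi_map hm
  simp_rw [fun a => (hX a).map_eq] at h1
  have hm' : AEMeasurable (fun ω a => X a ω) P := aemeasurable_pi_lambda _ hm
  have hcm := (MeasurableEquiv.curry α γ ℝ).symm.measurable
  refine ⟨hcm.comp_aemeasurable hm', ?_⟩
  have h2 := AEMeasurable.map_map_of_aemeasurable (μ := P) hcm.aemeasurable hm'
  rw [h1] at h2
  exact h2.symm.trans hc.symm

/-- Blocks of an independent family are independent, because currying turns the product law into a
product of product laws. It is applied first to time steps within trajectories, then to the two
members of each pair. -/
theorem iIndepFun_curry [IsProbabilityMeasure P] {X : α × γ → Ω → E} (hX : ∀ z, AEMeasurable (X z) P)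
    (hind : iIndepFun X P) : iIndepFun (fun a ω b => X (a, b) ω) P := by
  have hm : ∀ a, AEMeasurable (fun ω b => X (a, b) ω) P := fun a =>
    aemeasurable_pi_lambda _ fun b => hX (a, b)
  have hp : ∀ z, IsProbabilityMeasure (P.map (X z)) := fun z =>
    Measure.isProbabilityMeasure_map (hX z)
  rw [iIndepFun_iff_map_fun_eq_pi_map hm]
  have h1 : ∀ a, P.map (fun ω b => X (a, b) ω) = Measure.pi fun b => P.map (X (a, b)) := fun a =>
    (hind.precomp (g := fun b => (a, b)) (Prod.mk_right_injective a)).map_fun_eq_pi_map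
      fun b => hX (a, b)
  simp_rw [h1]
  rw [← pi_map_curry fun a b => P.map (X (a, b)), ← hind.map_fun_eq_pi_map hX,
    AEMeasurable.map_map_of_aemeasurable (MeasurableEquiv.measurable _).aemeasurable
      (aemeasurable_pi_lambda _ hX)]
  rfl

end

/-! ### Pairs of independent trajectories. -/

section

variable {n p : ℕ} {β : ℝ} {φ φ' : ℝ → ℝ} {A : Matrix (Fin n) (Fin n) ℝ}
  {B : Matrix (Fin n) (Fin p) ℝ}

theorem sampleInput_inputSeq (φ : ℝ → ℝ) (A : Matrix (Fin n) (Fin n) ℝ)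
    (B : Matrix (Fin n) (Fin p) ℝ) (μ : ℝ) (T : ℕ) (u : ℕ → Fin p → ℝ) :
    sampleInput φ A B μ T (inputSeq T fun z => u z.1 z.2) = sampleInput φ A B μ T u := by
  have h : ∀ s ≤ T, inputSeq T (fun z => u z.1 z.2) s = u s := fun s hs => by
    ext k
    simp [inputSeq, Nat.lt_succ_of_le hs]
  rw [sampleInput, sampleInput, h T le_rfl, state_congr fun s hs => h s hs.le]

variable {Ω : Type*} [MeasurableSpace Ω] {P : Measure Ω} [IsProbabilityMeasure P]

/-- The second moment of the difference of two independent regression inputs in the direction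
`w`. -/
noncomputable def diffMoment (φ : ℝ → ℝ) (A : Matrix (Fin n) (Fin n) ℝ)
    (B : Matrix (Fin n) (Fin p) ℝ) (μ : ℝ) (T : ℕ) (w : Fin n ⊕ Fin p → ℝ) : ℝ :=
  ∫ z, (w ⬝ᵥ sampleInput φ A B μ T (inputSeq T z.1)
    - w ⬝ᵥ sampleInput φ A B μ T (inputSeq T z.2)) ^ 2
    ∂((stdG (Fin (T + 1) × Fin p)).prod (stdG (Fin (T + 1) × Fin p)))

/-- Pairs of independent trajectories are independent and follow the product Gaussian law. -/
theorem hasLaw_pairs {M T : ℕ} {u : Fin M × Fin 2 → ℕ → Ω → Fin p → ℝ}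
    (hu : ∀ a t, HasLaw (u a t) (stdG (Fin p)) P)
    (hind : iIndepFun (fun z : (Fin M × Fin 2) × ℕ => u z.1 z.2) P) :
    (∀ k, HasLaw (fun ω => ((fun z : Fin (T + 1) × Fin p => u (k, 0) z.1 ω z.2),
        fun z : Fin (T + 1) × Fin p => u (k, 1) z.1 ω z.2))
      ((stdG (Fin (T + 1) × Fin p)).prod (stdG (Fin (T + 1) × Fin p))) P) ∧
    iIndepFun (fun k ω => ((fun z : Fin (T + 1) × Fin p => u (k, 0) z.1 ω z.2),
        fun z : Fin (T + 1) × Fin p => u (k, 1) z.1 ω z.2)) P := by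
  let U : Fin M × Fin 2 → Ω → Fin (T + 1) × Fin p → ℝ := fun a ω z => u a z.1 ω z.2
  have hlaw : ∀ a, HasLaw (U a) (stdG (Fin (T + 1) × Fin p)) P := fun a =>
    hasLaw_uncurry_stdG (X := fun (t : Fin (T + 1)) => u a t) (fun t => hu a t)
      (hind.precomp (g := fun t : Fin (T + 1) => (a, (t : ℕ))) fun s t h => by
        simpa [Fin.ext_iff] using h)
  have hU : iIndepFun U P := by
    have h1 := hind.precomp (g := fun z : (Fin M × Fin 2) × Fin (T + 1) => (z.1, (z.2 : ℕ)))
      (fun z z' h => by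
        rw [Prod.mk.injEq] at h
        exact Prod.ext h.1 (Fin.ext h.2))
    have h2 := iIndepFun_curry (X := fun z : (Fin M × Fin 2) × Fin (T + 1) => u z.1 z.2)
      (fun z => (hu z.1 z.2).aemeasurable) h1
    exact h2.comp (fun _ v (z : Fin (T + 1) × Fin p) => v z.1 z.2) fun _ => by fun_prop
  have hUm : ∀ a, AEMeasurable (U a) P := fun a => (hlaw a).aemeasurable
  have hV := iIndepFun_curry hUm hU
  have hpair := measurePreserving_finTwoArrow (stdG (Fin (T + 1) × Fin p))
  refine ⟨fun k => ?_, hV.comp (fun _ => MeasurableEquiv.finTwoArrow)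
    fun _ => MeasurableEquiv.measurable _⟩
  have h3 : HasLaw (fun ω b => U (k, b) ω) (Measure.pi fun _ => stdG (Fin (T + 1) × Fin p)) P := by
    refine ⟨aemeasurable_pi_lambda _ fun b => hUm _, ?_⟩
    have h4 := (hU.precomp (g := fun b => (k, b)) (Prod.mk_right_injective k)).map_fun_eq_pi_map
      fun b => hUm (k, b)
    simp_rw [fun b => (hlaw (k, b)).map_eq] at h4
    exact h4
  exact hpair.hasLaw.comp h3

end

/-! ### Uniform concentration of the pair differences. -/

section

variable {n p : ℕ} {β : ℝ} {φ φ' : ℝ → ℝ} {A : Matrix (Fin n) (Fin n) ℝ}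
  {B : Matrix (Fin n) (Fin p) ℝ}

theorem integrable_sq_diff (hφ : IsIncreasingActivation β φ φ') (hβ : 0 < β) {T : ℕ}
    (hB : 0 < stateBound A B T) (w : Fin n ⊕ Fin p → ℝ) :
    Integrable (fun z : (Fin (T + 1) × Fin p → ℝ) × (Fin (T + 1) × Fin p → ℝ) =>
      (w ⬝ᵥ sampleInput φ A B (1 / stateBound A B T) T (inputSeq T z.1)
        - w ⬝ᵥ sampleInput φ A B (1 / stateBound A B T) T (inputSeq T z.2)) ^ 2)
      ((stdG (Fin (T + 1) × Fin p)).prod (stdG (Fin (T + 1) × Fin p))) :=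
  (MemLp.prod_sub ((euclLipschitz_dotProduct_sampleInput hφ hβ hB w).memLp_two
    (Real.sqrt_nonneg _))).integrable_sq

theorem diffMoment_smul (φ : ℝ → ℝ) (A : Matrix (Fin n) (Fin n) ℝ) (B : Matrix (Fin n) (Fin p) ℝ)
    (μ : ℝ) (T : ℕ) (c : ℝ) (w : Fin n ⊕ Fin p → ℝ) :
    diffMoment φ A B μ T (c • w) = c ^ 2 * diffMoment φ A B μ T w := by
  rw [diffMoment, diffMoment, ← integral_const_mul]
  congr 1
  funext z
  simp only [smul_dotProduct, smul_eq_mul]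
  ring

/-- Polarisation under the integral. With homogeneity this is all that the net argument requires of
the quadratic form. -/
theorem diffMoment_sub (hφ : IsIncreasingActivation β φ φ') (hβ : 0 < β) {T : ℕ}
    (hB : 0 < stateBound A B T) (v w : Fin n ⊕ Fin p → ℝ) :
    diffMoment φ A B (1 / stateBound A B T) T v - diffMoment φ A B (1 / stateBound A B T) T w
      = diffMoment φ A B (1 / stateBound A B T) T ((1 / 4 : ℝ) • (v + w) + (v - w))
        - diffMoment φ A B (1 / stateBound A B T) T ((1 / 4 : ℝ) • (v + w) - (v - w)) := by
  simp only [diffMoment]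
  rw [← integral_sub (integrable_sq_diff hφ hβ hB _) (integrable_sq_diff hφ hβ hB _),
    ← integral_sub (integrable_sq_diff hφ hβ hB _) (integrable_sq_diff hφ hβ hB _)]
  congr 1
  funext z
  simp only [smul_dotProduct, smul_eq_mul, add_dotProduct, sub_dotProduct]
  ring

theorem lintegral_exp_sq_diff_le (hφ : IsIncreasingActivation β φ φ') (hβ : 0 < β) {T : ℕ}
    (hB : 0 < stateBound A B T) {w : Fin n ⊕ Fin p → ℝ} (hw : w ⬝ᵥ w = 1) :
    ∫⁻ z, ENNReal.ofReal (Real.exp ((w ⬝ᵥ sampleInput φ A B (1 / stateBound A B T) T (inputSeq T z.1)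
        - w ⬝ᵥ sampleInput φ A B (1 / stateBound A B T) T (inputSeq T z.2)) ^ 2 / 10))
      ∂((stdG (Fin (T + 1) × Fin p)).prod (stdG (Fin (T + 1) × Fin p))) ≤ 2 := by
  have h := euclLipschitz_dotProduct_sampleInput (A := A) hφ hβ hB w
  rw [hw, Real.sqrt_one] at h
  exact h.lintegral_exp_sq_le

theorem abs_diffMoment_le (hφ : IsIncreasingActivation β φ φ') (hβ : 0 < β) {T : ℕ}
    (hB : 0 < stateBound A B T) {w : Fin n ⊕ Fin p → ℝ} (hw : w ⬝ᵥ w = 1) :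
    |diffMoment φ A B (1 / stateBound A B T) T w| ≤ 10 := by
  obtain ⟨-, h0, h10⟩ := integrable_of_exp_div_ten
    (integrable_sq_diff (A := A) hφ hβ hB w).aemeasurable (fun z => sq_nonneg _)
    (lintegral_exp_sq_diff_le hφ hβ hB hw)
  exact abs_le.2 ⟨by rw [diffMoment]; linarith, h10⟩

variable {Ω : Type*} [MeasurableSpace Ω] {P : Measure Ω} [IsProbabilityMeasure P]

/-- Concentration of the empirical second moment of the pair differences in one direction. -/
theorem measureReal_sum_sq_diff_ge_le (hφ : IsIncreasingActivation β φ φ') (hβ : 0 < β) {M T : ℕ}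
    (hB : 0 < stateBound A B T) {u : Fin M × Fin 2 → ℕ → Ω → Fin p → ℝ}
    (hu : ∀ a t, HasLaw (u a t) (stdG (Fin p)) P)
    (hind : iIndepFun (fun z : (Fin M × Fin 2) × ℕ => u z.1 z.2) P)
    {w : Fin n ⊕ Fin p → ℝ} (hw : w ⬝ᵥ w = 1) {δ : ℝ} (hδ : 0 ≤ δ) (hδ1 : δ ≤ 1) :
    P.real {ω | M * δ ≤ |∑ k : Fin M,
        (w ⬝ᵥ sampleInput φ A B (1 / stateBound A B T) T (fun t => u (k, 0) t ω)
          - w ⬝ᵥ sampleInput φ A B (1 / stateBound A B T) T (fun t => u (k, 1) t ω)) ^ 2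
        - M * diffMoment φ A B (1 / stateBound A B T) T w|}
      ≤ 2 * Real.exp (-(M * δ ^ 2 / 12800)) := by
  obtain ⟨hlaw, hindV⟩ := hasLaw_pairs (T := T) hu hind
  let F : (Fin (T + 1) × Fin p → ℝ) × (Fin (T + 1) × Fin p → ℝ) → ℝ := fun z =>
    (w ⬝ᵥ sampleInput φ A B (1 / stateBound A B T) T (inputSeq T z.1)
      - w ⬝ᵥ sampleInput φ A B (1 / stateBound A B T) T (inputSeq T z.2)) ^ 2
  have hf := (euclLipschitz_dotProduct_sampleInput (A := A) hφ hβ hB w).measurable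
    (Real.sqrt_nonneg _)
  have hF : Measurable F :=
    ((hf.comp measurable_fst).sub (hf.comp measurable_snd)).pow_const 2
  have hFu : ∀ k ω, (w ⬝ᵥ sampleInput φ A B (1 / stateBound A B T) T (fun t => u (k, 0) t ω)
          - w ⬝ᵥ sampleInput φ A B (1 / stateBound A B T) T (fun t => u (k, 1) t ω)) ^ 2
      = F ((fun z : Fin (T + 1) × Fin p => u (k, 0) z.1 ω z.2),
        fun z : Fin (T + 1) × Fin p => u (k, 1) z.1 ω z.2) := by
    intro k ω
    simp only [F]
    rw [sampleInput_inputSeq φ A B _ T fun t => u (k, 0) t ω,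
      sampleInput_inputSeq φ A B _ T fun t => u (k, 1) t ω]
  simp only [hFu]
  have h := measureReal_abs_sum_sub_ge_le (P := P) (m := diffMoment φ A B (1 / stateBound A B T) T w)
    (hindV.comp (fun _ => F) fun _ => hF)
    (fun k => hF.comp_aemeasurable (hlaw k).aemeasurable) (fun k ω => sq_nonneg _)
    (fun k => ?_) (fun k => ?_) hδ hδ1
  · rw [Fintype.card_fin] at h
    exact h
  · have h1 := lintegral_map' (μ := P) (f := fun z => ENNReal.ofReal (Real.exp (F z / 10)))
      (hF.div_const 10).exp.ennreal_ofReal.aemeasurable (hlaw k).aemeasurable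
    rw [(hlaw k).map_eq] at h1
    exact h1.symm.trans_le (lintegral_exp_sq_diff_le hφ hβ hB hw)
  · have h1 := integral_map (hlaw k).aemeasurable (f := F) hF.aestronglyMeasurable
    rw [(hlaw k).map_eq] at h1
    exact h1.symm

/-- Concentration of the empirical second moment of the pair differences, uniformly over the unit
sphere. -/
theorem measureReal_not_forall_sum_sq_diff_le (hφ : IsIncreasingActivation β φ φ') (hβ : 0 < β)
    {M T : ℕ} (hB : 0 < stateBound A B T) {u : Fin M × Fin 2 → ℕ → Ω → Fin p → ℝ}
    (hu : ∀ a t, HasLaw (u a t) (stdG (Fin p)) P)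
    (hind : iIndepFun (fun z : (Fin M × Fin 2) × ℕ => u z.1 z.2) P)
    {δ : ℝ} (hδ : 0 ≤ δ) (hδ1 : δ ≤ 1) :
    P.real {ω | ¬ ∀ w : Fin n ⊕ Fin p → ℝ, w ⬝ᵥ w = 1 → |∑ k : Fin M,
        (w ⬝ᵥ sampleInput φ A B (1 / stateBound A B T) T (fun t => u (k, 0) t ω)
          - w ⬝ᵥ sampleInput φ A B (1 / stateBound A B T) T (fun t => u (k, 1) t ω)) ^ 2
        - M * diffMoment φ A B (1 / stateBound A B T) T w| ≤ 32 * (M * δ)}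
      ≤ 5 ^ (n + p) * (2 * Real.exp (-(M * δ ^ 2 / 12800))) := by
  obtain ⟨s, hcard, hs, hnet⟩ := exists_half_net (Fin n ⊕ Fin p)
  have hsub : {ω | ¬ ∀ w : Fin n ⊕ Fin p → ℝ, w ⬝ᵥ w = 1 → |∑ k : Fin M,
        (w ⬝ᵥ sampleInput φ A B (1 / stateBound A B T) T (fun t => u (k, 0) t ω)
          - w ⬝ᵥ sampleInput φ A B (1 / stateBound A B T) T (fun t => u (k, 1) t ω)) ^ 2
        - M * diffMoment φ A B (1 / stateBound A B T) T w| ≤ 32 * (M * δ)}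
      ⊆ ⋃ w ∈ s, {ω | M * δ ≤ |∑ k : Fin M,
        (w ⬝ᵥ sampleInput φ A B (1 / stateBound A B T) T (fun t => u (k, 0) t ω)
          - w ⬝ᵥ sampleInput φ A B (1 / stateBound A B T) T (fun t => u (k, 1) t ω)) ^ 2
        - M * diffMoment φ A B (1 / stateBound A B T) T w|} := by
    intro ω hω
    by_contra hcon
    simp only [Set.mem_iUnion, Set.mem_ofPred_eq, exists_prop, not_exists, not_and, not_le] at hcon
    refine hω fun w hw => ?_
    set x : Fin M × Fin 2 → Fin n ⊕ Fin p → ℝ := fun a =>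
      sampleInput φ A B (1 / stateBound A B T) T (fun t => u a t ω) with hx
    refine abs_le_of_half_net (q := fun w => ∑ k : Fin M, (w ⬝ᵥ x (k, 0) - w ⬝ᵥ x (k, 1)) ^ 2
      - M * diffMoment φ A B (1 / stateBound A B T) T w)
      -- Any finite bound serves here; it depends on ω and does not enter the estimate.
      (K := ∑ k : Fin M, (x (k, 0) - x (k, 1)) ⬝ᵥ (x (k, 0) - x (k, 1)) + M * 10)
      (fun c v => ?_) (fun v w => ?_) (fun v hv => ?_) hs hnet (fun w hw => (hcon w hw).le) hw
    · rw [diffMoment_smul, mul_sub, Finset.mul_sum]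
      congr 1
      · refine Finset.sum_congr rfl fun k _ => ?_
        simp only [smul_dotProduct, smul_eq_mul]
        ring
      · ring
    · have h1 := diffMoment_sub (A := A) hφ hβ hB v w
      have h2 : ∑ k : Fin M, (v ⬝ᵥ x (k, 0) - v ⬝ᵥ x (k, 1)) ^ 2
          - ∑ k : Fin M, (w ⬝ᵥ x (k, 0) - w ⬝ᵥ x (k, 1)) ^ 2
          = ∑ k : Fin M, (((1 / 4 : ℝ) • (v + w) + (v - w)) ⬝ᵥ x (k, 0)
              - ((1 / 4 : ℝ) • (v + w) + (v - w)) ⬝ᵥ x (k, 1)) ^ 2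
            - ∑ k : Fin M, (((1 / 4 : ℝ) • (v + w) - (v - w)) ⬝ᵥ x (k, 0)
              - ((1 / 4 : ℝ) • (v + w) - (v - w)) ⬝ᵥ x (k, 1)) ^ 2 := by
        rw [← Finset.sum_sub_distrib, ← Finset.sum_sub_distrib]
        refine Finset.sum_congr rfl fun k _ => ?_
        simp only [smul_dotProduct, smul_eq_mul, add_dotProduct, sub_dotProduct]
        ring
      linear_combination h2 - (M : ℝ) * h1
    · refine (abs_sub _ _).trans (add_le_add ?_ ?_)
      · rw [abs_of_nonneg (Finset.sum_nonneg fun k _ => sq_nonneg _)]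
        refine Finset.sum_le_sum fun k _ => ?_
        rw [← dotProduct_sub]
        exact (dotProduct_sq_le _ _).trans (by rw [hv, one_mul])
      · rw [abs_mul, abs_of_nonneg (Nat.cast_nonneg M)]
        exact mul_le_mul_of_nonneg_left (abs_diffMoment_le hφ hβ hB hv) (Nat.cast_nonneg M)
  refine (measureReal_mono hsub (measure_ne_top P _)).trans ((measureReal_biUnion_finset_le _ _).trans
    ((Finset.sum_le_sum fun w hw =>
      measureReal_sum_sq_diff_ge_le hφ hβ hB hu hind (hs w hw) hδ hδ1).trans ?_))
  rw [Finset.sum_const, nsmul_eq_mul]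
  refine mul_le_mul_of_nonneg_right ?_ (by positivity)
  rw [Fintype.card_sum, Fintype.card_fin, Fintype.card_fin] at hcard
  exact_mod_cast hcard

end

/-! ### Pairing the samples, and the numerical constants. -/

section

/-- `N / 2` disjoint pairs of indices below `N`. -/
def pairIndex (N : ℕ) : Fin (N / 2) × Fin 2 → Fin N := fun a =>
  Fin.castLE (Nat.div_mul_le_self N 2) (finProdFinEquiv a)

theorem pairIndex_injective (N : ℕ) : Function.Injective (pairIndex N) := fun _ _ h =>
  finProdFinEquiv.injective (Fin.castLE_injective _ h)

/-- From (a - b)² ≤ 2a² + 2b² on disjoint pairs. Thus a lower bound for the centred differences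
passes to the uncentred second moments without any control of the mean. -/
theorem sum_sq_sub_le (N : ℕ) (f : Fin N → ℝ) :
    ∑ k, (f (pairIndex N (k, 0)) - f (pairIndex N (k, 1))) ^ 2 ≤ 2 * ∑ i, f i ^ 2 := by
  have h1 : ∑ a, f (pairIndex N a) ^ 2 ≤ ∑ i, f i ^ 2 := by
    refine (Finset.sum_map Finset.univ ⟨pairIndex N, pairIndex_injective N⟩
      fun i => f i ^ 2).symm.le.trans ?_
    exact Finset.sum_le_sum_of_subset_of_nonneg (Finset.subset_univ _) fun _ _ _ => sq_nonneg _
  rw [Fintype.sum_prod_type] at h1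
  refine le_trans ?_ (mul_le_mul_of_nonneg_left h1 zero_le_two)
  rw [Finset.mul_sum]
  refine Finset.sum_le_sum fun k _ => ?_
  rw [Fin.sum_univ_two]
  nlinarith [sq_nonneg (f (pairIndex N (k, 0)) + f (pairIndex N (k, 1)))]

theorem le_cast_div_two {N : ℕ} (hN : 2 ≤ N) : (N : ℝ) / 3 ≤ (N / 2 : ℕ) := by
  have h : N ≤ 3 * (N / 2) := by omega
  have h' : (N : ℝ) ≤ 3 * (N / 2 : ℕ) := by exact_mod_cast h
  linarith

/-- The net costs at most exp(2(n + p)), which the sample size condition limits to exp(2·10⁻¹⁰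
N/ρ²). The deviation exponent is at least N/(629145600 ρ²) (three times 128²·12800), leaving more
than 10⁻⁹ N/ρ². -/
theorem five_pow_mul_exp_le {n p N : ℕ} (hN : 2 ≤ N) {ρ : ℝ} (hρ : 1 ≤ ρ)
    (h : 10000000000 * ρ ^ 2 * ((n : ℝ) + p) ≤ N) :
    5 ^ (n + p) * (2 * Real.exp (-((N / 2 : ℕ) * (1 / (128 * ρ)) ^ 2 / 12800)))
      ≤ 4 * Real.exp (-(1 / 1000000000 * (N / ρ ^ 2))) := by
  have hρ0 : 0 < ρ ^ 2 := by positivity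
  have h5 : (5 : ℝ) ^ (n + p) ≤ Real.exp (2 * ((n : ℝ) + p)) := by
    have h1 : (5 : ℝ) ≤ Real.exp 2 := by
      have := Real.quadratic_le_exp_of_nonneg (x := 2) (by norm_num)
      linarith
    refine (pow_le_pow_left₀ (by norm_num) h1 _).trans (le_of_eq ?_)
    rw [← Real.exp_nat_mul]
    congr 1
    push_cast
    ring
  have hs : 10000000000 * ((n : ℝ) + p) ≤ N / ρ ^ 2 := by
    rw [le_div_iff₀ hρ0]
    linarith
  have hM : (N / ρ ^ 2) / 629145600 ≤ (N / 2 : ℕ) * (1 / (128 * ρ)) ^ 2 / 12800 := by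
    have e1 : ((N / 2 : ℕ) : ℝ) * (1 / (128 * ρ)) ^ 2 / 12800
        = ((N / 2 : ℕ) : ℝ) / ρ ^ 2 / 209715200 := by
      field_simp
      ring
    rw [e1, show (N : ℝ) / ρ ^ 2 / 629145600 = (N : ℝ) / 3 / ρ ^ 2 / 209715200 by
      field_simp
      ring]
    have := le_cast_div_two hN
    gcongr
  have hs0 : 0 ≤ (N : ℝ) / ρ ^ 2 := by positivity
  calc (5 : ℝ) ^ (n + p) * (2 * Real.exp (-((N / 2 : ℕ) * (1 / (128 * ρ)) ^ 2 / 12800)))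
      ≤ Real.exp (2 * ((n : ℝ) + p))
        * (2 * Real.exp (-((N / 2 : ℕ) * (1 / (128 * ρ)) ^ 2 / 12800))) :=
        mul_le_mul_of_nonneg_right h5 (by positivity)
    _ = 2 * Real.exp (2 * ((n : ℝ) + p) + -((N / 2 : ℕ) * (1 / (128 * ρ)) ^ 2 / 12800)) := by
        rw [Real.exp_add]
        ring
    _ ≤ 2 * Real.exp (-(1 / 1000000000 * (N / ρ ^ 2))) :=
        mul_le_mul_of_nonneg_left (Real.exp_le_exp.2 (by linarith)) zero_le_two
    _ ≤ 4 * Real.exp (-(1 / 1000000000 * (N / ρ ^ 2))) :=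
        mul_le_mul_of_nonneg_right (by norm_num) (Real.exp_pos _).le

variable {n p : ℕ} {β : ℝ} {φ φ' : ℝ → ℝ} {A : Matrix (Fin n) (Fin n) ℝ}
  {B : Matrix (Fin n) (Fin p) ℝ}

/-- The empirical covariance of the samples is bounded below if the empirical second moments of
the pair differences concentrate. -/
theorem le_avg_sq_dotProduct_of_concentration (hφ : IsIncreasingActivation β φ φ') (hβ : 0 < β)
    (hn : 1 ≤ n) (hnp : n ≤ p) (hB : 0 < sigmaMin B) {T : ℕ} (hT : 1 ≤ T) {N : ℕ} (hN : 2 ≤ N)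
    (x : Fin N → Fin n ⊕ Fin p → ℝ)
    (hx : ∀ w : Fin n ⊕ Fin p → ℝ, w ⬝ᵥ w = 1 →
      |∑ k, (w ⬝ᵥ x (pairIndex N (k, 0)) - w ⬝ᵥ x (pairIndex N (k, 1))) ^ 2
        - (N / 2 : ℕ) * diffMoment φ A B (1 / stateBound A B T) T w|
        ≤ 32 * ((N / 2 : ℕ) * (1 / (128 * condNumber β A B T))))
    (w : Fin n ⊕ Fin p → ℝ) :
    7 / (24 * condNumber β A B T) * (w ⬝ᵥ w) ≤ (N : ℝ)⁻¹ * ∑ i, (w ⬝ᵥ x i) ^ 2 := by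
  have hρ := one_le_condNumber (A := A) hφ hβ hn hnp hB hT
  set ρ := condNumber β A B T with hρdef
  have hN0 : (0 : ℝ) < N := by
    have : (2 : ℝ) ≤ N := by exact_mod_cast hN
    linarith
  have hunit : ∀ w : Fin n ⊕ Fin p → ℝ, w ⬝ᵥ w = 1 →
      7 / (24 * ρ) ≤ (N : ℝ)⁻¹ * ∑ i, (w ⬝ᵥ x i) ^ 2 := by
    intro w hw
    have h1 := (abs_le.1 (hx w hw)).1
    have h2 := le_integral_sq_dotProduct_sampleInput (A := A) hφ hβ hn hnp hB hT w
    rw [hw] at h2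
    change 2 * (1 / ρ) ≤ diffMoment φ A B (1 / stateBound A B T) T w at h2
    have h3 := sum_sq_sub_le N fun i => w ⬝ᵥ x i
    have h4 := le_cast_div_two hN
    set M : ℝ := ((N / 2 : ℕ) : ℝ)
    have hM0 : 0 ≤ M := by linarith
    have h5 := mul_le_mul_of_nonneg_left h2 hM0
    -- The deviation δ = 1/(128ρ), after the factor 32 lost to the net, is 1/(4ρ), one eighth of the
    -- population bound 2/ρ. With M ≥ N/3 pairs and the factor 2 of the pairing this gives 7/(24ρ).
    have h6 : M * (2 * (1 / ρ)) - 32 * (M * (1 / (128 * ρ))) = M * (7 / (4 * ρ)) := by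
      field_simp
      ring
    have h7 : (N : ℝ) / 3 * (7 / (4 * ρ)) ≤ M * (7 / (4 * ρ)) :=
      mul_le_mul_of_nonneg_right h4 (by positivity)
    have h8 : (N : ℝ) / 3 * (7 / (4 * ρ)) = 2 * ((7 / (24 * ρ)) * N) := by
      field_simp
      ring
    rw [inv_mul_eq_div, le_div_iff₀ hN0]
    linarith
  rcases (dotProduct_self_nonneg' w).eq_or_lt with h0 | h0
  · rw [← h0, mul_zero]
    exact mul_nonneg (by positivity) (Finset.sum_nonneg fun _ _ => sq_nonneg _)
  · set r := √(w ⬝ᵥ w) with hr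
    have hr0 : 0 < r := Real.sqrt_pos.2 h0
    have hr2 : r ^ 2 = w ⬝ᵥ w := Real.sq_sqrt h0.le
    have h1 : (r⁻¹ • w) ⬝ᵥ (r⁻¹ • w) = 1 := by
      rw [smul_dotProduct, dotProduct_smul, ← hr2, smul_eq_mul, smul_eq_mul]
      field_simp
    have h2 := hunit _ h1
    have h3 : ∑ i, ((r⁻¹ • w) ⬝ᵥ x i) ^ 2 = (w ⬝ᵥ w)⁻¹ * ∑ i, (w ⬝ᵥ x i) ^ 2 := by
      rw [Finset.mul_sum, ← hr2]
      refine Finset.sum_congr rfl fun i _ => ?_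
      rw [smul_dotProduct, smul_eq_mul, mul_pow, inv_pow]
    rw [h3, mul_left_comm, inv_mul_eq_div, le_div_iff₀ h0] at h2
    exact h2

/-- The two step size conditions for the SGD contraction. -/
theorem stepSize_bounds {β ρ d m : ℝ} (hβ : 0 < β) (hβ1 : β ≤ 1) (hρ : 1 ≤ ρ) (hd : 1 ≤ d)
    (hm : 1 ≤ m) {η : ℝ} (hη : η = 1 / 4000 * (β ^ 2 / (ρ * m * d))) :
    0 ≤ η ∧ 0 ≤ 2 * η * β ^ 2 - η ^ 2 * (1000 * d) ∧
      0 ≤ 1 - 1 / 4000 * (β ^ 4 / (2 * ρ ^ 2 * m * d)) ∧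
      1 - (2 * η * β ^ 2 - η ^ 2 * (1000 * d)) * (7 / (24 * ρ))
        ≤ 1 - 1 / 4000 * (β ^ 4 / (2 * ρ ^ 2 * m * d)) := by
  have hη0 : 0 ≤ η := by rw [hη]; positivity
  have h1 : η * (1000 * d) ≤ β ^ 2 / 4 := by
    have e : η * (1000 * d) = β ^ 2 / 4 / (ρ * m) := by
      rw [hη]
      field_simp
      ring
    rw [e]
    exact div_le_self (by positivity) (one_le_mul_of_one_le_of_one_le hρ hm)
  have h2 : η * (7 / 4 * β ^ 2) ≤ 2 * η * β ^ 2 - η ^ 2 * (1000 * d) := by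
    have := mul_le_mul_of_nonneg_left h1 hη0
    nlinarith
  have h3 : 0 ≤ η * (7 / 4 * β ^ 2) := by positivity
  refine ⟨hη0, h3.trans h2, ?_, ?_⟩
  · have h4 : β ^ 4 / (2 * ρ ^ 2 * m * d) ≤ 1 := by
      rw [div_le_one (by positivity)]
      have h5 : β ^ 4 ≤ 1 := pow_le_one₀ hβ.le hβ1
      have h6 : 1 ≤ ρ ^ 2 * m * d := one_le_mul_of_one_le_of_one_le
        (one_le_mul_of_one_le_of_one_le (one_le_pow₀ hρ) hm) hd
      nlinarith
    linarith
  · have h4 := mul_le_mul_of_nonneg_right h2 (by positivity : 0 ≤ 7 / (24 * ρ))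
    -- The quadratic term takes at most an eighth of 2ηβ²; the surplus 49/48 > 1 shows that 7/(24ρ)
    -- just suffices for the claimed rate.
    have e : η * (7 / 4 * β ^ 2) * (7 / (24 * ρ))
        = 49 / 48 * (1 / 4000 * (β ^ 4 / (2 * ρ ^ 2 * m * d))) := by
      rw [hη]
      field_simp
      ring
    have h5 : 0 ≤ 1 / 4000 * (β ^ 4 / (2 * ρ ^ 2 * m * d)) := by positivity
    linarith

end

end RNN

/-! ### Assembly: the norm bound and the covariance bound hold together. -/

/-- Learning a possibly unstable nonlinear system by SGD from one sample, at time `T₀`, of each of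
`N` independent trajectories. `u i t` is the input of the `i`-th trajectory at time `t`; the
probability space `Ω` carries the data and `Ω'` the random sample indices of SGD. -/
theorem theorem5 :
    ∃ C c c₀ : ℝ, 0 < C ∧ 0 < c ∧ 0 < c₀ ∧
      ∀ (n p N T₀ : ℕ) (β : ℝ) (φ φ' : ℝ → ℝ)
        (A : Matrix (Fin n) (Fin n) ℝ) (B : Matrix (Fin n) (Fin p) ℝ)
        (Ω : Type*) [MeasurableSpace Ω] (P : Measure Ω) [IsProbabilityMeasure P]
        (u : Fin N → ℕ → Ω → Fin p → ℝ)
        (Ω' : Type*) [MeasurableSpace Ω'] (Q : Measure Ω') [IsProbabilityMeasure Q]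
        (r : ℕ → Ω' → Fin N) (ρ μ η : ℝ),
        1 ≤ n → n ≤ p → 1 ≤ T₀ →
        0 < β → RNN.IsIncreasingActivation β φ φ' →
        0 < RNN.sigmaMin B →
        -- the inputs are i.i.d. standard normal vectors
        (∀ i t, HasLaw (u i t) (Measure.pi fun _ : Fin p => gaussianReal 0 1) P) →
        iIndepFun (fun k : Fin N × ℕ => u k.1 k.2) P →
        -- the SGD indices are i.i.d. uniform
        (∀ τ, HasLaw (r τ) (uniformOn Set.univ) Q) →
        iIndepFun r Q →
        ρ = RNN.condNumber β A B T₀ →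
        C * ρ ^ 2 * ((n : ℝ) + p) ≤ N →
        μ = 1 / RNN.stateBound A B T₀ →
        η = c₀ * (β ^ 2 / (ρ * n * ((n : ℝ) + p))) →
        ∃ E : Set Ω, MeasurableSet E ∧
          1 - 2 * (N : ℝ) * Real.exp (-100 * ((n : ℝ) + p)) - 4 * Real.exp (-(c * (N / ρ ^ 2)))
            ≤ P.real E ∧
          ∀ ω ∈ E, ∀ (Θ₀ : Matrix (Fin n) (Fin n ⊕ Fin p) ℝ) (τ : ℕ),
            Integrable (fun ω' => RNN.frobSq
              (RNN.sgd φ φ' η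
                (fun i => RNN.sampleInput φ A B μ T₀ (fun t => u i t ω))
                (fun i => RNN.sampleOutput φ A B T₀ (fun t => u i t ω))
                Θ₀ (fun s => r s ω') τ - RNN.groundTruth A B μ)) Q ∧
            ∫ ω', RNN.frobSq
              (RNN.sgd φ φ' η
                (fun i => RNN.sampleInput φ A B μ T₀ (fun t => u i t ω))
                (fun i => RNN.sampleOutput φ A B T₀ (fun t => u i t ω))
                Θ₀ (fun s => r s ω') τ - RNN.groundTruth A B μ) ∂Q
              ≤ (1 - c₀ * (β ^ 4 / (2 * ρ ^ 2 * n * ((n : ℝ) + p)))) ^ τ *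
                RNN.frobSq (Θ₀ - RNN.groundTruth A B μ) := by
  refine ⟨10000000000, 1 / 1000000000, 1 / 4000, by norm_num, by norm_num, by norm_num, ?_⟩
  intro n p N T β φ φ' A B Ω _ P _ u Ω' _ Q _ r ρ μ η hn hnp hT hβ hφ hB hu hind hr hrind hρ hN hμ hη
  have hρ1 : 1 ≤ ρ := hρ ▸ RNN.one_le_condNumber hφ hβ hn hnp hB hT
  have hsb : 0 < RNN.stateBound A B T := RNN.stateBound_pos hn hnp hB hT
  have hn1 : (1 : ℝ) ≤ n := by exact_mod_cast hn
  have hp0 : (0 : ℝ) ≤ p := Nat.cast_nonneg p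
  have hd1 : (1 : ℝ) ≤ (n : ℝ) + p := by linarith
  have hN2 : 2 ≤ N := by
    have h1 : 1 ≤ ρ ^ 2 * ((n : ℝ) + p) := one_le_mul_of_one_le_of_one_le (one_le_pow₀ hρ1) hd1
    have h2 : (2 : ℝ) ≤ N := by linarith
    exact_mod_cast h2
  subst hμ
  let x : Fin N → Ω → Fin n ⊕ Fin p → ℝ := fun i ω =>
    RNN.sampleInput φ A B (1 / RNN.stateBound A B T) T fun t => u i t ω
  let big : Set Ω := ⋃ i ∈ (Finset.univ : Finset (Fin N)),
    {ω | 1000 * ((n : ℝ) + p) < x i ω ⬝ᵥ x i ω}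
  let dev : Set Ω := {ω | ¬ ∀ w : Fin n ⊕ Fin p → ℝ, w ⬝ᵥ w = 1 →
      |∑ k, (w ⬝ᵥ x (RNN.pairIndex N (k, 0)) ω - w ⬝ᵥ x (RNN.pairIndex N (k, 1)) ω) ^ 2
        - (N / 2 : ℕ) * RNN.diffMoment φ A B (1 / RNN.stateBound A B T) T w|
        ≤ 32 * ((N / 2 : ℕ) * (1 / (128 * ρ)))}
  have hbig : P.real big ≤ 2 * (N : ℝ) * Real.exp (-100 * ((n : ℝ) + p)) := by
    refine (measureReal_biUnion_finset_le _ _).trans ((Finset.sum_le_sum fun i _ =>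
      RNN.measureReal_sampleInput_gt_le hφ hβ hsb (hu i)
        (hind.precomp (g := fun t => (i, t)) (Prod.mk_right_injective i))).trans (le_of_eq ?_))
    rw [Finset.sum_const, Finset.card_univ, Fintype.card_fin, nsmul_eq_mul]
    ring
  have hdev : P.real dev ≤ 4 * Real.exp (-(1 / 1000000000 * (N / ρ ^ 2))) := by
    refine (RNN.measureReal_not_forall_sum_sq_diff_le hφ hβ hsb
      (u := fun a => u (RNN.pairIndex N a)) (fun a t => hu _ t)
      (hind.precomp (g := fun z : (Fin (N / 2) × Fin 2) × ℕ => (RNN.pairIndex N z.1, z.2))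
        fun z z' h => ?_)
      (δ := 1 / (128 * ρ)) (by positivity) ?_).trans (RNN.five_pow_mul_exp_le hN2 hρ1 hN)
    · rw [Prod.mk.injEq] at h
      exact Prod.ext (RNN.pairIndex_injective N h.1) h.2
    · rw [div_le_one (by positivity)]
      linarith
  -- The bad event involves an uncountable union over w, and the inputs are only almost everywhere
  -- measurable. Its measurable hull has the same probability, and the complement of the hull avoids
  -- it.
  refine ⟨(toMeasurable P (big ∪ dev))ᶜ, (measurableSet_toMeasurable P _).compl, ?_, ?_⟩
  · rw [probReal_compl_eq_one_sub (measurableSet_toMeasurable P _), measureReal_def,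
      measure_toMeasurable, ← measureReal_def]
    have := measureReal_union_le (μ := P) big dev
    linarith
  · intro ω hω Θ₀ τ
    have hω' : ω ∉ big ∪ dev := fun h => hω (subset_toMeasurable P _ h)
    rw [Set.mem_union, not_or] at hω'
    obtain ⟨hωb, hωd⟩ := hω'
    obtain ⟨s1, s2, s3, s4⟩ := RNN.stepSize_bounds hβ hφ.beta_le_one hρ1 hd1 hn1 hη
    have hX : ∀ i, x i ω ⬝ᵥ x i ω ≤ 1000 * ((n : ℝ) + p) := fun i => by
      simp only [big, Set.mem_iUnion, not_exists] at hωb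
      exact not_lt.1 (hωb i (Finset.mem_univ i))
    have hl : ∀ w : Fin n ⊕ Fin p → ℝ,
        7 / (24 * ρ) * (w ⬝ᵥ w) ≤ (N : ℝ)⁻¹ * ∑ i, (w ⬝ᵥ x i ω) ^ 2 := by
      have h1 := not_not.1 hωd
      rw [hρ] at h1 ⊢
      exact RNN.le_avg_sq_dotProduct_of_concentration hφ hβ hn hnp hB hT hN2 (fun i => x i ω) h1
    exact RNN.integral_frobSq_sgd_le hφ hβ (by omega) hr hrind s1 s2 s3 s4
      (RNN.groundTruth A B (1 / RNN.stateBound A B T)) Θ₀ (fun i => x i ω)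
      (fun i => RNN.sampleOutput φ A B T fun t => u i t ω)
      (fun i j => RNN.sampleOutput_eq A B (one_div_pos.2 hsb).ne' T _ j) hX hl τ
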